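/- Let $m\ge 0$ be an integer. For $n\ge 0$ put $A(u)=\prod_{i<j}(u_i-u_j)$, $B(x)=\prod_{i<j}\sinh(x_i-x_j)$ and $C_m(\nu)=\prod_{l=1}^m\prod_{i<j}(\nu_i-\nu_j-l)$ for $u,x,\nu\in\mathbb C^n$. The trigonometric Baker--Akhiezer (BA) function with $n$ particles and multiplicity $m$ is the function $$\Phi^{(n)}_m(x,\nu)=\frac{P(x,\nu)}{B(x)^mC_m(\nu)}\,e^{2(\nu,x)},\qquad (\nu,x)=\sum_i\nu_ix_i,$$ where $P(x,\nu)=\sum_\alpha c_\alpha(\nu)e^{(\alpha,x)}$ (a finite sum over $\alpha\in\mathbb Z^n$ with $c_\alpha\in\mathbb C[\nu_1,\dots,\nu_n]$) is such that: * $P$ has leading term (highest homogeneous part in $\nu$) $B(x)^mA(\nu)^m$; * for $C_m(\nu)\ne0$, on the set $B(x)\neq 0$, $\Bigl(-\Delta+\sum_{i<j}\frac{2m(m+1)}{\sinh^2(x_i-x_j)}\Bigr)\Phi^{(n)}_m=-4(\nu,\nu)\,\Phi^{(n)}_m$; * for $C_m(\nu)\ne 0$, $P(x,\nu)/(B(x)^mC_m(\nu))\to1$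 as $x\in\mathbb R^n$ tends to infinity in the Weyl chamber $x_1>\dots>x_n$ (that is, $x_i-x_j\to+\infty$ for all $i<j$). In the exponential variables $u_i=e^{2x_i}$, a power $u_i^a$ means $e^{2ax_i}$, and $\Phi^{(n)}_m$ is regarded as a (multivalued) function of $u$. **Theorem.** Let $k\ge0$. The numerators $P$ of the BA functions $\Phi^{(k)}_m$ and $\Phi^{(k+1)}_m$ exist and are unique. Let $x,\nu\in\mathbb C^{k+1}$ be such that the numbers $u_i=e^{2x_i}$ are distinct and $C_m(\nu)\ne0$. Let $\sigma$ be the product of the positively oriented circles $|w_i-u_i|=\varepsilon$, $i=1,\dots,k$, where $\varepsilon>0$ is small: $\varepsilon<|u_i|$ for $i\le k$ and $2\varepsilon<|u_i-u_j|$ for $i\ne j$. For $w=(w_1,\dots,w_k)$ put $$A^*(w,u)=\prod_{i\le j}(w_i-u_j)\prod_{i>j}(u_j-w_i)\qquad(1\le i\le k,\ 1\le j\le k+1).$$ Then $$\prod_{i=1}^{k+1}u_i^{\nu_{k+1}}\int_\sigma\frac{A(u)^{m+1}A(w)^{m+1}}{A^*(w,u)^{m+1}}\prod_{i=1}^kw_i^{m-\nu_{k+1}}\,\Phi^{(k)}_m(w,\nu_1,\dots,\nu_k)\,dw=(2\pi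 i)^k\prod_{i=1}^k\binom{\nu_i-\nu_{k+1}-1}{m}\,\Phi^{(k+1)}_m(u,\nu_1,\dots,\nu_{k+1}),$$ where $dw=dw_1\wedge\dots\wedge dw_k$, $\binom am=\frac{a(a-1)\cdots(a-m+1)}{m!}$, the integrand is integrable on $\sigma$, and the multivalued functions $w_i^{m-\nu_{k+1}}$ and $\Phi^{(k)}_m(w,\cdot)$ are evaluated with $w_i=e^{2z_i}$, $z_i$ being the branch of $\frac12\log w_i$ on the disc $|w_i-u_i|<|u_i|$ that equals $x_i$ at $w_i=u_i$. -/

import Mathlib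

open scoped BigOperators Real

noncomputable section

/-- `A(u) = ∏_{i<j} (u_i - u_j)`. -/
def prodDiff {R : Type*} [CommRing R] {n : ℕ} (u : Fin n → R) : R :=
  ∏ i : Fin n, ∏ j ∈ Finset.Ioi i, (u i - u j)

/-- `A^*(w,u) = ∏_{i ≤ j} (w_i - u_j) ∏_{i > j} (u_j - w_i)`, with `1 ≤ i ≤ k`, `1 ≤ j ≤ l`. -/
def prodDiffStar {k l : ℕ} (w : Fin k → ℂ) (u : Fin l → ℂ) : ℂ :=
  ∏ i : Fin k, ∏ j : Fin l, if (i : ℕ) ≤ (j : ℕ) then w i - u j else u j - w i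

/-- `B(x) = ∏_{i<j} sinh (x_i - x_j)`. -/
def prodSinh {n : ℕ} (x : Fin n → ℂ) : ℂ :=
  ∏ i : Fin n, ∏ j ∈ Finset.Ioi i, Complex.sinh (x i - x j)

/-- `C_m(ν) = ∏_{l=1}^m ∏_{i<j} (ν_i - ν_j - l)`. -/
def normConst {n : ℕ} (m : ℕ) (ν : Fin n → ℂ) : ℂ :=
  ∏ l ∈ Finset.Icc 1 m, ∏ i : Fin n, ∏ j ∈ Finset.Ioi i, (ν i - ν j - (l : ℂ))

/-- `binom(a, m) = a (a-1) ⋯ (a-m+1) / m!` for complex `a`. -/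
def complexBinom (a : ℂ) (m : ℕ) : ℂ :=
  (∏ l ∈ Finset.range m, (a - (l : ℂ))) / (Nat.factorial m : ℂ)

/-- The Sutherland operator `-Δ + ∑_{i<j} 2m(m+1) / sinh² (x_i - x_j)` applied to `f`,
with complex partial derivatives. -/
def sutherlandOp (n m : ℕ) (f : (Fin n → ℂ) → ℂ) (x : Fin n → ℂ) : ℂ :=
  -(∑ i : Fin n, iteratedDeriv 2 (fun t : ℂ => f (Function.update x i t)) (x i)) +
    (∑ i : Fin n, ∑ j ∈ Finset.Ioi i,
      2 * (m : ℂ) * ((m : ℂ) + 1) / Complex.sinh (x i - x j) ^ 2) * f x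

/-- Functions `P(x, ν) = ∑_α c_α(ν) exp (α, x)` (finite sum over `α ∈ ℤⁿ`), trigonometric
polynomials in `x` whose coefficients are polynomials in `ν`. -/
abbrev TrigPoly (n : ℕ) : Type := (Fin n → ℤ) →₀ MvPolynomial (Fin n) ℂ

/-- `P(x, ·)` as a polynomial in `ν`, for fixed `x`. -/
def TrigPoly.polyAt {n : ℕ} (P : TrigPoly n) (x : Fin n → ℂ) : MvPolynomial (Fin n) ℂ :=
  P.sum fun α c => MvPolynomial.C (Complex.exp (∑ i : Fin n, (α i : ℂ) * x i)) * c

/-- `P(x, ν) / (B(x)^m C_m(ν))`. -/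
def TrigPoly.ratio {n : ℕ} (m : ℕ) (P : TrigPoly n) (x ν : Fin n → ℂ) : ℂ :=
  MvPolynomial.eval ν (P.polyAt x) / (prodSinh x ^ m * normConst m ν)

/-- `P(x, ν) / (B(x)^m C_m(ν)) · exp 2(ν, x)`. -/
def TrigPoly.toFun {n : ℕ} (m : ℕ) (P : TrigPoly n) (x ν : Fin n → ℂ) : ℂ :=
  P.ratio m x ν * Complex.exp (2 * ∑ i : Fin n, ν i * x i)

/-- `x → +∞` in the Weyl chamber `x_1 > x_2 > ⋯ > x_n`: all `x_i - x_j`, `i < j`, tend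
to `+∞`. -/
def chamberAtTop (n : ℕ) : Filter (Fin n → ℝ) :=
  ⨅ (i : Fin n) (j : Fin n) (_ : i < j),
    Filter.comap (fun x : Fin n → ℝ => x i - x j) Filter.atTop

/-- `P` is the numerator of the trigonometric Baker–Akhiezer function with `n` particles and
multiplicity `m`. -/
structure IsBANumerator (n m : ℕ) (P : TrigPoly n) : Prop where
  /-- The degree of `P(x, ·)` is at most that of `A(ν)^m`. -/
  degree_le : ∀ x : Fin n → ℂ, (P.polyAt x).totalDegree ≤ m * n.choose 2
  /-- The leading term of `P` in `ν` is `B(x)^m A(ν)^m`. -/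
  leading : ∀ x : Fin n → ℂ,
    MvPolynomial.homogeneousComponent (m * n.choose 2) (P.polyAt x) =
      MvPolynomial.C (prodSinh x ^ m) *
        prodDiff (fun i : Fin n => (MvPolynomial.X i : MvPolynomial (Fin n) ℂ)) ^ m
  /-- The Schrödinger equation. -/
  eigen : ∀ ν : Fin n → ℂ, normConst m ν ≠ 0 → ∀ x : Fin n → ℂ, prodSinh x ≠ 0 →
    sutherlandOp n m (fun y => P.toFun m y ν) x = -4 * (∑ i : Fin n, ν i ^ 2) * P.toFun m x ν
  /-- The normalisation at infinity in the Weyl chamber. -/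
  normalised : ∀ ν : Fin n → ℂ, normConst m ν ≠ 0 →
    Filter.Tendsto (fun x : Fin n → ℝ => P.ratio m (fun i => (x i : ℂ)) ν)
      (chamberAtTop n) (nhds 1)

open Classical in
/-- The trigonometric Baker–Akhiezer function `Φ^{(n)}_m(x, ν)`, as a function of `x`, where
`u_i = exp 2x_i` (so that it is single-valued). -/
def trigBA (n m : ℕ) (x ν : Fin n → ℂ) : ℂ :=
  if h : ∃ P : TrigPoly n, IsBANumerator n m P then h.choose.toFun m x ν else 0

/-- The analytic branch of `½ log w` on the disc `|w - u| < |u|`, `u = exp 2x`, which takes the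
value `x` at `w = u`. -/
def halfLog (x w : ℂ) : ℂ := x + Complex.log (w / Complex.exp (2 * x)) / 2

/-- The integrand of the residue formula at `w`, with `u_i = exp 2x_i` and `w_i = exp 2z_i`, where
`z_i` is close to `x_i`, so that `w_i^a = exp (2 a z_i)`. -/
def residueIntegrand (k m : ℕ) (x ν : Fin (k + 1) → ℂ) (w : Fin k → ℂ) : ℂ :=
  let u : Fin (k + 1) → ℂ := fun i => Complex.exp (2 * x i)
  let z : Fin k → ℂ := fun i => halfLog (x i.castSucc) (w i)
  prodDiff u ^ (m + 1) * prodDiff w ^ (m + 1) / prodDiffStar w u ^ (m + 1) *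
    (∏ i : Fin k, Complex.exp (2 * ((m : ℂ) - ν (Fin.last k)) * z i)) *
    trigBA k m z (fun i => ν i.castSucc)

end

/-! The proof is an induction on the number of particles: the residue formula is used to construct
the function with k + 1 particles, so it yields existence as well. Put u = e^{2x}, w = e^{2z}, a =
ν_{k+1}, and let K(x, z) be A(u)^{m+1} A(w)^{m+1} / A^*(w,u)^{m+1} · ∏ w_i^{m+1} · e^{2a(∑x_i -
∑z_i)}. Since dw_i = 2 w_i dz_i, the left side of the formula is, up to a constant, the integral of
K Φ^{(k)} in the variables z.

Eigenfunction. The Sutherland operator with k + 1 particles in x acts on K as the one with k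
particles in z, minus 4a² (`kernel_identity`). This is the functional equation of coth, in the form
`sum_weighted_cothDiff_sq`, for the points x with weight 1 and z with weight -1; its cubic constant
vanishes because the weights add up to 1. The circles are closed, so Green's identity in z moves the
operator from K to Φ^{(k)} without boundary terms. The integral is therefore an eigenfunction with
eigenvalue -4 ∑_{i ≤ k+1} ν_i² (`logAvg_eigen`, `resHat_eigen`).

Shape. The integrand is a finite sum of products of functions of one w_i, each with a pole of order
m + 1 at u_i. Taking residues gives e^{2(ν,x)} times a polynomial in ν whose coefficients are
trigonometric polynomials divided by a power of B (`resHat_eq`, `eval_resPoly_mem_ratAlg`). The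
power may be large. But the indicial polynomial of the equation along sinh (x_a - x_b) = 0 is (s -
m)(s + m + 1), so a numerator over B^s with s > m vanishes on the walls and a factor B cancels; this
descends to s = m (`TrigPoly.ev_eq_zero_of_isWall`, `TrigPoly.exists_reduce`).

Constants. The part of top degree in ν comes from the last term of Leibniz' rule in each residue
(`hasTopForm_resPoly`). For the normalisation substitute w_i = u_i s_i with |s_i - 1| = 1/2. Deep in
the chamber the integrand divided by e^{2(ν,x)} converges uniformly to a multiple of ∏ s_i^{ν_i -
ν_{k+1} - 1} / (s_i - 1)^{m+1}, whose residues are the binomial coefficients of the theorem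
(`tendsto_logAvg`). By `normConst_castSucc` these are also, up to m!^k, the quotient of C_m for k +
1 and for k particles, so a single constant adjusts both the leading term and the limit.

Uniqueness. Let α be the leading exponent of the difference of two numerators along a generic ray in
the chamber. The limit of the equation forces α to be the leading exponent of B^m, and the
coefficient at that exponent is zero because both numerators have the same normalisation
(`IsBANumerator.unique`). -/

/-! ### Trigonometric polynomials and their characters -/

open MvPolynomial in
/-- The value `P(x, ν)`. -/
noncomputable def TrigPoly.ev {n : ℕ} (P : TrigPoly n) (x ν : Fin n → ℂ) : ℂ :=
  eval ν (P.polyAt x)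

/-- The character `exp (α, x)`. -/
noncomputable def trigChar {n : ℕ} (α : Fin n → ℤ) (x : Fin n → ℂ) : ℂ :=
  Complex.exp (∑ i, (α i : ℂ) * x i)

section basics
open MvPolynomial
variable {n : ℕ}

theorem trigChar_add (α β : Fin n → ℤ) (x : Fin n → ℂ) :
    trigChar (α + β) x = trigChar α x * trigChar β x := by
  simp [trigChar, ← Complex.exp_add, ← Finset.sum_add_distrib, add_mul]

theorem trigChar_zero (x : Fin n → ℂ) : trigChar 0 x = 1 := by simp [trigChar]

theorem continuous_trigChar (α : Fin n → ℤ) : Continuous (trigChar α) := by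
  unfold trigChar; fun_prop

theorem TrigPoly.polyAt_eq_sum (P : TrigPoly n) (x : Fin n → ℂ) :
    P.polyAt x = ∑ α ∈ P.support, C (trigChar α x) * P α := rfl

theorem TrigPoly.ev_eq_sum (P : TrigPoly n) (x ν : Fin n → ℂ) :
    P.ev x ν = ∑ α ∈ P.support, trigChar α x * eval ν (P α) := by
  simp [TrigPoly.ev, TrigPoly.polyAt_eq_sum]

theorem TrigPoly.coeff_polyAt (P : TrigPoly n) (x : Fin n → ℂ) (κ : Fin n →₀ ℕ) :
    coeff κ (P.polyAt x) = ∑ α ∈ P.support, trigChar α x * coeff κ (P α) := by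
  simp [TrigPoly.polyAt_eq_sum, coeff_sum, coeff_C_mul]

theorem TrigPoly.polyAt_zero (x : Fin n → ℂ) : TrigPoly.polyAt (0 : TrigPoly n) x = 0 := by
  simp [TrigPoly.polyAt]

theorem TrigPoly.polyAt_add (P Q : TrigPoly n) (x : Fin n → ℂ) :
    TrigPoly.polyAt (P + Q) x = P.polyAt x + Q.polyAt x := by
  unfold TrigPoly.polyAt
  rw [Finsupp.sum_add_index']
  · simp
  · intros; ring

theorem TrigPoly.polyAt_single (α : Fin n → ℤ) (c : MvPolynomial (Fin n) ℂ) (x : Fin n → ℂ) :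
    TrigPoly.polyAt (Finsupp.single α c) x = C (trigChar α x) * c := by
  unfold TrigPoly.polyAt
  rw [Finsupp.sum_single_index] <;> simp [trigChar]

theorem TrigPoly.polyAt_sub (P Q : TrigPoly n) (x : Fin n → ℂ) :
    TrigPoly.polyAt (P - Q) x = P.polyAt x - Q.polyAt x := by
  have := TrigPoly.polyAt_add (P - Q) Q x
  rw [sub_add_cancel] at this
  rw [this]; ring

theorem TrigPoly.ev_add (P Q : TrigPoly n) (x ν : Fin n → ℂ) :
    TrigPoly.ev (P + Q) x ν = P.ev x ν + Q.ev x ν := by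
  simp [TrigPoly.ev, TrigPoly.polyAt_add]

theorem TrigPoly.ev_sub (P Q : TrigPoly n) (x ν : Fin n → ℂ) :
    TrigPoly.ev (P - Q) x ν = P.ev x ν - Q.ev x ν := by
  simp [TrigPoly.ev, TrigPoly.polyAt_sub]

theorem TrigPoly.ev_single (α : Fin n → ℤ) (c : MvPolynomial (Fin n) ℂ) (x ν : Fin n → ℂ) :
    TrigPoly.ev (Finsupp.single α c) x ν = trigChar α x * eval ν c := by
  simp [TrigPoly.ev, TrigPoly.polyAt_single]

theorem TrigPoly.ev_zero (x ν : Fin n → ℂ) : TrigPoly.ev (0 : TrigPoly n) x ν = 0 := by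
  simp [TrigPoly.ev, TrigPoly.polyAt_zero]

theorem TrigPoly.continuous_ev (P : TrigPoly n) (ν : Fin n → ℂ) :
    Continuous (fun x => P.ev x ν) := by
  simp only [TrigPoly.ev_eq_sum]
  exact continuous_finsetSum _ fun α _ => (continuous_trigChar α).mul continuous_const

/-- The characters `exp (α, x)` are linearly independent. -/
theorem trigChar_linearIndependent :
    LinearIndependent ℂ (fun α : Fin n → ℤ => (trigChar α : (Fin n → ℂ) → ℂ)) := by
  let φ : (Fin n → ℤ) → (Multiplicative (Fin n → ℂ) →* ℂ) := fun α =>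
    { toFun := fun x => trigChar α x.toAdd
      map_one' := by simp [trigChar]
      map_mul' := fun x y => by
        simp [trigChar, ← Complex.exp_add, ← Finset.sum_add_distrib, mul_add] }
  -- Restricted to the i-th axis, a character has derivative α_i at 0. Dedekind's independence of
  -- characters then applies.
  have hφ : Function.Injective φ := by
    intro α β h
    funext i
    have h1 : ∀ t : ℂ, Complex.exp (α i * t) = Complex.exp (β i * t) := by
      intro t
      have := DFunLike.congr_fun h (Multiplicative.ofAdd (Pi.single i t))
      simpa [φ, trigChar, Pi.single_apply] using this
    have h2 : HasDerivAt (fun t : ℂ => Complex.exp (α i * t)) (α i : ℂ) 0 := by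
      have := ((hasDerivAt_id (0 : ℂ)).const_mul (α i : ℂ)).cexp
      simpa using this
    have h3 : HasDerivAt (fun t : ℂ => Complex.exp (β i * t)) (β i : ℂ) 0 := by
      have := ((hasDerivAt_id (0 : ℂ)).const_mul (β i : ℂ)).cexp
      simpa using this
    rw [← funext h1] at h3
    exact_mod_cast h2.unique h3
  exact (linearIndependent_monoidHom (Multiplicative (Fin n → ℂ)) ℂ).comp φ hφ

theorem eq_zero_of_sum_trigChar_eq_zero (s : Finset (Fin n → ℤ)) (c : (Fin n → ℤ) → ℂ)
    (h : ∀ x, ∑ α ∈ s, trigChar α x * c α = 0) : ∀ α ∈ s, c α = 0 := by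
  refine linearIndependent_iff'.1 trigChar_linearIndependent s c ?_
  funext x
  simpa [mul_comm] using h x

/-- Independence of characters turns a bound on the degree in ν that holds at every x into one for
each coefficient c_α. -/
theorem TrigPoly.coeff_eq_zero (P : TrigPoly n) (κ : Fin n →₀ ℕ)
    (h : ∀ x, coeff κ (P.polyAt x) = 0) (α : Fin n → ℤ) : coeff κ (P α) = 0 := by
  by_cases hα : α ∈ P.support
  · exact eq_zero_of_sum_trigChar_eq_zero P.support (fun α => coeff κ (P α))
      (fun x => by rw [← TrigPoly.coeff_polyAt]; exact h x) α hα
  · rw [Finsupp.notMem_support_iff.1 hα, coeff_zero]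

/-- `A(u)` is non-zero exactly when the entries of `u` are distinct. -/
theorem prodDiff_ne_zero_iff {u : Fin n → ℂ} : prodDiff u ≠ 0 ↔ ∀ i j, i ≠ j → u i ≠ u j := by
  simp only [prodDiff, Finset.prod_ne_zero_iff, Finset.mem_univ, true_implies, Finset.mem_Ioi,
    sub_ne_zero]
  refine ⟨fun h i j hij => ?_, fun h i j hij => h i j hij.ne⟩
  rcases lt_or_gt_of_ne hij with h1 | h1
  · exact h i j h1
  · exact (h j i h1).symm

theorem prodSinh_ne_zero_iff {x : Fin n → ℂ} :
    prodSinh x ≠ 0 ↔ ∀ i j, i ≠ j → Complex.sinh (x i - x j) ≠ 0 := by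
  simp only [prodSinh, Finset.prod_ne_zero_iff, Finset.mem_univ, true_implies, Finset.mem_Ioi]
  refine ⟨fun h i j hij => ?_, fun h i j hij => h i j hij.ne⟩
  rcases lt_or_gt_of_ne hij with h1 | h1
  · exact h i j h1
  · rw [← neg_sub, Complex.sinh_neg, neg_ne_zero]; exact h j i h1

theorem continuous_prodSinh : Continuous (prodSinh : (Fin n → ℂ) → ℂ) := by
  unfold prodSinh; fun_prop

/-- The zeros of sinh are simple, because cosh² - sinh² = 1, hence isolated on any line along which
the argument moves. -/
theorem eventually_sinh_ne_zero (c δ : ℂ) (h : Complex.sinh c ≠ 0 ∨ δ ≠ 0) :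
    ∀ᶠ t : ℂ in nhdsWithin 0 {0}ᶜ, Complex.sinh (c + t * δ) ≠ 0 := by
  by_cases hc : Complex.sinh c = 0
  · have hδ : δ ≠ 0 := h.resolve_left (fun h => h hc)
    have h1 : HasDerivAt (fun t : ℂ => Complex.sinh (c + t * δ)) (Complex.cosh c * δ) 0 := by
      have := (((hasDerivAt_id (0 : ℂ)).mul_const δ).const_add c).csinh
      simpa using this
    have h2 : Complex.cosh c ≠ 0 := by
      intro h0
      have := Complex.cosh_sq_sub_sinh_sq c
      simp [h0, hc] at this
    exact h1.eventually_ne (mul_ne_zero h2 hδ)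
  · have h1 : Filter.Tendsto (fun t : ℂ => Complex.sinh (c + t * δ)) (nhdsWithin 0 {0}ᶜ)
        (nhds (Complex.sinh c)) := by
      have : Continuous (fun t : ℂ => Complex.sinh (c + t * δ)) := by fun_prop
      have := this.tendsto 0
      simp only [zero_mul, add_zero] at this
      exact this.mono_left nhdsWithin_le_nhds
    exact h1.eventually_ne hc

/-- A continuous function that vanishes wherever the `sinh (x_i - x_j)` do not (apart from one
pair, allowed to be kept fixed) vanishes everywhere. -/
theorem eq_zero_of_eventually_line {f : (Fin n → ℂ) → ℂ} (hf : Continuous f) (x d : Fin n → ℂ)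
    (h : ∀ᶠ t : ℂ in nhdsWithin 0 {0}ᶜ, f (x + t • d) = 0) : f x = 0 := by
  have h1 : Filter.Tendsto (fun t : ℂ => f (x + t • d)) (nhdsWithin 0 {0}ᶜ) (nhds (f x)) := by
    have : Continuous (fun t : ℂ => f (x + t • d)) := by fun_prop
    have := this.tendsto 0
    simp only [zero_smul, add_zero] at this
    exact this.mono_left nhdsWithin_le_nhds
  exact tendsto_nhds_unique (h1.congr' h) tendsto_const_nhds

/-- The direction (0, 1, 2, …) changes every difference x_i - x_j, so every point is a limit of
points with B ≠ 0. This extends identities known off the walls to all x. -/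
theorem eq_zero_of_prodSinh_ne_zero {f : (Fin n → ℂ) → ℂ} (hf : Continuous f)
    (h : ∀ x, prodSinh x ≠ 0 → f x = 0) (x : Fin n → ℂ) : f x = 0 := by
  refine eq_zero_of_eventually_line hf x (fun i => ((i : ℕ) : ℂ)) ?_
  have h1 : ∀ᶠ t : ℂ in nhdsWithin 0 {0}ᶜ, ∀ i j : Fin n, i ≠ j →
      Complex.sinh ((x i - x j) + t * (((i : ℕ) : ℂ) - ((j : ℕ) : ℂ))) ≠ 0 := by
    simp only [Filter.eventually_all]
    intro i j hij
    refine eventually_sinh_ne_zero _ _ (Or.inr ?_)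
    rw [sub_ne_zero]
    exact fun h => hij (Fin.ext (by exact_mod_cast h))
  filter_upwards [h1] with t ht
  refine h _ (prodSinh_ne_zero_iff.2 fun i j hij => ?_)
  convert ht i j hij using 2
  simp; ring

/-- `C_m` as a polynomial. -/
noncomputable def normConstPoly (n m : ℕ) : MvPolynomial (Fin n) ℂ :=
  ∏ l ∈ Finset.Icc 1 m, ∏ i : Fin n, ∏ j ∈ Finset.Ioi i, (X i - X j - C (l : ℂ))

theorem eval_normConstPoly (m : ℕ) (ν : Fin n → ℂ) :
    eval ν (normConstPoly n m) = normConst m ν := by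
  simp [normConstPoly, normConst]

theorem normConstPoly_ne_zero (n m : ℕ) : normConstPoly n m ≠ 0 := by
  simp only [normConstPoly, Finset.prod_ne_zero_iff, Finset.mem_univ, true_implies,
    Finset.mem_Ioi]
  intro l hl i j _ h
  have := congrArg (eval (0 : Fin n → ℂ)) h
  simp at this
  simp [this] at hl

/-- The product of p with C_m vanishes everywhere, and polynomials over ℂ form a domain. -/
theorem eq_zero_of_normConst_ne_zero (m : ℕ) (p : MvPolynomial (Fin n) ℂ)
    (h : ∀ ν, normConst m ν ≠ 0 → eval ν p = 0) : p = 0 := by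
  have : normConstPoly n m * p = 0 := by
    refine MvPolynomial.funext fun ν => ?_
    by_cases hν : normConst m ν = 0
    · simp [eval_normConstPoly, hν]
    · simp [h ν hν]
  exact (mul_eq_zero.1 this).resolve_left (normConstPoly_ne_zero n m)

theorem TrigPoly.exists_mul (P Q : TrigPoly n) :
    ∃ R : TrigPoly n, ∀ x ν, R.ev x ν = P.ev x ν * Q.ev x ν := by
  induction P using Finsupp.induction_linear with
  | zero => exact ⟨0, fun x ν => by simp [TrigPoly.ev_zero]⟩
  | add P₁ P₂ h₁ h₂ =>
    obtain ⟨R₁, h₁⟩ := h₁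
    obtain ⟨R₂, h₂⟩ := h₂
    exact ⟨R₁ + R₂, fun x ν => by rw [TrigPoly.ev_add, TrigPoly.ev_add, h₁, h₂]; ring⟩
  | single α c =>
    induction Q using Finsupp.induction_linear with
    | zero => exact ⟨0, fun x ν => by simp [TrigPoly.ev_zero]⟩
    | add P₁ P₂ h₁ h₂ =>
      obtain ⟨R₁, h₁⟩ := h₁
      obtain ⟨R₂, h₂⟩ := h₂
      exact ⟨R₁ + R₂, fun x ν => by rw [TrigPoly.ev_add, TrigPoly.ev_add, h₁, h₂]; ring⟩
    | single β d =>
      refine ⟨Finsupp.single (α + β) (c * d), fun x ν => ?_⟩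
      simp only [TrigPoly.ev_single, trigChar_add, map_mul]
      ring

/-- The algebra of functions of `(x, ν)` of the form `P(x, ν)`. -/
noncomputable def trigAlg (n : ℕ) : Subalgebra ℂ ((Fin n → ℂ) → (Fin n → ℂ) → ℂ) where
  carrier := {f | ∃ P : TrigPoly n, ∀ x ν, f x ν = P.ev x ν}
  mul_mem' := by
    rintro f g ⟨P, hP⟩ ⟨Q, hQ⟩
    obtain ⟨R, hR⟩ := TrigPoly.exists_mul P Q
    exact ⟨R, fun x ν => by rw [hR, Pi.mul_apply, Pi.mul_apply, hP, hQ]⟩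
  add_mem' := by
    rintro f g ⟨P, hP⟩ ⟨Q, hQ⟩
    exact ⟨P + Q, fun x ν => by rw [TrigPoly.ev_add, Pi.add_apply, Pi.add_apply, hP, hQ]⟩
  algebraMap_mem' := fun r => ⟨Finsupp.single 0 (C r), fun x ν => by
    simp [TrigPoly.ev_single, trigChar_zero]⟩

theorem trigChar_mem_trigAlg (α : Fin n → ℤ) : (fun x _ => trigChar α x) ∈ trigAlg n :=
  ⟨Finsupp.single α 1, fun x ν => by simp [TrigPoly.ev_single]⟩

theorem eval_mem_trigAlg (p : MvPolynomial (Fin n) ℂ) : (fun _ ν => eval ν p) ∈ trigAlg n :=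
  ⟨Finsupp.single 0 p, fun x ν => by simp [TrigPoly.ev_single, trigChar_zero]⟩

theorem exp_int_mem_trigAlg (a : ℤ) (i : Fin n) :
    (fun x _ => Complex.exp ((a : ℂ) * x i)) ∈ trigAlg n := by
  convert trigChar_mem_trigAlg (Pi.single i a) using 3
  simp [trigChar, Pi.single_apply]

theorem sinh_mem_trigAlg (i j : Fin n) :
    (fun x _ => Complex.sinh (x i - x j)) ∈ trigAlg n := by
  have h1 := (trigAlg n).mul_mem (exp_int_mem_trigAlg 1 i) (exp_int_mem_trigAlg (-1) j)
  have h2 := (trigAlg n).mul_mem (exp_int_mem_trigAlg (-1) i) (exp_int_mem_trigAlg 1 j)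
  convert (trigAlg n).smul_mem ((trigAlg n).sub_mem h1 h2) (1 / 2 : ℂ) using 1
  funext x ν
  simp [Complex.sinh, ← Complex.exp_add, sub_eq_add_neg]
  ring_nf

end basics

/-! ### Logarithmic derivatives -/

/-- `f` has logarithmic derivative `l` at `t` (also where `f` vanishes: `f' = l f`). -/
def HasLogDerivAt (f : ℂ → ℂ) (l t : ℂ) : Prop := HasDerivAt f (l * f t) t

namespace HasLogDerivAt
variable {f g : ℂ → ℂ} {l l' t : ℂ}

theorem mul (hf : HasLogDerivAt f l t) (hg : HasLogDerivAt g l' t) :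
    HasLogDerivAt (fun s => f s * g s) (l + l') t := by
  have := HasDerivAt.mul hf hg
  exact this.congr_deriv (by ring)

theorem const (c : ℂ) : HasLogDerivAt (fun _ => c) 0 t := by
  have := hasDerivAt_const t c
  exact this.congr_deriv (by ring)

theorem pow (hf : HasLogDerivAt f l t) (N : ℕ) : HasLogDerivAt (fun s => f s ^ N) (N * l) t := by
  induction N with
  | zero => simpa using const (t := t) 1
  | succ N ih =>
    have := ih.mul hf
    simp only [← pow_succ] at this
    convert this using 1
    push_cast; ring

theorem inv (hf : HasLogDerivAt f l t) (h0 : f t ≠ 0) : HasLogDerivAt (fun s => (f s)⁻¹) (-l) t := by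
  have := HasDerivAt.fun_inv hf h0
  exact this.congr_deriv (by field_simp)

theorem exp {a : ℂ} (hf : HasDerivAt f a t) : HasLogDerivAt (fun s => Complex.exp (f s)) a t := by
  have := hf.cexp
  exact this.congr_deriv (by ring)

theorem prod {ι : Type*} {F : ι → ℂ → ℂ} {L : ι → ℂ} (s : Finset ι)
    (h : ∀ i ∈ s, HasLogDerivAt (F i) (L i) t) :
    HasLogDerivAt (fun z => ∏ i ∈ s, F i z) (∑ i ∈ s, L i) t := by
  classical
  induction s using Finset.induction_on with
  | empty => simpa using const (t := t) 1
  | insert a s ha ih =>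
    simp only [Finset.prod_insert ha, Finset.sum_insert ha]
    exact (h a (Finset.mem_insert_self _ _)).mul
      (ih fun i hi => h i (Finset.mem_insert_of_mem hi))

theorem congr_logDeriv (hf : HasLogDerivAt f l t) (h : l = l') : HasLogDerivAt f l' t := h ▸ hf

end HasLogDerivAt

/-! ### Identities for hyperbolic cotangents -/

/-- `coth (a - b)`, equal to `0` for `a = b`. -/
noncomputable def cothDiff (a b : ℂ) : ℂ :=
  (Complex.exp (2 * a) + Complex.exp (2 * b)) / (Complex.exp (2 * a) - Complex.exp (2 * b))

/-- `1 / sinh² (a - b)`, equal to `0` for `a = b`. -/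
noncomputable def cschSqDiff (a b : ℂ) : ℂ :=
  4 * Complex.exp (2 * a) * Complex.exp (2 * b) / (Complex.exp (2 * a) - Complex.exp (2 * b)) ^ 2

/-- The point with coordinates `exp 2x_i`. -/
noncomputable def expTwo {n : ℕ} (x : Fin n → ℂ) : Fin n → ℂ := fun i => Complex.exp (2 * x i)

theorem exp_two_sub (a b : ℂ) :
    Complex.exp (2 * a) - Complex.exp (2 * b) = 2 * Complex.exp (a + b) * Complex.sinh (a - b) := by
  rw [Complex.sinh, show -(a - b) = b - a by ring]
  have h1 : Complex.exp (2 * a) = Complex.exp (a + b) * Complex.exp (a - b) := by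
    rw [← Complex.exp_add]; ring_nf
  have h2 : Complex.exp (2 * b) = Complex.exp (a + b) * Complex.exp (b - a) := by
    rw [← Complex.exp_add]; ring_nf
  rw [h1, h2]; ring

theorem exp_two_add (a b : ℂ) :
    Complex.exp (2 * a) + Complex.exp (2 * b) = 2 * Complex.exp (a + b) * Complex.cosh (a - b) := by
  rw [Complex.cosh, show -(a - b) = b - a by ring]
  have h1 : Complex.exp (2 * a) = Complex.exp (a + b) * Complex.exp (a - b) := by
    rw [← Complex.exp_add]; ring_nf
  have h2 : Complex.exp (2 * b) = Complex.exp (a + b) * Complex.exp (b - a) := by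
    rw [← Complex.exp_add]; ring_nf
  rw [h1, h2]; ring

theorem cothDiff_eq (a b : ℂ) : cothDiff a b = Complex.cosh (a - b) / Complex.sinh (a - b) := by
  rw [cothDiff, exp_two_sub, exp_two_add, mul_div_mul_left]
  simp [Complex.exp_ne_zero]

theorem cschSqDiff_eq (a b : ℂ) : cschSqDiff a b = 1 / Complex.sinh (a - b) ^ 2 := by
  rw [cschSqDiff, exp_two_sub]
  have h1 : 4 * Complex.exp (2 * a) * Complex.exp (2 * b) =
      (2 * Complex.exp (a + b)) ^ 2 * 1 := by
    rw [mul_pow, ← Complex.exp_nat_mul, mul_assoc, ← Complex.exp_add]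
    push_cast; ring_nf
  rw [h1, mul_pow _ (Complex.sinh _), mul_div_mul_left]
  simp [Complex.exp_ne_zero]

theorem exp_two_ne_iff (a b : ℂ) :
    Complex.exp (2 * a) ≠ Complex.exp (2 * b) ↔ Complex.sinh (a - b) ≠ 0 := by
  rw [← sub_ne_zero, exp_two_sub]
  simp [Complex.exp_ne_zero]

theorem cothDiff_self (a : ℂ) : cothDiff a a = 0 := by simp [cothDiff]

theorem cschSqDiff_self (a : ℂ) : cschSqDiff a a = 0 := by simp [cschSqDiff]

theorem cothDiff_comm (a b : ℂ) : cothDiff b a = -cothDiff a b := by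
  rw [cothDiff, cothDiff, ← neg_sub (Complex.exp (2 * a)), div_neg, add_comm]

theorem cschSqDiff_comm (a b : ℂ) : cschSqDiff b a = cschSqDiff a b := by
  rw [cschSqDiff, cschSqDiff, ← neg_sub (Complex.exp (2 * a)), neg_sq]
  ring

theorem cothDiff_sq {a b : ℂ} (h : Complex.exp (2 * a) ≠ Complex.exp (2 * b)) :
    cothDiff a b ^ 2 = 1 + cschSqDiff a b := by
  have := sub_ne_zero.2 h
  rw [cothDiff, cschSqDiff]
  field_simp
  ring

/-- The addition formula of coth for three differences with sum 0; in exponentials it is an identity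
of rational functions. -/
theorem cothDiff_triple {a b c : ℂ} (hab : Complex.exp (2 * a) ≠ Complex.exp (2 * b))
    (hac : Complex.exp (2 * a) ≠ Complex.exp (2 * c))
    (hbc : Complex.exp (2 * b) ≠ Complex.exp (2 * c)) :
    cothDiff a b * cothDiff a c + cothDiff b a * cothDiff b c + cothDiff c a * cothDiff c b = 1 := by
  rw [cothDiff_comm a b, cothDiff_comm a c, cothDiff_comm b c]
  have h1 := sub_ne_zero.2 hab
  have h2 := sub_ne_zero.2 hac
  have h3 := sub_ne_zero.2 hbc
  simp only [cothDiff]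
  field_simp
  ring

theorem hasDerivAt_cothDiff {a b : ℂ} (h : Complex.exp (2 * a) ≠ Complex.exp (2 * b)) :
    HasDerivAt (fun t => cothDiff t b) (-cschSqDiff a b) a := by
  have h1 := sub_ne_zero.2 h
  have h2 : HasDerivAt (fun t : ℂ => Complex.exp (2 * t)) (Complex.exp (2 * a) * 2) a := by
    simpa using ((hasDerivAt_id a).const_mul (2 : ℂ)).cexp
  have h3 := (h2.add_const (Complex.exp (2 * b))).div (h2.sub_const (Complex.exp (2 * b))) h1
  refine h3.congr_deriv ?_
  rw [cschSqDiff]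
  field_simp
  ring

/-- The quadratic identity for hyperbolic cotangents behind the kernel function identity. -/
theorem sum_weighted_cothDiff_sq {ι : Type*} [Fintype ι] (y : ι → ℂ) (e : ι → ℂ)
    (he : ∀ p, e p ^ 2 = 1)
    (hy : ∀ p q, p ≠ q → Complex.exp (2 * y p) ≠ Complex.exp (2 * y q)) :
    ∑ p, e p * (∑ q, e q * cothDiff (y p) (y q)) ^ 2 =
      ((∑ p, e p) ^ 3 - ∑ p, e p) / 3 + ∑ p, ∑ q, e q * cschSqDiff (y p) (y q) := by
  classical
  set c : ι → ι → ℂ := fun p q => cothDiff (y p) (y q) with hc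
  set S : ι → ι → ℂ := fun p q => cschSqDiff (y p) (y q) with hS
  have hc2 : ∀ p q, c p q ^ 2 = 1 + S p q - if p = q then 1 else 0 := by
    intro p q
    by_cases h : p = q
    · subst h; simp [hc, hS, cothDiff_self, cschSqDiff_self]
    · simp only [h, if_false, sub_zero]; exact cothDiff_sq (hy p q h)
  have hcc : ∀ p, c p p = 0 := fun p => cothDiff_self _
  have hca : ∀ p q, c q p = - c p q := fun p q => cothDiff_comm _ _
  set D : ι → ι → ℂ := fun p q => c p q ^ 2 - 1 with hD
  have hDD : ∀ p, D p p = -1 := fun p => by simp [hD, hcc]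
  have hDc : ∀ p q, D q p = D p q := fun p q => by simp only [hD]; rw [hca p q]; ring
  -- For distinct indices this is the addition formula. The other terms correct for coincidences,
  -- where c is 0 by convention; when all three agree, 1 - 3 + 2 = 0.
  have ht : ∀ p q r, c p q * c p r + c q p * c q r + c r p * c r q =
      1 + (if p = q then D p r else 0) + (if q = r then D p q else 0)
        + (if p = r then D q p else 0) + (if p = q then if q = r then 2 else 0 else 0) := by
    intro p q r
    by_cases h1 : p = q
    · subst h1
      by_cases h2 : p = r
      · subst h2; simp [hcc, hDD]; norm_num
      · simp [h2, hcc, hD, hca p r]; ring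
    · by_cases h2 : q = r
      · subst h2
        simp [h1, hcc, hD]; ring
      · by_cases h3 : p = r
        · subst h3
          simp [h1, h2, hcc, hD]; ring
        · simp only [h1, h2, h3, if_false, add_zero]
          exact cothDiff_triple (hy _ _ h1) (hy _ _ h3) (hy _ _ h2)
  have e2 : ∀ p, e p * e p = 1 := fun p => by rw [← sq]; exact he p
  set T : ℂ := ∑ p, ∑ q, ∑ r, e p * e q * e r * (c p q * c p r) with hT
  have hL : ∑ p, e p * (∑ q, e q * c p q) ^ 2 = T := by
    refine Finset.sum_congr rfl fun p _ => ?_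
    rw [sq, Finset.sum_mul_sum, Finset.mul_sum]
    refine Finset.sum_congr rfl fun q _ => ?_
    rw [Finset.mul_sum]
    exact Finset.sum_congr rfl fun r _ => by ring
  -- Relabelling makes each of the three indices in turn the distinguished one, so that 3T is a sum
  -- of the symmetric expressions in `ht`.
  have hT2 : T = ∑ p, ∑ q, ∑ r, e p * e q * e r * (c q p * c q r) := by
    rw [hT, Finset.sum_comm]
    refine Finset.sum_congr rfl fun p _ => Finset.sum_congr rfl fun q _ =>
      Finset.sum_congr rfl fun r _ => by ring
  have hT3 : T = ∑ p, ∑ q, ∑ r, e p * e q * e r * (c r p * c r q) := by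
    rw [hT, Finset.sum_comm]
    have : ∀ q, ∑ p, ∑ r, e p * e q * e r * (c p q * c p r) =
        ∑ r, ∑ p, e p * e q * e r * (c p q * c p r) := fun q => Finset.sum_comm
    simp only [this]
    refine Finset.sum_congr rfl fun p _ => Finset.sum_congr rfl fun q _ =>
      Finset.sum_congr rfl fun r _ => by ring
  -- Two equal indices contribute e² = 1, so every correction term retains only one weight.
  have hR : ∀ p q r, e p * e q * e r * (c p q * c p r) + e p * e q * e r * (c q p * c q r) +
      e p * e q * e r * (c r p * c r q) = e p * e q * e r +
      (if p = q then e r * D p r else 0) + (if q = r then e p * D p q else 0)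
        + (if p = r then e q * D q p else 0)
        + (if p = q then if q = r then 2 * e p else 0 else 0) := by
    intro p q r
    rw [← mul_add, ← mul_add, ht]
    by_cases h1 : p = q
    · subst h1
      by_cases h2 : p = r
      · subst h2; simp only [if_true, hDD]; linear_combination (2 * e p - 3 * e p) * e2 p
      · simp only [if_true, h2, if_false]; linear_combination (e r * D p r) * e2 p
    · by_cases h2 : q = r
      · subst h2; simp only [if_true, h1, if_false]; linear_combination (e p * D p q) * e2 q
      · by_cases h3 : p = r
        · subst h3; simp only [if_true, h1, h2, if_false]
          linear_combination (e q * D q p) * e2 p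
        · simp only [h1, h2, h3, if_false]; ring
  have h3T : T + T + T = (∑ p, e p) ^ 3 + 3 * (∑ p, ∑ q, e q * D p q) + 2 * ∑ p, e p := by
    have : T + T + T = T + (∑ p, ∑ q, ∑ r, e p * e q * e r * (c q p * c q r)) +
        ∑ p, ∑ q, ∑ r, e p * e q * e r * (c r p * c r q) := by rw [← hT2, ← hT3]
    rw [this, hT]
    simp only [← Finset.sum_add_distrib, hR]
    simp only [Finset.sum_add_distrib]
    have i1 : ∑ p, ∑ q, ∑ r, e p * e q * e r = (∑ p, e p) ^ 3 := by
      rw [pow_succ, sq, Finset.sum_mul_sum, Finset.sum_mul]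
      refine Finset.sum_congr rfl fun p _ => ?_
      rw [Finset.sum_mul]
      refine Finset.sum_congr rfl fun q _ => ?_
      rw [Finset.mul_sum]
    have i2 : ∑ p, ∑ q, ∑ r, (if p = q then e r * D p r else 0) =
        ∑ p, ∑ q, e q * D p q := by
      refine Finset.sum_congr rfl fun p _ => ?_
      rw [Finset.sum_eq_single p]
      · simp
      · intro b _ hb; simp [hb.symm]
      · simp
    have i3 : ∑ p, ∑ q, ∑ r, (if q = r then e p * D p q else 0) =
        ∑ p, ∑ q, e q * D p q := by
      simp only [Finset.sum_ite_eq, Finset.mem_univ, if_true]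
      rw [Finset.sum_comm]
      simp only [hDc]
    have i4 : ∑ p, ∑ q, ∑ r, (if p = r then e q * D q p else 0) =
        ∑ p, ∑ q, e q * D p q := by
      simp only [Finset.sum_ite_eq, Finset.mem_univ, if_true, hDc]
    have i5 : ∑ p, ∑ q, ∑ r, (if p = q then if q = r then 2 * e p else 0 else 0) =
        2 * ∑ p, e p := by
      rw [Finset.mul_sum]
      refine Finset.sum_congr rfl fun p _ => ?_
      rw [Finset.sum_eq_single p]
      · simp
      · intro b _ hb; simp [hb.symm]
      · simp
    rw [i1, i2, i3, i4, i5]; ring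
  have hsub : ∑ p, ∑ q, e q * D p q = ∑ p, ∑ q, e q * S p q - ∑ p, e p := by
    have : ∀ p q, e q * D p q = e q * S p q - if p = q then e q else 0 := by
      intro p q
      simp only [hD, hc2]
      split_ifs <;> ring
    simp [this, Finset.sum_sub_distrib]
  rw [hL]
  linear_combination (1 / 3 : ℂ) * h3T + hsub

/-! ### The kernel function and its differential identity -/

section kernel
variable {n k : ℕ}

theorem sum_sum_Ioi_symm (f : Fin n → Fin n → ℂ) :
    ∑ i, ∑ j ∈ Finset.Ioi i, (f i j + f j i) = ∑ i, ∑ j ∈ Finset.univ.erase i, f i j := by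
  have := Finset.sum_sum_Ioi_add_eq_sum_sum_off_diag (fun i j => f j i)
  rw [this]
  refine Finset.sum_congr rfl fun i _ => Finset.sum_congr ?_ fun j _ => rfl
  ext j; simp

theorem sum_card_Ioi (n : ℕ) : ∑ i : Fin n, (Finset.Ioi i).card = n.choose 2 := by
  simp only [Fin.card_Ioi]
  rw [Fin.sum_univ_eq_sum_range (fun i => n - 1 - i) n, Finset.sum_range_reflect (fun i => i) n,
    Finset.sum_range_id, Nat.choose_two_right]

/-- Each pair contributes 2 e^{x_i + x_j} sinh (x_i - x_j), and each index lies in n - 1 pairs. -/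
theorem prodDiff_expTwo (x : Fin n → ℂ) :
    prodDiff (expTwo x) =
      2 ^ n.choose 2 * Complex.exp (((n : ℂ) - 1) * ∑ i, x i) * prodSinh x := by
  have h1 : prodDiff (expTwo x) =
      (∏ i : Fin n, ∏ _j ∈ Finset.Ioi i, (2 : ℂ)) *
      (∏ i : Fin n, ∏ j ∈ Finset.Ioi i, Complex.exp (x i + x j)) * prodSinh x := by
    simp only [prodDiff, prodSinh, ← Finset.prod_mul_distrib, expTwo, exp_two_sub]
  have h2 : ∑ i : Fin n, ∑ j ∈ Finset.Ioi i, (x i + x j) = ((n : ℂ) - 1) * ∑ i, x i := by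
    rw [sum_sum_Ioi_symm (fun i _ => x i), Finset.mul_sum]
    refine Finset.sum_congr rfl fun i _ => ?_
    rw [Finset.sum_const, Finset.card_erase_of_mem (Finset.mem_univ _), Finset.card_univ,
      Fintype.card_fin, nsmul_eq_mul, Nat.cast_sub (Fin.pos i), Nat.cast_one]
  rw [h1]
  simp only [← Complex.exp_sum, h2, Finset.prod_const, Finset.prod_pow_eq_pow_sum, sum_card_Ioi]

theorem hasDerivAt_exp_two (a : ℂ) :
    HasDerivAt (fun t : ℂ => Complex.exp (2 * t)) (2 * Complex.exp (2 * a)) a := by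
  have := ((hasDerivAt_id a).const_mul (2 : ℂ)).cexp
  exact this.congr_deriv (by simp; ring)

theorem hasLogDerivAt_exp_sub {a b : ℂ} (h : Complex.exp (2 * a) ≠ Complex.exp (2 * b)) :
    HasLogDerivAt (fun t => Complex.exp (2 * t) - Complex.exp (2 * b)) (cothDiff a b + 1) a := by
  have h1 := sub_ne_zero.2 h
  refine HasDerivAt.congr_deriv ((hasDerivAt_exp_two a).sub_const _) ?_
  rw [cothDiff]; field_simp; ring

theorem hasLogDerivAt_sub_exp {a b : ℂ} (h : Complex.exp (2 * a) ≠ Complex.exp (2 * b)) :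
    HasLogDerivAt (fun t => Complex.exp (2 * b) - Complex.exp (2 * t)) (cothDiff a b + 1) a := by
  have := (HasLogDerivAt.const (t := a) (-1)).mul (hasLogDerivAt_exp_sub h)
  rw [zero_add] at this
  convert this using 1
  funext t; ring

/-- Each of the n - 1 factors containing x_i contributes coth + 1. The sum may run over all j since
the diagonal coth is 0 by convention. -/
theorem hasLogDerivAt_prodDiff {x : Fin n → ℂ}
    (hx : ∀ i j, i ≠ j → Complex.exp (2 * x i) ≠ Complex.exp (2 * x j)) (i : Fin n) :
    HasLogDerivAt (fun t => prodDiff (expTwo (Function.update x i t)))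
      (∑ j, cothDiff (x i) (x j) + ((n : ℂ) - 1)) (x i) := by
  have h1 : HasLogDerivAt (fun t => prodDiff (expTwo (Function.update x i t)))
      (∑ a, ∑ b ∈ Finset.Ioi a, ((if a = i then cothDiff (x i) (x b) + 1 else 0) +
        (if b = i then cothDiff (x i) (x a) + 1 else 0))) (x i) := by
    unfold prodDiff expTwo
    refine HasLogDerivAt.prod _ fun a _ => HasLogDerivAt.prod _ fun b hb => ?_
    have hab : a ≠ b := (Finset.mem_Ioi.1 hb).ne
    by_cases ha : a = i
    · subst ha
      simp only [Function.update_self, Function.update_of_ne hab.symm, if_true, hab.symm, if_false,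
        add_zero]
      exact hasLogDerivAt_exp_sub (hx _ _ hab)
    · by_cases hb : b = i
      · subst hb
        simp only [Function.update_self, Function.update_of_ne hab, if_true, hab, if_false,
          zero_add]
        exact hasLogDerivAt_sub_exp (hx _ _ hab.symm)
      · simp only [Function.update_of_ne ha, Function.update_of_ne hb, ha, hb, if_false, add_zero]
        exact HasLogDerivAt.const _
  refine h1.congr_logDeriv ?_
  rw [sum_sum_Ioi_symm (fun a b => if a = i then cothDiff (x i) (x b) + 1 else 0),
    Finset.sum_eq_single i]
  · simp only [if_true, Finset.sum_add_distrib, Finset.sum_const,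
      Finset.card_erase_of_mem (Finset.mem_univ i), Finset.card_univ, Fintype.card_fin]
    rw [← Finset.add_sum_erase _ _ (Finset.mem_univ i), cothDiff_self, zero_add, nsmul_eq_mul,
      Nat.cast_sub (Fin.pos i)]
    simp
  · intro b _ hb; simp [hb]
  · simp

theorem hasDerivAt_sum_update (x : Fin n → ℂ) (i : Fin n) :
    HasDerivAt (fun t => ∑ j, Function.update x i t j) 1 (x i) := by
  have : HasDerivAt (fun t => ∑ j, Function.update x i t j) (∑ j, if j = i then (1 : ℂ) else 0)
      (x i) := by
    refine HasDerivAt.fun_sum fun j _ => ?_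
    by_cases h : j = i
    · subst h; simpa using hasDerivAt_id' _
    · simpa [h] using hasDerivAt_const _ _
  simpa using this

/-- The exponential relating B(x) to A(e^{2x}) cancels the constant n - 1. -/
theorem hasLogDerivAt_prodSinh {x : Fin n → ℂ}
    (hx : ∀ i j, i ≠ j → Complex.exp (2 * x i) ≠ Complex.exp (2 * x j)) (i : Fin n) :
    HasLogDerivAt (fun t => prodSinh (Function.update x i t)) (∑ j, cothDiff (x i) (x j)) (x i) := by
  have h1 : ∀ y : Fin n → ℂ, prodSinh y = (1 / 2 ^ n.choose 2) *
      (Complex.exp (-((n : ℂ) - 1) * ∑ i, y i) * prodDiff (expTwo y)) := by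
    intro y
    rw [prodDiff_expTwo, neg_mul, Complex.exp_neg]
    have := Complex.exp_ne_zero (((n : ℂ) - 1) * ∑ i, y i)
    field_simp
  simp only [h1]
  have h2 := (HasLogDerivAt.exp ((hasDerivAt_sum_update x i).const_mul (-((n : ℂ) - 1)))).mul
    (hasLogDerivAt_prodDiff hx i)
  refine ((HasLogDerivAt.const (1 / 2 ^ n.choose 2 : ℂ)).mul h2).congr_logDeriv ?_
  ring

theorem hasDerivAt_sum_cothDiff {x : Fin n → ℂ}
    (hx : ∀ i j, i ≠ j → Complex.exp (2 * x i) ≠ Complex.exp (2 * x j)) (i : Fin n) :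
    HasDerivAt (fun t => ∑ j, cothDiff t (Function.update x i t j))
      (-∑ j, cschSqDiff (x i) (x j)) (x i) := by
  rw [← Finset.sum_neg_distrib]
  refine HasDerivAt.fun_sum fun j _ => ?_
  by_cases h : j = i
  · subst h
    simp only [Function.update_self, cothDiff_self, cschSqDiff_self, neg_zero]
    exact hasDerivAt_const _ _
  · simp only [Function.update_of_ne h]
    exact hasDerivAt_cothDiff (hx _ _ (Ne.symm h))

/-- The sign relating `A^*(w, u)` to `∏ (w_i - u_j)`. -/
noncomputable def starSign (k l : ℕ) : ℂ :=
  ∏ i : Fin k, ∏ j : Fin l, if (i : ℕ) ≤ (j : ℕ) then 1 else -1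

theorem starSign_ne_zero (k l : ℕ) : starSign k l ≠ 0 := by
  simp only [starSign, Finset.prod_ne_zero_iff]
  intro i _ j _
  split_ifs <;> norm_num

theorem prodDiffStar_eq (w : Fin k → ℂ) (u : Fin n → ℂ) :
    prodDiffStar w u = starSign k n * ∏ i, ∏ j, (w i - u j) := by
  simp only [prodDiffStar, starSign, ← Finset.prod_mul_distrib]
  refine Finset.prod_congr rfl fun i _ => Finset.prod_congr rfl fun j _ => ?_
  split_ifs <;> ring

theorem prodDiffStar_ne_zero_iff {w : Fin k → ℂ} {u : Fin n → ℂ} :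
    prodDiffStar w u ≠ 0 ↔ ∀ i j, w i ≠ u j := by
  simp [prodDiffStar_eq, starSign_ne_zero, Finset.prod_eq_zero_iff, sub_eq_zero]

theorem hasLogDerivAt_prodDiffStar_right {x : Fin n → ℂ} {z : Fin k → ℂ}
    (hxz : ∀ l j, Complex.exp (2 * z l) ≠ Complex.exp (2 * x j)) (i : Fin n) :
    HasLogDerivAt (fun t => prodDiffStar (expTwo z) (expTwo (Function.update x i t)))
      (∑ l, cothDiff (x i) (z l) + k) (x i) := by
  simp only [prodDiffStar_eq]
  have h1 : HasLogDerivAt (fun t => ∏ l, ∏ j, (expTwo z l - expTwo (Function.update x i t) j))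
      (∑ l, ∑ j, if j = i then (cothDiff (x i) (z l) + 1) else 0) (x i) := by
    unfold expTwo
    refine HasLogDerivAt.prod _ fun l _ => HasLogDerivAt.prod _ fun j _ => ?_
    by_cases h : j = i
    · subst h
      simpa using hasLogDerivAt_sub_exp (hxz l j).symm
    · simpa [h] using HasLogDerivAt.const _
  refine ((HasLogDerivAt.const _).mul h1).congr_logDeriv ?_
  simp [Finset.sum_add_distrib]

theorem hasLogDerivAt_prodDiffStar_left {x : Fin n → ℂ} {z : Fin k → ℂ}
    (hxz : ∀ l j, Complex.exp (2 * z l) ≠ Complex.exp (2 * x j)) (l : Fin k) :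
    HasLogDerivAt (fun t => prodDiffStar (expTwo (Function.update z l t)) (expTwo x))
      (∑ j, cothDiff (z l) (x j) + n) (z l) := by
  simp only [prodDiffStar_eq]
  have h1 : HasLogDerivAt (fun t => ∏ i, ∏ j, (expTwo (Function.update z l t) i - expTwo x j))
      (∑ i, ∑ j, if i = l then (cothDiff (z l) (x j) + 1) else 0) (z l) := by
    unfold expTwo
    refine HasLogDerivAt.prod _ fun i _ => HasLogDerivAt.prod _ fun j _ => ?_
    by_cases h : i = l
    · subst h
      simpa using hasLogDerivAt_exp_sub (hxz i j)
    · simpa [h] using HasLogDerivAt.const _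
  refine ((HasLogDerivAt.const _).mul h1).congr_logDeriv ?_
  rw [Finset.sum_comm]
  simp [Finset.sum_add_distrib]

/-- The kernel function, in the additive variables `x`, `z`, with spectral parameter `a`. -/
noncomputable def kern (m : ℕ) (a : ℂ) (x : Fin n → ℂ) (z : Fin k → ℂ) : ℂ :=
  prodDiff (expTwo x) ^ (m + 1) * prodDiff (expTwo z) ^ (m + 1) *
    (prodDiffStar (expTwo z) (expTwo x) ^ (m + 1))⁻¹ *
    Complex.exp (2 * (m + 1) * ∑ i, z i) * Complex.exp (2 * a * (∑ i, x i - ∑ i, z i))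

/-- The domain on which the kernel function is regular and non-zero. -/
def KernDom (x : Fin n → ℂ) (z : Fin k → ℂ) : Prop :=
  prodDiff (expTwo x) ≠ 0 ∧ prodDiff (expTwo z) ≠ 0 ∧ prodDiffStar (expTwo z) (expTwo x) ≠ 0

/-- The logarithmic derivative of the kernel in `x_i`. -/
noncomputable def kernX (m : ℕ) (a : ℂ) (x : Fin n → ℂ) (z : Fin k → ℂ) (i : Fin n) : ℂ :=
  (m + 1) * (∑ j, cothDiff (x i) (x j) - ∑ l, cothDiff (x i) (z l)) + 2 * a

/-- The logarithmic derivative of the kernel in `z_l`. -/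
noncomputable def kernZ (m : ℕ) (a : ℂ) (x : Fin n → ℂ) (z : Fin k → ℂ) (l : Fin k) : ℂ :=
  (m + 1) * (∑ j, cothDiff (z l) (z j) - ∑ i, cothDiff (z l) (x i)) - 2 * a

theorem hasLogDerivAt_kern_left (m : ℕ) (a : ℂ) {x : Fin (k + 1) → ℂ} {z : Fin k → ℂ}
    (h : KernDom x z) (i : Fin (k + 1)) :
    HasLogDerivAt (fun t => kern m a (Function.update x i t) z) (kernX m a x z i) (x i) := by
  obtain ⟨h1, h2, h3⟩ := h
  have hx := prodDiff_ne_zero_iff.1 h1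
  have hxz := prodDiffStar_ne_zero_iff.1 h3
  have e1 := (hasLogDerivAt_prodDiff hx i).pow (m + 1)
  have e3 := ((hasLogDerivAt_prodDiffStar_right hxz i).pow (m + 1)).inv
    (by simpa using h3)
  have e5 := HasLogDerivAt.exp (((hasDerivAt_sum_update x i).sub_const (∑ i, z i)).const_mul (2 * a))
  refine ((((e1.mul (HasLogDerivAt.const _)).mul e3).mul (HasLogDerivAt.const _)).mul
    e5).congr_logDeriv ?_
  rw [kernX]; push_cast; ring

theorem hasLogDerivAt_kern_right (m : ℕ) (a : ℂ) {x : Fin (k + 1) → ℂ} {z : Fin k → ℂ}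
    (h : KernDom x z) (l : Fin k) :
    HasLogDerivAt (fun t => kern m a x (Function.update z l t)) (kernZ m a x z l) (z l) := by
  obtain ⟨h1, h2, h3⟩ := h
  have hz := prodDiff_ne_zero_iff.1 h2
  have hxz := prodDiffStar_ne_zero_iff.1 h3
  have e1 := (hasLogDerivAt_prodDiff hz l).pow (m + 1)
  have e3 := ((hasLogDerivAt_prodDiffStar_left hxz l).pow (m + 1)).inv
    (by simpa using h3)
  have e4 := HasLogDerivAt.exp ((hasDerivAt_sum_update z l).const_mul (2 * ((m : ℂ) + 1)))
  have e5 := HasLogDerivAt.exp (((hasDerivAt_sum_update z l).const_sub (∑ i, x i)).const_mul (2 * a))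
  refine (((((HasLogDerivAt.const _).mul e1).mul e3).mul e4).mul e5).congr_logDeriv ?_
  rw [kernZ]; push_cast; ring

/-- The derivative of `kernX` in `x_i`. -/
noncomputable def kernXX (m : ℕ) (x : Fin n → ℂ) (z : Fin k → ℂ) (i : Fin n) : ℂ :=
  (m + 1) * (∑ l, cschSqDiff (x i) (z l) - ∑ j, cschSqDiff (x i) (x j))

/-- The derivative of `kernZ` in `z_l`. -/
noncomputable def kernZZ (m : ℕ) (x : Fin n → ℂ) (z : Fin k → ℂ) (l : Fin k) : ℂ :=
  (m + 1) * (∑ i, cschSqDiff (z l) (x i) - ∑ j, cschSqDiff (z l) (z j))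

theorem hasDerivAt_kernX (m : ℕ) (a : ℂ) {x : Fin n → ℂ} {z : Fin k → ℂ}
    (h : KernDom x z) (i : Fin n) :
    HasDerivAt (fun t => kernX m a (Function.update x i t) z i) (kernXX m x z i) (x i) := by
  have hx := prodDiff_ne_zero_iff.1 h.1
  have hxz := prodDiffStar_ne_zero_iff.1 h.2.2
  have e1 := hasDerivAt_sum_cothDiff hx i
  have e2 : HasDerivAt (fun t => ∑ l, cothDiff t (z l)) (∑ l, -cschSqDiff (x i) (z l)) (x i) :=
    HasDerivAt.fun_sum fun l _ => hasDerivAt_cothDiff (hxz l i).symm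
  have := ((e1.sub e2).const_mul ((m : ℂ) + 1)).add_const (2 * a)
  unfold kernX
  simp only [Function.update_self]
  refine this.congr_deriv ?_
  rw [kernXX, Finset.sum_neg_distrib]; ring

theorem hasDerivAt_kernZ (m : ℕ) (a : ℂ) {x : Fin n → ℂ} {z : Fin k → ℂ}
    (h : KernDom x z) (l : Fin k) :
    HasDerivAt (fun t => kernZ m a x (Function.update z l t) l) (kernZZ m x z l) (z l) := by
  have hz := prodDiff_ne_zero_iff.1 h.2.1
  have hxz := prodDiffStar_ne_zero_iff.1 h.2.2
  have e1 := hasDerivAt_sum_cothDiff hz l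
  have e2 : HasDerivAt (fun t => ∑ i, cothDiff t (x i)) (∑ i, -cschSqDiff (z l) (x i)) (z l) :=
    HasDerivAt.fun_sum fun i _ => hasDerivAt_cothDiff (hxz l i)
  have := ((e1.sub e2).const_mul ((m : ℂ) + 1)).sub_const (2 * a)
  unfold kernZ
  simp only [Function.update_self]
  refine this.congr_deriv ?_
  rw [kernZZ, Finset.sum_neg_distrib]; ring

theorem sum_antisymm {ι : Type*} [Fintype ι] (c : ι → ι → ℂ) (h : ∀ p q, c q p = -c p q) :
    ∑ p, ∑ q, c p q = 0 := by
  have h1 : ∑ p, ∑ q, c p q = -∑ p, ∑ q, c p q := by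
    conv_lhs => rw [Finset.sum_comm]
    simp only [← Finset.sum_neg_distrib]
    exact Finset.sum_congr rfl fun p _ => Finset.sum_congr rfl fun q _ => h p q
  linear_combination (1 / 2 : ℂ) * h1

/-- The kernel function identity. -/
theorem kernel_identity (m : ℕ) (a : ℂ) {x : Fin (k + 1) → ℂ} {z : Fin k → ℂ}
    (h : KernDom x z) :
    ∑ i, (kernX m a x z i ^ 2 + kernXX m x z i) =
      ∑ l, (kernZ m a x z l ^ 2 + kernZZ m x z l) + 4 * a ^ 2 +
        m * (m + 1) * (∑ i, ∑ j, cschSqDiff (x i) (x j)) -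
        m * (m + 1) * (∑ i, ∑ j, cschSqDiff (z i) (z j)) := by
  have hx := prodDiff_ne_zero_iff.1 h.1
  have hz := prodDiff_ne_zero_iff.1 h.2.1
  have hxz := prodDiffStar_ne_zero_iff.1 h.2.2
  -- With k + 1 weights 1 and k weights -1 the sum of the weights is 1, and the constant (1³ - 1)/3
  -- disappears.
  have key := sum_weighted_cothDiff_sq (ι := Fin (k + 1) ⊕ Fin k) (Sum.elim x z)
    (Sum.elim (fun _ => 1) (fun _ => -1)) (by rintro (i | i) <;> simp) (by
      rintro (i | i) (j | j) hij
      · exact hx i j (by simpa using hij)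
      · exact (hxz j i).symm
      · exact hxz i j
      · exact hz i j (by simpa using hij))
  simp only [Fintype.sum_sum_type, Sum.elim_inl, Sum.elim_inr] at key
  simp only [one_mul, neg_mul, Finset.sum_neg_distrib, Finset.sum_const, Finset.card_univ,
    Fintype.card_fin, nsmul_eq_mul, mul_one, Finset.sum_add_distrib] at key
  have hc : ∑ l, ∑ i, cschSqDiff (z l) (x i) = ∑ i, ∑ l, cschSqDiff (x i) (z l) := by
    rw [Finset.sum_comm]; simp only [cschSqDiff_comm]
  -- The terms linear in a: sums over pairs of one kind vanish by antisymmetry, and the mixed sums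
  -- agree on both sides. What remains of a is (k + 1) · 4a² - k · 4a².
  have a1 := sum_antisymm (fun i j => cothDiff (x i) (x j)) fun _ _ => cothDiff_comm _ _
  have a2 := sum_antisymm (fun i j => cothDiff (z i) (z j)) fun _ _ => cothDiff_comm _ _
  have a3 : ∑ l, ∑ i, cothDiff (z l) (x i) = -∑ i, ∑ l, cothDiff (x i) (z l) := by
    rw [Finset.sum_comm]
    simp only [← Finset.sum_neg_distrib, ← cothDiff_comm]
  set X1 : Fin (k + 1) → ℂ := fun i => ∑ j, cothDiff (x i) (x j) with hX1
  set X2 : Fin (k + 1) → ℂ := fun i => ∑ l, cothDiff (x i) (z l) with hX2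
  set Z1 : Fin k → ℂ := fun l => ∑ j, cothDiff (z l) (z j) with hZ1
  set Z2 : Fin k → ℂ := fun l => ∑ i, cothDiff (z l) (x i) with hZ2
  have l1 : ∑ i, kernX m a x z i ^ 2 = (m + 1) ^ 2 * ∑ i, (X1 i + -X2 i) ^ 2 +
      4 * a * (m + 1) * (∑ i, X1 i - ∑ i, X2 i) + (k + 1) * (4 * a ^ 2) := by
    have : ∀ i, kernX m a x z i ^ 2 = (m + 1) ^ 2 * (X1 i + -X2 i) ^ 2 +
      4 * a * (m + 1) * (X1 i - X2 i) + 4 * a ^ 2 := fun i => by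
        simp only [kernX, hX1, hX2]; ring
    simp only [this, Finset.sum_add_distrib, ← Finset.mul_sum, Finset.sum_sub_distrib]
    simp; ring
  have l2 : ∑ l, kernZ m a x z l ^ 2 = (m + 1) ^ 2 * ∑ l, (Z2 l + -Z1 l) ^ 2 +
      -4 * a * (m + 1) * (∑ i, Z1 i - ∑ i, Z2 i) + k * (4 * a ^ 2) := by
    have : ∀ l, kernZ m a x z l ^ 2 = (m + 1) ^ 2 * (Z2 l + -Z1 l) ^ 2 +
      -4 * a * (m + 1) * (Z1 l - Z2 l) + 4 * a ^ 2 := fun i => by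
        simp only [kernZ, hZ1, hZ2]; ring
    simp only [this, Finset.sum_add_distrib, ← Finset.mul_sum, Finset.sum_sub_distrib]
    simp; ring
  simp only [Finset.sum_add_distrib, l1, l2, kernXX, kernZZ, ← Finset.mul_sum,
    Finset.sum_sub_distrib]
  push_cast at key
  simp only [hX1, hX2, hZ1, hZ2] at key a1 a2 a3 ⊢
  rw [hc] at key ⊢
  linear_combination ((m : ℂ) + 1) ^ 2 * key + 4 * a * (m + 1) * a1 + 4 * a * (m + 1) * a2
    - 4 * a * (m + 1) * a3
end kernel

/-! ### The Schrödinger equation on exponentials divided by a power of B -/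

section gauge
variable {n : ℕ}

theorem iteratedDeriv_two_eq {f f₁ : ℂ → ℂ} {f₂ t₀ : ℂ}
    (h₁ : ∀ᶠ t in nhds t₀, HasDerivAt f (f₁ t) t) (h₂ : HasDerivAt f₁ f₂ t₀) :
    iteratedDeriv 2 f t₀ = f₂ := by
  rw [iteratedDeriv_succ, iteratedDeriv_one]
  have : deriv f =ᶠ[nhds t₀] f₁ := h₁.mono fun t ht => ht.deriv
  rw [this.deriv_eq, h₂.deriv]

/-- From h' = L h follows h'' = (L² + L') h. -/
theorem iteratedDeriv_two_sum {ι : Type*} (s : Finset ι) (c : ι → ℂ) (h L : ι → ℂ → ℂ)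
    (L' : ι → ℂ) {t₀ : ℂ}
    (h₁ : ∀ᶠ t in nhds t₀, ∀ α ∈ s, HasLogDerivAt (h α) (L α t) t)
    (h₂ : ∀ α ∈ s, HasDerivAt (L α) (L' α) t₀) :
    iteratedDeriv 2 (fun t => ∑ α ∈ s, c α * h α t) t₀ =
      ∑ α ∈ s, c α * ((L α t₀ ^ 2 + L' α) * h α t₀) := by
  refine iteratedDeriv_two_eq (f₁ := fun t => ∑ α ∈ s, c α * (L α t * h α t)) ?_ ?_
  · filter_upwards [h₁] with t ht
    exact HasDerivAt.fun_sum fun α hα => (HasDerivAt.const_mul (c α) (ht α hα))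
  · refine HasDerivAt.fun_sum fun α hα => ?_
    have := ((h₂ α hα).mul (h₁.self_of_nhds α hα)).const_mul (c α)
    exact this.congr_deriv (by ring)

/-- The symbol of the Sutherland operator, conjugated by `B(x)^s`, minus its eigenvalue, on
`exp (α + 2ν, x)`. -/
noncomputable def gaugeSymbol (m s : ℕ) (ν x : Fin n → ℂ) (α : Fin n → ℤ) : ℂ :=
  ∑ i, (α i + 2 * ν i - s * ∑ j, cothDiff (x i) (x j)) ^ 2 +
    ((s : ℂ) - m * (m + 1)) * (∑ i, ∑ j, cschSqDiff (x i) (x j)) - 4 * ∑ i, ν i ^ 2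

theorem potential_eq (m : ℕ) (x : Fin n → ℂ) :
    (∑ i : Fin n, ∑ j ∈ Finset.Ioi i,
      2 * (m : ℂ) * ((m : ℂ) + 1) / Complex.sinh (x i - x j) ^ 2) =
      m * (m + 1) * ∑ i, ∑ j, cschSqDiff (x i) (x j) := by
  have h1 : ∀ i j, 2 * (m : ℂ) * ((m : ℂ) + 1) / Complex.sinh (x i - x j) ^ 2 =
      m * (m + 1) * (cschSqDiff (x i) (x j) + cschSqDiff (x j) (x i)) := by
    intro i j
    rw [cschSqDiff_comm (x i) (x j), cschSqDiff_eq]; ring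
  simp only [h1, ← Finset.mul_sum]
  rw [sum_sum_Ioi_symm (fun i j => cschSqDiff (x i) (x j))]
  congr 1
  refine Finset.sum_congr rfl fun i _ => ?_
  rw [← Finset.add_sum_erase _ _ (Finset.mem_univ i), cschSqDiff_self, zero_add]

theorem hasLogDerivAt_trigChar (α : Fin n → ℤ) (x : Fin n → ℂ) (i : Fin n) :
    HasLogDerivAt (fun t => trigChar α (Function.update x i t)) (α i) (x i) := by
  unfold trigChar
  refine HasLogDerivAt.exp ?_
  have : HasDerivAt (fun t => ∑ j, (α j : ℂ) * Function.update x i t j)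
      (∑ j, if j = i then (α j : ℂ) else 0) (x i) := by
    refine HasDerivAt.fun_sum fun j _ => ?_
    by_cases h : j = i
    · subst h; simpa using (hasDerivAt_id' (x j)).const_mul (α j : ℂ)
    · simpa [h] using hasDerivAt_const _ _
  simpa using this

theorem hasDerivAt_inner_update (ν x : Fin n → ℂ) (i : Fin n) :
    HasDerivAt (fun t => 2 * ∑ j, ν j * Function.update x i t j) (2 * ν i) (x i) := by
  have : HasDerivAt (fun t => ∑ j, ν j * Function.update x i t j)
      (∑ j, if j = i then ν j else 0) (x i) := by
    refine HasDerivAt.fun_sum fun j _ => ?_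
    by_cases h : j = i
    · subst h; simpa using (hasDerivAt_id' (x j)).const_mul (ν j)
    · simpa [h] using hasDerivAt_const _ _
  simpa using this.const_mul (2 : ℂ)

theorem continuous_update_right (x : Fin n → ℂ) (i : Fin n) :
    Continuous (fun t : ℂ => Function.update x i t) :=
  continuous_const.update i continuous_id

theorem sinh_exp_ne {x : Fin n → ℂ} (hx : prodSinh x ≠ 0) (i j : Fin n) (hij : i ≠ j) :
    Complex.exp (2 * x i) ≠ Complex.exp (2 * x j) :=
  (exp_two_ne_iff _ _).2 (prodSinh_ne_zero_iff.1 hx i j hij)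

/-- On e^{(α + 2ν, x)} B^{-s} the operator is multiplication by a function: the logarithmic
derivative in x_i is α_i + 2ν_i - s ∑ coth, with derivative s ∑ 1/sinh². This turns the differential
equation for a numerator into a pointwise identity between characters. -/
theorem sutherlandOp_eq (m s : ℕ) (Q : TrigPoly n) (c : ℂ) (ν x : Fin n → ℂ)
    (hx : prodSinh x ≠ 0) :
    sutherlandOp n m (fun y => Q.ev y ν / (prodSinh y ^ s * c) *
        Complex.exp (2 * ∑ i, ν i * y i)) x +
      4 * (∑ i, ν i ^ 2) * (Q.ev x ν / (prodSinh x ^ s * c) * Complex.exp (2 * ∑ i, ν i * x i)) =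
    -(Q.sum fun α p => trigChar α x * MvPolynomial.eval ν p * gaugeSymbol m s ν x α) *
      ((prodSinh x ^ s * c)⁻¹ * Complex.exp (2 * ∑ i, ν i * x i)) := by
  set h : (Fin n → ℤ) → (Fin n → ℂ) → ℂ := fun α y =>
    trigChar α y * (prodSinh y ^ s)⁻¹ * Complex.exp (2 * ∑ i, ν i * y i) with hh
  have hf : ∀ y, Q.ev y ν / (prodSinh y ^ s * c) * Complex.exp (2 * ∑ i, ν i * y i) =
      ∑ α ∈ Q.support, (MvPolynomial.eval ν (Q α) * c⁻¹) * h α y := by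
    intro y
    rw [TrigPoly.ev_eq_sum, Finset.sum_div, Finset.sum_mul]
    refine Finset.sum_congr rfl fun α _ => ?_
    simp only [hh, div_eq_mul_inv, mul_inv]; ring
  have hL : ∀ i, ∀ y : Fin n → ℂ, prodSinh y ≠ 0 → ∀ α, HasLogDerivAt
      (fun t => h α (Function.update y i t))
      (α i + 2 * ν i - s * ∑ j, cothDiff (y i) (y j)) (y i) := by
    intro i y hy α
    have e1 := ((hasLogDerivAt_prodSinh (sinh_exp_ne hy) i).pow s).inv (by
        rw [Function.update_eq_self]; exact pow_ne_zero _ hy)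
    refine (((hasLogDerivAt_trigChar α y i).mul e1).mul
      (HasLogDerivAt.exp (hasDerivAt_inner_update ν y i))).congr_logDeriv ?_
    ring
  have h2 : ∀ i, iteratedDeriv 2 (fun t => ∑ α ∈ Q.support, (MvPolynomial.eval ν (Q α) * c⁻¹) *
      h α (Function.update x i t)) (x i) = ∑ α ∈ Q.support, (MvPolynomial.eval ν (Q α) * c⁻¹) *
      (((α i + 2 * ν i - s * ∑ j, cothDiff (x i) (x j)) ^ 2 + s * ∑ j, cschSqDiff (x i) (x j)) *
        h α x) := by
    intro i
    have := iteratedDeriv_two_sum Q.support (fun α => MvPolynomial.eval ν (Q α) * c⁻¹)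
      (fun α t => h α (Function.update x i t))
      (fun α t => α i + 2 * ν i - s * ∑ j, cothDiff t (Function.update x i t j))
      (fun α => s * ∑ j, cschSqDiff (x i) (x j)) (t₀ := x i) ?_ ?_
    · simpa only [Function.update_eq_self] using this
    · have hev : ∀ᶠ t in nhds (x i), prodSinh (Function.update x i t) ≠ 0 := by
        have hcont : Continuous (fun t => prodSinh (Function.update x i t)) :=
          continuous_prodSinh.comp (continuous_update_right x i)
        refine hcont.continuousAt.eventually_ne ?_
        simpa using hx
      filter_upwards [hev] with t ht α _
      have := hL i (Function.update x i t) ht α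
      simpa only [Function.update_self, Function.update_idem] using this
    · intro α _
      have := ((hasDerivAt_sum_cothDiff (sinh_exp_ne hx) i).const_mul (s : ℂ)).const_sub
        ((α i : ℂ) + 2 * ν i)
      exact this.congr_deriv (by ring)
  rw [sutherlandOp, potential_eq]
  simp only [hf, h2, Finsupp.sum]
  rw [Finset.sum_comm, ← Finset.sum_neg_distrib, Finset.mul_sum Q.support,
    Finset.mul_sum Q.support,
    ← Finset.sum_add_distrib, ← Finset.sum_add_distrib, ← Finset.sum_neg_distrib, Finset.sum_mul]
  refine Finset.sum_congr rfl fun α _ => ?_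
  rw [← Finset.mul_sum, ← Finset.sum_mul, Finset.sum_add_distrib, ← Finset.mul_sum, gaugeSymbol]
  simp only [hh, mul_inv]
  ring

/-- The Schrödinger equation in terms of the symbol. -/
theorem sutherlandOp_eigen_iff (m s : ℕ) (Q : TrigPoly n) {c : ℂ} (hc : c ≠ 0) (ν x : Fin n → ℂ)
    (hx : prodSinh x ≠ 0) :
    sutherlandOp n m (fun y => Q.ev y ν / (prodSinh y ^ s * c) *
        Complex.exp (2 * ∑ i, ν i * y i)) x =
      -4 * (∑ i, ν i ^ 2) *
        (Q.ev x ν / (prodSinh x ^ s * c) * Complex.exp (2 * ∑ i, ν i * x i)) ↔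
    (Q.sum fun α p => trigChar α x * MvPolynomial.eval ν p * gaugeSymbol m s ν x α) = 0 := by
  have h := sutherlandOp_eq m s Q c ν x hx
  have h0 : (prodSinh x ^ s * c)⁻¹ * Complex.exp (2 * ∑ i, ν i * x i) ≠ 0 :=
    mul_ne_zero (inv_ne_zero (mul_ne_zero (pow_ne_zero _ hx) hc)) (Complex.exp_ne_zero _)
  constructor
  · intro h1
    rw [h1] at h
    have h2 : (Q.sum fun α p => trigChar α x * MvPolynomial.eval ν p * gaugeSymbol m s ν x α) *
      ((prodSinh x ^ s * c)⁻¹ * Complex.exp (2 * ∑ i, ν i * x i)) = 0 := by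
      linear_combination h
    exact (mul_eq_zero.1 h2).resolve_right h0
  · intro h1
    rw [h1] at h
    linear_combination h

end gauge

/-! ### Uniqueness from the leading exponent along a generic ray -/

section uniqueness
variable {n : ℕ}

/-- Twice the Weyl vector. -/
def twoRho (n : ℕ) (i : Fin n) : ℤ := ∑ j, if i < j then 1 else if j < i then -1 else 0

/-- The ratio `u_b / u_a`. -/
noncomputable def expRatio (x : Fin n → ℂ) (a b : Fin n) : ℂ := Complex.exp (2 * (x b - x a))

theorem cothDiff_expRatio (x : Fin n → ℂ) (a b : Fin n) :
    cothDiff (x a) (x b) = (1 + expRatio x a b) / (1 - expRatio x a b) := by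
  have h : Complex.exp (2 * x b) = Complex.exp (2 * x a) * expRatio x a b := by
    rw [expRatio, ← Complex.exp_add]; ring_nf
  rw [cothDiff, h]
  have h0 := Complex.exp_ne_zero (2 * x a)
  rw [show Complex.exp (2 * x a) + Complex.exp (2 * x a) * expRatio x a b =
    Complex.exp (2 * x a) * (1 + expRatio x a b) by ring,
    show Complex.exp (2 * x a) - Complex.exp (2 * x a) * expRatio x a b =
    Complex.exp (2 * x a) * (1 - expRatio x a b) by ring, mul_div_mul_left _ _ h0]

theorem cschSqDiff_expRatio (x : Fin n → ℂ) (a b : Fin n) :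
    cschSqDiff (x a) (x b) = 4 * expRatio x a b / (1 - expRatio x a b) ^ 2 := by
  have h : Complex.exp (2 * x b) = Complex.exp (2 * x a) * expRatio x a b := by
    rw [expRatio, ← Complex.exp_add]; ring_nf
  rw [cschSqDiff, h]
  have h0 := Complex.exp_ne_zero (2 * x a)
  rw [show 4 * Complex.exp (2 * x a) * (Complex.exp (2 * x a) * expRatio x a b) =
    Complex.exp (2 * x a) ^ 2 * (4 * expRatio x a b) by ring,
    show (Complex.exp (2 * x a) - Complex.exp (2 * x a) * expRatio x a b) ^ 2 =
    Complex.exp (2 * x a) ^ 2 * (1 - expRatio x a b) ^ 2 by ring,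
    mul_div_mul_left _ _ (pow_ne_zero 2 h0)]

/-- Splits off the exponential that dominates B in the chamber; the other factors have a non-zero
limit there. -/
theorem prodSinh_eq_trigChar (x : Fin n → ℂ) :
    prodSinh x = trigChar (twoRho n) x *
      ∏ i : Fin n, ∏ j ∈ Finset.Ioi i, ((1 - expRatio x i j) / 2) := by
  have h1 : ∀ i j, Complex.sinh (x i - x j) =
      Complex.exp (x i - x j) * ((1 - expRatio x i j) / 2) := by
    intro i j
    rw [Complex.sinh, expRatio, mul_div_assoc', mul_sub, mul_one, ← Complex.exp_add]
    ring_nf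
  have h2 : ∑ i : Fin n, ∑ j ∈ Finset.Ioi i, (x i - x j) = ∑ i, (twoRho n i : ℂ) * x i := by
    have := sum_sum_Ioi_symm (fun i j : Fin n =>
      (if i < j then 1 else if j < i then -1 else 0) * x i)
    calc ∑ i : Fin n, ∑ j ∈ Finset.Ioi i, (x i - x j) = _ := by
          refine Finset.sum_congr rfl fun i _ => Finset.sum_congr rfl fun j hj => ?_
          have hij := Finset.mem_Ioi.1 hj
          simp only [hij, not_lt_of_gt hij, if_true, if_false]
          show _ = (1 * x i + -1 * x j)
          ring
      _ = _ := this
      _ = _ := by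
          refine Finset.sum_congr rfl fun i _ => ?_
          rw [twoRho, ← Finset.sum_mul, ← Finset.add_sum_erase _ _ (Finset.mem_univ i)]
          push_cast
          simp
  simp only [prodSinh, h1, Finset.prod_mul_distrib, ← Complex.exp_sum, h2, trigChar]

/-- With v_i a decreasing sequence of powers of t, a coincidence of two exponents is a root of a
non-zero polynomial in t. Only finitely many t > 1 are excluded. -/
theorem exists_generic_direction (S : Finset (Fin n → ℤ)) :
    ∃ v : Fin n → ℝ, StrictAnti v ∧
      ∀ α ∈ S, ∀ β ∈ S, ∑ i, (α i : ℝ) * v i = ∑ i, (β i : ℝ) * v i → α = β := by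
  classical
  let p : (Fin n → ℤ) → Polynomial ℝ := fun α =>
    ∑ i, Polynomial.monomial (Fin.rev i : ℕ) (α i : ℝ)
  have hp : ∀ α, p α = 0 → α = 0 := by
    intro α h
    funext i
    have := congrArg (fun q => Polynomial.coeff q (Fin.rev i : ℕ)) h
    simp only [p, Polynomial.finsetSum_coeff, Polynomial.coeff_monomial, Polynomial.coeff_zero,
      Fin.val_inj, Fin.rev_inj] at this
    simpa using this
  let F : Polynomial ℝ := ∏ q ∈ (S ×ˢ S).filter (fun q => q.1 ≠ q.2), p (q.1 - q.2)
  have hF : F ≠ 0 := by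
    rw [Finset.prod_ne_zero_iff]
    intro q hq h
    exact (Finset.mem_filter.1 hq).2 (sub_eq_zero.1 (hp _ h))
  obtain ⟨t, ht1, ht2⟩ : ∃ t : ℝ, 1 < t ∧ ¬ F.IsRoot t := by
    by_contra! hcon
    exact hF (Polynomial.eq_zero_of_infinite_isRoot F
      ((Set.Ioi_infinite (1 : ℝ)).mono fun t ht => hcon t ht))
  refine ⟨fun i => t ^ (Fin.rev i : ℕ), fun i j hij => ?_, fun α hα β hβ h => ?_⟩
  · exact pow_lt_pow_right₀ ht1 (Fin.lt_def.1 (Fin.rev_lt_rev.2 hij))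
  · by_contra hne
    refine ht2 ?_
    rw [Polynomial.IsRoot, Polynomial.eval_prod]
    refine Finset.prod_eq_zero (i := (α, β)) (by simp [hα, hβ, hne]) ?_
    simp only [p, Polynomial.eval_finsetSum, Polynomial.eval_monomial, Pi.sub_apply, Int.cast_sub,
      sub_mul, Finset.sum_sub_distrib]
    linarith

/-- The point `t v`. -/
noncomputable def ray (v : Fin n → ℝ) (t : ℝ) : Fin n → ℂ := fun i => ((t * v i : ℝ) : ℂ)

theorem tendsto_exp_neg_ray {d : ℝ} (hd : d < 0) :
    Filter.Tendsto (fun t : ℝ => Complex.exp ((t * d : ℝ) : ℂ)) Filter.atTop (nhds 0) := by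
  rw [tendsto_zero_iff_norm_tendsto_zero]
  simp only [Complex.norm_exp, Complex.ofReal_re]
  exact Real.tendsto_exp_atBot.comp (Filter.tendsto_id.atTop_mul_const_of_neg hd)

theorem tendsto_expRatio_ray {v : Fin n → ℝ} (hv : StrictAnti v) {i j : Fin n} (hij : i < j) :
    Filter.Tendsto (fun t => expRatio (ray v t) i j) Filter.atTop (nhds 0) := by
  have := tendsto_exp_neg_ray (d := 2 * (v j - v i)) (by linarith [hv hij])
  refine this.congr fun t => ?_
  simp only [expRatio, ray]; push_cast; ring_nf

theorem tendsto_cothDiff_ray {v : Fin n → ℝ} (hv : StrictAnti v) (i j : Fin n) :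
    Filter.Tendsto (fun t => cothDiff (ray v t i) (ray v t j)) Filter.atTop
      (nhds (if i < j then 1 else if j < i then -1 else 0)) := by
  have key : ∀ {i j : Fin n}, i < j →
      Filter.Tendsto (fun t => cothDiff (ray v t i) (ray v t j)) Filter.atTop (nhds 1) := by
    intro i j hij
    have h := tendsto_expRatio_ray hv hij
    have h1 := (tendsto_const_nhds (x := (1 : ℂ))).add h
    have h2 := (tendsto_const_nhds (x := (1 : ℂ))).sub h
    have := h1.div h2 (by simp)
    simp only [cothDiff_expRatio]
    simpa [Pi.div_def] using this
  rcases lt_trichotomy i j with h | h | h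
  · simpa [h] using key h
  · subst h; simp [cothDiff_self]
  · have := (key h).neg
    simp only [← cothDiff_comm] at this
    simpa [h, not_lt_of_gt h] using this

theorem tendsto_cschSqDiff_ray {v : Fin n → ℝ} (hv : StrictAnti v) (i j : Fin n) :
    Filter.Tendsto (fun t => cschSqDiff (ray v t i) (ray v t j)) Filter.atTop (nhds 0) := by
  have key : ∀ {i j : Fin n}, i < j →
      Filter.Tendsto (fun t => cschSqDiff (ray v t i) (ray v t j)) Filter.atTop (nhds 0) := by
    intro i j hij
    have h := tendsto_expRatio_ray hv hij
    have h1 := (tendsto_const_nhds (x := (4 : ℂ))).mul h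
    have h2 := ((tendsto_const_nhds (x := (1 : ℂ))).sub h).pow 2
    have := h1.div h2 (by simp)
    simp only [cschSqDiff_expRatio]
    simpa [Pi.div_def] using this
  rcases lt_trichotomy i j with h | h | h
  · exact key h
  · subst h; simp [cschSqDiff_self]
  · simpa only [cschSqDiff_comm] using key h

/-- In the chamber coth tends to ±1 and 1/sinh² to 0, so ∑_j coth tends to the i-th coordinate of
`twoRho n`. -/
theorem tendsto_gaugeSymbol_ray (m : ℕ) {v : Fin n → ℝ} (hv : StrictAnti v) (ν : Fin n → ℂ)
    (α : Fin n → ℤ) :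
    Filter.Tendsto (fun t => gaugeSymbol m m ν (ray v t) α) Filter.atTop
      (nhds (∑ i, (α i + 2 * ν i - m * twoRho n i) ^ 2 - 4 * ∑ i, ν i ^ 2)) := by
  have h1 : ∀ i, Filter.Tendsto (fun t => ∑ j, cothDiff (ray v t i) (ray v t j)) Filter.atTop
      (nhds (twoRho n i : ℂ)) := by
    intro i
    have := tendsto_finsetSum Finset.univ fun j _ => tendsto_cothDiff_ray hv i j
    convert this using 2
    rw [twoRho]; push_cast; rfl
  have h2 : Filter.Tendsto (fun t => ∑ i, ∑ j, cschSqDiff (ray v t i) (ray v t j)) Filter.atTop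
      (nhds 0) := by
    have := tendsto_finsetSum Finset.univ fun i _ =>
      tendsto_finsetSum Finset.univ fun j _ => tendsto_cschSqDiff_ray hv i j
    simpa using this
  have h3 := tendsto_finsetSum Finset.univ fun i _ =>
    (((h1 i).const_mul (m : ℂ)).const_sub ((α i : ℂ) + 2 * ν i)).pow 2
  have := (h3.add (h2.const_mul ((m : ℂ) - m * (m + 1)))).sub_const (4 * ∑ i, ν i ^ 2)
  simpa [gaugeSymbol] using this

theorem tendsto_ray_chamber {v : Fin n → ℝ} (hv : StrictAnti v) :
    Filter.Tendsto (fun t : ℝ => fun i => t * v i) Filter.atTop (chamberAtTop n) := by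
  simp only [chamberAtTop, Filter.tendsto_iInf, Filter.tendsto_comap_iff]
  intro i j hij
  have : Filter.Tendsto (fun t : ℝ => t * (v i - v j)) Filter.atTop Filter.atTop :=
    Filter.tendsto_id.atTop_mul_const (sub_pos.2 (hv hij))
  refine this.congr fun t => ?_
  simp [mul_sub]

theorem prodSinh_ray_ne_zero {v : Fin n → ℝ} (hv : StrictAnti v) {t : ℝ} (ht : 0 < t) :
    prodSinh (ray v t) ≠ 0 := by
  rw [prodSinh_ne_zero_iff]
  intro i j hij
  rw [ray, ray, ← Complex.ofReal_sub, ← Complex.ofReal_sinh]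
  norm_cast
  rw [Real.sinh_eq_zero, ← mul_sub]
  exact mul_ne_zero ht.ne' (sub_ne_zero.2 (hv.injective.ne hij))

/-- After division by the leading character every other term decays exponentially. -/
theorem tendsto_sum_ray {v : Fin n → ℝ} (s : Finset (Fin n → ℤ)) {α₀ : Fin n → ℤ} (h₀ : α₀ ∈ s)
    (hmax : ∀ α ∈ s, α ≠ α₀ → ∑ i, (α i : ℝ) * v i < ∑ i, (α₀ i : ℝ) * v i)
    (g : (Fin n → ℤ) → ℝ → ℂ) (l : (Fin n → ℤ) → ℂ)
    (hg : ∀ α ∈ s, Filter.Tendsto (g α) Filter.atTop (nhds (l α))) :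
    Filter.Tendsto (fun t => (trigChar α₀ (ray v t))⁻¹ * ∑ α ∈ s, trigChar α (ray v t) * g α t)
      Filter.atTop (nhds (l α₀)) := by
  classical
  have h1 : ∀ α t, (trigChar α₀ (ray v t))⁻¹ * trigChar α (ray v t) =
      Complex.exp ((t * (∑ i, (α i : ℝ) * v i - ∑ i, (α₀ i : ℝ) * v i) : ℝ) : ℂ) := by
    intro α t
    rw [trigChar, trigChar, ← Complex.exp_neg, ← Complex.exp_add]
    congr 1
    simp only [ray]
    push_cast
    rw [mul_sub, Finset.mul_sum, Finset.mul_sum]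
    rw [show ∀ a b : ℂ, -a + b = b - a by intros; ring]
    congr 1 <;> exact Finset.sum_congr rfl fun i _ => by ring
  simp only [Finset.mul_sum, ← mul_assoc, h1]
  have h2 : ∀ α ∈ s, Filter.Tendsto (fun t : ℝ =>
      Complex.exp ((t * (∑ i, (α i : ℝ) * v i - ∑ i, (α₀ i : ℝ) * v i) : ℝ) : ℂ) * g α t)
      Filter.atTop (nhds (if α = α₀ then l α else 0)) := by
    intro α hα
    by_cases h : α = α₀
    · subst h; simpa using hg α hα
    · have := (tendsto_exp_neg_ray (sub_neg.2 (hmax α hα h))).mul (hg α hα)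
      simpa [h] using this
  have := tendsto_finsetSum s h2
  simpa [h₀] using this

-- At the leading exponent of B^m, the coefficient is a constant multiple of the limit of D / B^m,
-- which is zero.
open MvPolynomial in
theorem eval_leading_eq_zero {m : ℕ} (D : TrigPoly n) {v : Fin n → ℝ} (hv : StrictAnti v)
    {α₀ : Fin n → ℤ} (hα₀ : α₀ ∈ D.support)
    (hmax : ∀ α ∈ D.support, α ≠ α₀ → ∑ i, (α i : ℝ) * v i < ∑ i, (α₀ i : ℝ) * v i)
    (hμ0 : ∀ i, α₀ i = m * twoRho n i) (ν : Fin n → ℂ) {c : ℂ} (hc : c ≠ 0)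
    (l1 : Filter.Tendsto (fun t : ℝ => D.ev (ray v t) ν / (prodSinh (ray v t) ^ m * c))
      Filter.atTop (nhds 0)) : eval ν (D α₀) = 0 := by
  have hα₀B : ∀ x, prodSinh x ^ m = trigChar α₀ x *
      (∏ i : Fin n, ∏ j ∈ Finset.Ioi i, ((1 - expRatio x i j) / 2)) ^ m := by
    intro x
    rw [prodSinh_eq_trigChar, mul_pow]
    congr 1
    rw [trigChar, trigChar, ← Complex.exp_nat_mul, Finset.mul_sum]
    congr 1
    refine Finset.sum_congr rfl fun i _ => ?_
    rw [hμ0 i]; push_cast; ring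
  have l2 := tendsto_sum_ray D.support hα₀ hmax
      (fun α t => eval ν (D α)) _ (fun α _ => tendsto_const_nhds)
  have l3 : Filter.Tendsto (fun t => (∏ i : Fin n, ∏ j ∈ Finset.Ioi i,
      ((1 - expRatio (ray v t) i j) / 2)) ^ m) Filter.atTop
      (nhds ((∏ i : Fin n, ∏ j ∈ Finset.Ioi i, ((1 - 0) / 2)) ^ m)) :=
    (tendsto_finsetProd _ fun i _ => tendsto_finsetProd _ fun j hj =>
      ((tendsto_expRatio_ray hv (Finset.mem_Ioi.1 hj)).const_sub 1).div_const 2).pow m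
  have l4 := (l1.mul (l3.mul_const c))
  rw [zero_mul] at l4
  refine tendsto_nhds_unique (l2.congr' ?_) l4
  filter_upwards [Filter.eventually_gt_atTop 0] with t ht
  have hB := prodSinh_ray_ne_zero hv ht
  rw [← TrigPoly.ev_eq_sum]
  have h7 := pow_ne_zero m hB
  rw [hα₀B] at h7 ⊢
  have h8 := left_ne_zero_of_mul h7
  have h9 := right_ne_zero_of_mul h7
  generalize (∏ i : Fin n, ∏ j ∈ Finset.Ioi i, ((1 - expRatio (ray v t) i j) / 2)) ^ m = Y at *
  field_simp

-- Let α₀ = μ + m · `twoRho n` be the leading exponent of the difference. The limit of the equation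
-- says that its coefficient, multiplied by ∑ (μ_i² + 4 μ_i ν_i), is zero. Hence μ = 0, and the
-- normalisation excludes this case.
open MvPolynomial in
theorem IsBANumerator.unique {m : ℕ} {P₁ P₂ : TrigPoly n} (h₁ : IsBANumerator n m P₁)
    (h₂ : IsBANumerator n m P₂) : P₁ = P₂ := by
  classical
  by_contra hne
  set D : TrigPoly n := P₁ - P₂ with hD
  have hD0 : D ≠ 0 := sub_ne_zero.2 hne
  obtain ⟨v, hv, hinj⟩ := exists_generic_direction D.support
  obtain ⟨α₀, hα₀, hmax'⟩ := D.support.exists_max_image (fun α => ∑ i, (α i : ℝ) * v i)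
    (Finsupp.support_nonempty_iff.2 hD0)
  have hmax : ∀ α ∈ D.support, α ≠ α₀ → ∑ i, (α i : ℝ) * v i < ∑ i, (α₀ i : ℝ) * v i :=
    fun α hα hne => lt_of_le_of_ne (hmax' α hα) fun h => hne (hinj α hα α₀ hα₀ h)
  have heq : ∀ ν, normConst m ν ≠ 0 → ∀ x, prodSinh x ≠ 0 →
      ∑ α ∈ D.support, trigChar α x * (eval ν (D α) * gaugeSymbol m m ν x α) = 0 := by
    intro ν hν x hx
    have e1 := (sutherlandOp_eigen_iff m m P₁ hν ν x hx).1 (h₁.eigen ν hν x hx)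
    have e2 := (sutherlandOp_eigen_iff m m P₂ hν ν x hx).1 (h₂.eigen ν hν x hx)
    have e3 : (D.sum fun α p => trigChar α x * eval ν p * gaugeSymbol m m ν x α) = 0 := by
      rw [hD, Finsupp.sum_sub_index, e1, e2, sub_zero]
      intros; rw [map_sub]; ring
    simpa only [Finsupp.sum, mul_assoc] using e3
  set μ : Fin n → ℤ := fun i => α₀ i - m * twoRho n i with hμ
  have hlim : ∀ ν, normConst m ν ≠ 0 → eval ν (D α₀) *
      (∑ i, ((α₀ i : ℂ) + 2 * ν i - m * twoRho n i) ^ 2 - 4 * ∑ i, ν i ^ 2) = 0 := by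
    intro ν hν
    have := tendsto_sum_ray D.support hα₀ hmax
      (fun α t => eval ν (D α) * gaugeSymbol m m ν (ray v t) α) _
      (fun α _ => (tendsto_gaugeSymbol_ray m hv ν α).const_mul (eval ν (D α)))
    refine tendsto_nhds_unique (this.congr' ?_) tendsto_const_nhds
    filter_upwards [Filter.eventually_gt_atTop 0] with t ht
    rw [heq ν hν _ (prodSinh_ray_ne_zero hv ht), mul_zero]
  have hc0 : D α₀ ≠ 0 := Finsupp.mem_support_iff.1 hα₀
  set p : MvPolynomial (Fin n) ℂ := ∑ i, (C ((μ i : ℂ) ^ 2) + C (4 * (μ i : ℂ)) * X i) with hp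
  have hp0 : D α₀ * p = 0 := by
    refine eq_zero_of_normConst_ne_zero m _ fun ν hν => ?_
    rw [← hlim ν hν, map_mul]
    congr 1
    simp only [hp, map_sum, map_add, map_mul, eval_C, eval_X, Finset.mul_sum,
      ← Finset.sum_sub_distrib]
    refine Finset.sum_congr rfl fun i _ => ?_
    simp only [hμ]; push_cast; ring
  have hp1 := (mul_eq_zero.1 hp0).resolve_left hc0
  have hμ0 : ∀ i, α₀ i = m * twoRho n i := by
    -- At ν = 0 only ∑ μ_i² is left, a sum of squares of integers.
    have h3 := congrArg (eval (0 : Fin n → ℂ)) hp1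
    simp only [hp, map_sum, map_add, map_mul, eval_C, eval_X, Pi.zero_apply, mul_zero, add_zero,
      map_zero] at h3
    have h4 : ∑ i, μ i ^ 2 = 0 := by exact_mod_cast h3
    intro i
    have h5 := (Finset.sum_eq_zero_iff_of_nonneg fun i _ => sq_nonneg (μ i)).1 h4 i
      (Finset.mem_univ i)
    have h6 : μ i = 0 := by simpa using h5
    simp only [hμ] at h6
    linarith
  refine hc0 (eq_zero_of_normConst_ne_zero m _ fun ν hν => ?_)
  refine eval_leading_eq_zero D hv hα₀ hmax hμ0 ν hν ?_
  have l1 : Filter.Tendsto (fun t : ℝ => P₁.ratio m (ray v t) ν - P₂.ratio m (ray v t) ν)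
      Filter.atTop (nhds 0) := by
    have := ((h₁.normalised ν hν).sub (h₂.normalised ν hν)).comp (tendsto_ray_chamber hv)
    rw [sub_self] at this
    exact this
  refine l1.congr fun t => ?_
  rw [hD, TrigPoly.ev_sub, sub_div]
  rfl

end uniqueness

/-! ### Integrals over products of circles -/

section torus
variable {k : ℕ}
open MeasureTheory

/-- The product of the circles `|w_i - c_i| = R_i`. -/
def torusSet (c : Fin k → ℂ) (R : Fin k → ℝ) : Set (Fin k → ℂ) := {w | ∀ i, ‖w i - c i‖ = R i}

theorem torusMap_mem_torusSet (c : Fin k → ℂ) {R : Fin k → ℝ} (hR : ∀ i, 0 ≤ R i)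
    (θ : Fin k → ℝ) : torusMap c R θ ∈ torusSet c R := by
  intro i
  simp [torusMap, abs_of_nonneg (hR i)]

theorem isCompact_torusSet (c : Fin k → ℂ) (R : Fin k → ℝ) : IsCompact (torusSet c R) := by
  have : torusSet c R = Set.univ.pi fun i => Metric.sphere (c i) (R i) := by
    ext w; simp [torusSet]
  rw [this]
  exact isCompact_univ_pi fun i => isCompact_sphere _ _

theorem continuous_torusMap (c : Fin k → ℂ) (R : Fin k → ℝ) : Continuous (torusMap c R) := by
  unfold torusMap; fun_prop

theorem continuous_comp_torusMap {f : (Fin k → ℂ) → ℂ} {c : Fin k → ℂ} {R : Fin k → ℝ}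
    (hR : ∀ i, 0 ≤ R i) (hf : ContinuousOn f (torusSet c R)) :
    Continuous (fun θ => f (torusMap c R θ)) :=
  hf.comp_continuous (continuous_torusMap c R) (torusMap_mem_torusSet c hR)

theorem ContinuousOn.torusIntegrable {f : (Fin k → ℂ) → ℂ} {c : Fin k → ℂ} {R : Fin k → ℝ}
    (hR : ∀ i, 0 ≤ R i) (hf : ContinuousOn f (torusSet c R)) : TorusIntegrable f c R :=
  (continuous_comp_torusMap hR hf).continuousOn.integrableOn_compact isCompact_Icc

theorem torusIntegral_congr {f g : (Fin k → ℂ) → ℂ} {c : Fin k → ℂ} {R : Fin k → ℝ}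
    (hR : ∀ i, 0 ≤ R i) (h : ∀ w ∈ torusSet c R, f w = g w) :
    torusIntegral f c R = torusIntegral g c R := by
  simp only [torusIntegral, h _ (torusMap_mem_torusSet c hR _)]

theorem torusIntegral_prod (f : Fin k → ℂ → ℂ) (c : Fin k → ℂ) (R : Fin k → ℝ) :
    torusIntegral (fun w => ∏ i, f i (w i)) c R = ∏ i, ∮ z in C(c i, R i), f i z := by
  simp only [circleIntegral_def_Icc, torusIntegral, smul_eq_mul, deriv_circleMap, circleMap_zero]
  rw [show Set.Icc (0 : Fin k → ℝ) (fun _ => 2 * π) = Set.univ.pi fun _ => Set.Icc 0 (2 * π) from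
    (Set.pi_univ_Icc _ _).symm, volume_pi, Measure.restrict_pi_pi]
  simp only [← Finset.prod_mul_distrib]
  exact integral_fintype_prod_eq_prod (𝕜 := ℂ)
    (fun i (θ : ℝ) => (R i * Complex.exp (θ * Complex.I) * Complex.I) * f i (circleMap (c i) (R i) θ))

theorem torusIntegral_finsetSum {ι : Type*} (s : Finset ι) (F : ι → (Fin k → ℂ) → ℂ)
    (c : Fin k → ℂ) (R : Fin k → ℝ) (hF : ∀ a ∈ s, TorusIntegrable (F a) c R) :
    torusIntegral (fun w => ∑ a ∈ s, F a w) c R = ∑ a ∈ s, torusIntegral (F a) c R := by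
  simp only [torusIntegral, Finset.smul_sum]
  exact integral_finsetSum s fun a ha => (hF a ha).function_integrable

/-- Fubini with the i-th circle innermost, so that facts about one closed contour apply. -/
theorem torusIntegral_succAbove_inner {f : (Fin (k + 1) → ℂ) → ℂ} {c : Fin (k + 1) → ℂ}
    {R : Fin (k + 1) → ℝ} (hf : TorusIntegrable f c R) (i : Fin (k + 1)) :
    torusIntegral f c R = torusIntegral (fun y => ∮ x in C(c i, R i), f (i.insertNth x y))
      (c ∘ i.succAbove) (R ∘ i.succAbove) := by
  set e : ℝ × (Fin k → ℝ) ≃ᵐ (Fin (k + 1) → ℝ) :=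
    (MeasurableEquiv.piFinSuccAbove (fun _ => ℝ) i).symm
  have hem : MeasurePreserving e :=
    (volume_preserving_piFinSuccAbove (fun _ : Fin (k + 1) => ℝ) i).symm _
  have heπ : (e ⁻¹' Set.Icc 0 fun _ => 2 * π) =
      Set.Icc 0 (2 * π) ×ˢ Set.Icc (0 : Fin k → ℝ) fun _ => 2 * π :=
    ((Fin.insertNthOrderIso (fun _ => ℝ) i).preimage_Icc _ _).trans (Set.Icc_prod_eq _ _)
  rw [torusIntegral, ← hem.map_eq, setIntegral_map_equiv, heπ, Measure.volume_eq_prod,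
    ← setIntegral_prod_swap, setIntegral_prod, torusIntegral]
  · refine setIntegral_congr_fun measurableSet_Icc fun Θ _ => ?_
    simp only [circleIntegral_def_Icc]
    rw [← integral_smul]
    refine setIntegral_congr_fun measurableSet_Icc fun θ _ => ?_
    simp +unfoldPartialApp only [e, Prod.swap,
      deriv_circleMap, i.prod_univ_succAbove _, smul_smul, torusMap, circleMap_zero]
    simp only [MeasurableEquiv.piFinSuccAbove_symm_apply, i.insertNth_apply_same,
      i.insertNth_apply_succAbove, (· ∘ ·), Fin.insertNthEquiv, Equiv.coe_fn_mk]
    rw [mul_comm]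
    congr 2
    simp only [funext_iff, i.forall_iff_succAbove, circleMap, Fin.insertNth_apply_same,
      Fin.insertNth_apply_succAbove, imp_true_iff, and_self_iff]
  · have := hf.function_integrable
    rw [← hem.integrableOn_comp_preimage e.measurableEmbedding, heπ] at this
    exact this.swap

/-- The integral of a partial derivative over a torus vanishes. -/
theorem torusIntegral_deriv_eq_zero {c : Fin k → ℂ} {R : Fin k → ℝ} (hR : ∀ i, 0 ≤ R i)
    (l : Fin k) (g g' : (Fin k → ℂ) → ℂ) (hg' : ContinuousOn g' (torusSet c R))
    (h : ∀ w ∈ torusSet c R, HasDerivAt (fun t => g (Function.update w l t)) (g' w) (w l)) :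
    torusIntegral g' c R = 0 := by
  cases k with
  | zero => exact l.elim0
  | succ k =>
    rw [torusIntegral_succAbove_inner (hg'.torusIntegrable hR) l,
      torusIntegral_congr (g := fun _ => 0) (R := R ∘ l.succAbove) (fun i => hR _)]
    · simp [torusIntegral]
    · intro y hy
      refine circleIntegral.integral_eq_zero_of_hasDerivWithinAt (hR l)
        (f := fun x => g (l.insertNth x y)) fun x hx => ?_
      have hw : (l.insertNth x y : Fin (k + 1) → ℂ) ∈ torusSet c R := by
        intro j
        rcases Fin.eq_self_or_eq_succAbove l j with rfl | ⟨j, rfl⟩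
        · simpa [dist_eq_norm] using hx
        · simpa using hy j
      have := h _ hw
      simp only [Fin.insertNth_apply_same, Fin.update_insertNth] at this
      exact this.hasDerivWithinAt

/-- Differentiation under an integral over a torus. -/
theorem hasDerivAt_torusIntegral {c : Fin k → ℂ} {R : Fin k → ℝ} (hR : ∀ i, 0 ≤ R i)
    {F F' : ℂ → (Fin k → ℂ) → ℂ} {t₀ : ℂ}
    (hF : ∀ᶠ t in nhds t₀, ContinuousOn (F t) (torusSet c R))
    (hF' : ∀ w ∈ torusSet c R, ContinuousAt (Function.uncurry F') (t₀, w))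
    (hd : ∀ᶠ t in nhds t₀, ∀ w ∈ torusSet c R, HasDerivAt (fun t => F t w) (F' t w) t) :
    HasDerivAt (fun t => torusIntegral (F t) c R) (torusIntegral (F' t₀) c R) t₀ := by
  have hc : ContinuousOn (F' t₀) (torusSet c R) := fun w hw =>
    ((hF' w hw).comp (f := fun w => (t₀, w)) (by fun_prop)).continuousWithinAt
  obtain ⟨M, hM⟩ := (isCompact_torusSet c R).exists_bound_of_continuousOn hc
  -- Compactness of the torus makes the bound on the derivative uniform for t near t₀, as dominated
  -- convergence requires.
  have hbound : ∀ᶠ t in nhds t₀, ∀ w ∈ torusSet c R, ‖F' t w‖ < M + 1 := by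
    refine (isCompact_torusSet c R).eventually_forall_of_forall_eventually fun w hw => ?_
    exact (hF' w hw).norm.eventually_lt continuousAt_const
      (lt_of_le_of_lt (hM w hw) (lt_add_one M))
  set W : (Fin k → ℝ) → ℂ := fun θ => ∏ i, (R i * Complex.exp (θ i * Complex.I) * Complex.I) with hW
  have hWc : Continuous W := by rw [hW]; fun_prop
  have hWn : ∀ θ, ‖W θ‖ = ∏ i, R i := fun θ => by
    simp [hW, norm_prod, abs_of_nonneg (hR _)]
  unfold torusIntegral
  refine (hasDerivAt_integral_of_dominated_loc_of_deriv_le (𝕜 := ℂ)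
    (s := {t | ∀ w ∈ torusSet c R, HasDerivAt (fun t => F t w) (F' t w) t ∧ ‖F' t w‖ < M + 1})
    (F' := fun t θ => W θ • F' t (torusMap c R θ))
    (bound := fun _ => (∏ i, R i) * (M + 1)) ?_ ?_ ?_ ?_ ?_ ?_ ?_).2
  · filter_upwards [hd, hbound] with t h1 h2 w hw using ⟨h1 w hw, h2 w hw⟩
  · filter_upwards [hF] with t ht
    exact (hWc.smul (continuous_comp_torusMap hR ht)).aestronglyMeasurable
  · exact (hF.self_of_nhds.torusIntegrable hR).function_integrable
  · exact (hWc.smul (continuous_comp_torusMap hR hc)).aestronglyMeasurable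
  · refine Filter.Eventually.of_forall fun θ t ht => ?_
    rw [norm_smul, hWn]
    exact mul_le_mul_of_nonneg_left (ht _ (torusMap_mem_torusSet c hR θ)).2.le
      (Finset.prod_nonneg fun i _ => hR i)
  · exact continuous_const.continuousOn.integrableOn_compact isCompact_Icc
  · refine Filter.Eventually.of_forall fun θ t ht => ?_
    exact ((ht _ (torusMap_mem_torusSet c hR θ)).1).const_smul (W θ)

end torus

/-! ### Averages over z = x + ½ log s on a torus independent of x -/

section logAverage
variable {k : ℕ}

/-- The torus of points with all `|s_i - 1| = r`. -/
def unitTorus (k : ℕ) (r : ℝ) : Set (Fin k → ℂ) := torusSet (fun _ => 1) (fun _ => r)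

/-- The point with coordinates `x_i + ½ log s_i`. -/
noncomputable def shiftLog (x : Fin (k + 1) → ℂ) (s : Fin k → ℂ) : Fin k → ℂ :=
  fun l => x l.castSucc + Complex.log (s l) / 2

/-- The integral of `h (x, x + ½ log s) ∏ s_i⁻¹` over the circles `|s_i - 1| = r`. -/
noncomputable def logAvg (r : ℝ) (h : (Fin (k + 1) → ℂ) × (Fin k → ℂ) → ℂ)
    (x : Fin (k + 1) → ℂ) : ℂ :=
  torusIntegral (fun s => (∏ l, s l)⁻¹ * h (x, shiftLog x s)) (fun _ => 1) (fun _ => r)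

theorem mem_slitPlane_of_norm_sub_one {r : ℝ} (hr : r < 1) {s : ℂ} (hs : ‖s - 1‖ ≤ r) :
    s ∈ Complex.slitPlane := by
  have := Complex.mem_slitPlane_of_norm_lt_one (lt_of_le_of_lt hs hr)
  simpa using this

theorem unitTorus_slitPlane {r : ℝ} (hr : r < 1) {s : Fin k → ℂ} (hs : s ∈ unitTorus k r)
    (l : Fin k) : s l ∈ Complex.slitPlane :=
  mem_slitPlane_of_norm_sub_one hr (hs l).le

theorem unitTorus_ne_zero {r : ℝ} (hr : r < 1) {s : Fin k → ℂ} (hs : s ∈ unitTorus k r)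
    (l : Fin k) : s l ≠ 0 := Complex.slitPlane_ne_zero (unitTorus_slitPlane hr hs l)

theorem continuousAt_shiftLog {r : ℝ} (hr : r < 1) (x : Fin (k + 1) → ℂ) {s : Fin k → ℂ}
    (hs : s ∈ unitTorus k r) :
    ContinuousAt (fun q : (Fin (k + 1) → ℂ) × (Fin k → ℂ) => shiftLog q.1 q.2) (x, s) := by
  refine continuousAt_pi.2 fun l => ?_
  have h1 : ContinuousAt (fun q : (Fin (k + 1) → ℂ) × (Fin k → ℂ) => Complex.log (q.2 l)) (x, s) :=
    ContinuousAt.clog (by fun_prop) (unitTorus_slitPlane hr hs l)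
  have h2 : ContinuousAt (fun q : (Fin (k + 1) → ℂ) × (Fin k → ℂ) => q.1 l.castSucc) (x, s) := by
    fun_prop
  exact h2.add (h1.div_const 2)

theorem continuousOn_prod_inv {r : ℝ} (hr : r < 1) :
    ContinuousOn (fun s : Fin k → ℂ => (∏ l, s l)⁻¹) (unitTorus k r) := by
  refine ContinuousOn.inv₀ (by fun_prop) fun s hs => ?_
  exact Finset.prod_ne_zero_iff.2 fun l _ => unitTorus_ne_zero hr hs l

theorem continuousOn_logAvg_integrand {r : ℝ} (hr : r < 1)
    {h : (Fin (k + 1) → ℂ) × (Fin k → ℂ) → ℂ} {x : Fin (k + 1) → ℂ}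
    (hc : ∀ s ∈ unitTorus k r, ContinuousAt h (x, shiftLog x s)) :
    ContinuousOn (fun s => (∏ l, s l)⁻¹ * h (x, shiftLog x s)) (unitTorus k r) := by
  refine (continuousOn_prod_inv hr).mul fun s hs => ?_
  have h1 : ContinuousAt (fun s' => shiftLog x s') s :=
    (continuousAt_shiftLog hr x hs).comp (f := fun s' => (x, s')) (by fun_prop)
  have h2 : ContinuousAt (fun s' => (x, shiftLog x s')) s := continuousAt_const.prodMk h1
  exact (ContinuousAt.comp (f := fun s' => (x, shiftLog x s')) (hc s hs) h2).continuousWithinAt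

theorem logAvg_congr {r : ℝ} (hr : 0 ≤ r) {h h' : (Fin (k + 1) → ℂ) × (Fin k → ℂ) → ℂ}
    {x : Fin (k + 1) → ℂ} (H : ∀ s ∈ unitTorus k r, h (x, shiftLog x s) = h' (x, shiftLog x s)) :
    logAvg r h x = logAvg r h' x :=
  torusIntegral_congr (fun _ => hr) fun s hs => by rw [H s hs]

theorem logAvg_sum {ι : Type*} (S : Finset ι) {r : ℝ} (hr₀ : 0 ≤ r) (hr : r < 1)
    {h : ι → (Fin (k + 1) → ℂ) × (Fin k → ℂ) → ℂ} {x : Fin (k + 1) → ℂ}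
    (hc : ∀ a ∈ S, ∀ s ∈ unitTorus k r, ContinuousAt (h a) (x, shiftLog x s)) :
    logAvg r (fun p => ∑ a ∈ S, h a p) x = ∑ a ∈ S, logAvg r (h a) x := by
  simp only [logAvg, Finset.mul_sum]
  exact torusIntegral_finsetSum S _ _ _ fun a ha =>
    (continuousOn_logAvg_integrand hr (hc a ha)).torusIntegrable fun _ => hr₀

theorem logAvg_add {r : ℝ} (hr₀ : 0 ≤ r) (hr : r < 1)
    {h h' : (Fin (k + 1) → ℂ) × (Fin k → ℂ) → ℂ} {x : Fin (k + 1) → ℂ}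
    (hc : ∀ s ∈ unitTorus k r, ContinuousAt h (x, shiftLog x s))
    (hc' : ∀ s ∈ unitTorus k r, ContinuousAt h' (x, shiftLog x s)) :
    logAvg r (fun p => h p + h' p) x = logAvg r h x + logAvg r h' x := by
  simp only [logAvg, mul_add]
  exact torusIntegral_add ((continuousOn_logAvg_integrand hr hc).torusIntegrable fun _ => hr₀)
    ((continuousOn_logAvg_integrand hr hc').torusIntegrable fun _ => hr₀)

theorem logAvg_const_mul (r : ℝ) (a : ℂ) (h : (Fin (k + 1) → ℂ) × (Fin k → ℂ) → ℂ)
    (x : Fin (k + 1) → ℂ) : logAvg r (fun p => a * h p) x = a * logAvg r h x := by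
  simp only [logAvg, ← torusIntegral_const_mul]
  congr 1; funext s; ring

/-- The averages of derivatives in `z` vanish. -/
theorem logAvg_deriv_eq_zero {r : ℝ} (hr₀ : 0 ≤ r) (hr : r < 1) (l : Fin k)
    {g g' : (Fin (k + 1) → ℂ) × (Fin k → ℂ) → ℂ} {x : Fin (k + 1) → ℂ}
    (hc : ∀ s ∈ unitTorus k r, ContinuousAt g' (x, shiftLog x s))
    (hd : ∀ s ∈ unitTorus k r, HasDerivAt (fun t => g (x, Function.update (shiftLog x s) l t))
      (g' (x, shiftLog x s)) (shiftLog x s l)) :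
    logAvg r g' x = 0 := by
  -- Since ∂z_l/∂s_l = 1/(2 s_l), the factor 2 and the product of the other s_j⁻¹ give a primitive
  -- of the weighted integrand in s_l.
  refine torusIntegral_deriv_eq_zero (fun _ => hr₀) l
    (fun s => (∏ j ∈ Finset.univ.erase l, s j)⁻¹ * (2 * g (x, shiftLog x s))) _
    (continuousOn_logAvg_integrand hr hc) fun s hs => ?_
  have h1 : ∀ t, ∏ j ∈ Finset.univ.erase l, Function.update s l t j =
      ∏ j ∈ Finset.univ.erase l, s j := fun t =>
    Finset.prod_congr rfl fun j hj => Function.update_of_ne (Finset.ne_of_mem_erase hj) _ _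
  have h2 : ∀ t, shiftLog x (Function.update s l t) =
      Function.update (shiftLog x s) l (x l.castSucc + Complex.log t / 2) := by
    intro t
    funext j
    by_cases hj : j = l
    · subst hj; simp [shiftLog]
    · simp [shiftLog, hj]
  simp only [h1, h2]
  have h3 : HasDerivAt (fun t => x l.castSucc + Complex.log t / 2) ((s l)⁻¹ / 2) (s l) :=
    ((Complex.hasDerivAt_log (unitTorus_slitPlane hr hs l)).div_const 2).const_add _
  have h4 := HasDerivAt.comp (s l) (h₂ := fun t => g (x, Function.update (shiftLog x s) l t))
    (hd s hs) h3
  have h5 := (h4.const_mul 2).const_mul (∏ j ∈ Finset.univ.erase l, s j)⁻¹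
  refine h5.congr_deriv ?_
  rw [← Finset.mul_prod_erase _ _ (Finset.mem_univ l), mul_inv]
  ring

theorem eventually_shiftLog_mem {r : ℝ} (hr : r < 1) {O : Set ((Fin (k + 1) → ℂ) × (Fin k → ℂ))}
    (hO : IsOpen O) {x : Fin (k + 1) → ℂ} (hx : ∀ s ∈ unitTorus k r, (x, shiftLog x s) ∈ O) :
    ∀ᶠ y in nhds x, ∀ s ∈ unitTorus k r, (y, shiftLog y s) ∈ O := by
  refine (isCompact_torusSet _ _).eventually_forall_of_forall_eventually fun s hs => ?_
  have h1 : ContinuousAt (fun q : (Fin (k + 1) → ℂ) × (Fin k → ℂ) => (q.1, shiftLog q.1 q.2))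
      (x, s) := continuousAt_fst.prodMk (continuousAt_shiftLog hr x hs)
  exact h1.eventually (hO.mem_nhds (hx s hs))

theorem eventually_update {P : (Fin k → ℂ) → Prop} {x : Fin k → ℂ} (i : Fin k)
    (h : ∀ᶠ y in nhds x, P y) : ∀ᶠ t in nhds (x i), P (Function.update x i t) := by
  have h1 := (continuous_update_right x i).tendsto (x i)
  rw [Function.update_eq_self] at h1
  exact h1.eventually h

/-- Derivatives in `x` may be taken with `z` fixed. -/
theorem hasDerivAt_logAvg {r : ℝ} (hr₀ : 0 ≤ r) (hr : r < 1) (i : Fin (k + 1))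
    {O : Set ((Fin (k + 1) → ℂ) × (Fin k → ℂ))} (hO : IsOpen O)
    {h hx : (Fin (k + 1) → ℂ) × (Fin k → ℂ) → ℂ} (hh : ContDiffOn ℂ 1 h O)
    (hd : ∀ p ∈ O, HasDerivAt (fun t => h (Function.update p.1 i t, p.2)) (hx p) (p.1 i))
    {x : Fin (k + 1) → ℂ} (hxO : ∀ s ∈ unitTorus k r, (x, shiftLog x s) ∈ O) :
    HasDerivAt (fun t => logAvg r h (Function.update x i t)) (logAvg r hx x) (x i) := by
  set e : Fin (k + 1) → ℂ := Pi.single i 1 with he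
  have hfd : ∀ p ∈ O, HasFDerivAt h (fderiv ℂ h p) p := fun p hp =>
    ((hh.differentiableOn (by norm_num)).differentiableAt (hO.mem_nhds hp)).hasFDerivAt
  have hfc : ∀ p ∈ O, ContinuousAt (fderiv ℂ h) p := fun p hp =>
    (hh.continuousOn_fderiv_of_isOpen hO le_rfl).continuousAt (hO.mem_nhds hp)
  have hhc : ∀ p ∈ O, ContinuousAt h p := fun p hp =>
    hh.continuousOn.continuousAt (hO.mem_nhds hp)
  have hev := eventually_update i (eventually_shiftLog_mem hr hO hxO)
  -- On the torus z moves together with x, so the derivative of the average is first taken along the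
  -- combined direction in (x, z).
  have main : HasDerivAt (fun t => logAvg r h (Function.update x i t))
      (logAvg r (fun p => fderiv ℂ h p (e, fun l => e l.castSucc)) x) (x i) := by
    have key := hasDerivAt_torusIntegral (c := fun _ : Fin k => (1 : ℂ)) (R := fun _ => r)
      (fun _ => hr₀) (t₀ := x i)
      (F := fun t s => (∏ l, s l)⁻¹ * h (Function.update x i t, shiftLog (Function.update x i t) s))
      (F' := fun t s => (∏ l, s l)⁻¹ * fderiv ℂ h (Function.update x i t,
        shiftLog (Function.update x i t) s) (e, fun l => e l.castSucc)) ?_ ?_ ?_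
    · simp only [Function.update_eq_self] at key
      exact key
    · filter_upwards [hev] with t ht
      exact continuousOn_logAvg_integrand hr fun s hs => hhc _ (ht s hs)
    · intro s hs
      have h1 : ContinuousAt (fun q : ℂ × (Fin k → ℂ) => (Function.update x i q.1, q.2))
          (x i, s) :=
        (((continuous_update_right x i).comp continuous_fst).prodMk continuous_snd).continuousAt
      have h2 : ContinuousAt (fun q : (Fin (k + 1) → ℂ) × (Fin k → ℂ) => (q.1, shiftLog q.1 q.2))
        (Function.update x i (x i), s) :=
        continuousAt_fst.prodMk (continuousAt_shiftLog hr _ hs)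
      have h3 := ContinuousAt.comp (f := fun q : ℂ × (Fin k → ℂ) => (Function.update x i q.1, q.2))
        (x := (x i, s)) h2 h1
      have h4 : ContinuousAt (fderiv ℂ h) (Function.update x i (x i),
          shiftLog (Function.update x i (x i)) s) := by
        rw [Function.update_eq_self]; exact hfc _ (hxO s hs)
      have h5 := ContinuousAt.comp (x := (x i, s))
        (f := fun q : ℂ × (Fin k → ℂ) => (Function.update x i q.1,
          shiftLog (Function.update x i q.1) q.2)) h4 h3
      have h6 : ContinuousAt (fun q : ℂ × (Fin k → ℂ) => (∏ l, q.2 l)⁻¹) (x i, s) :=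
        ContinuousAt.inv₀ (by fun_prop)
          (Finset.prod_ne_zero_iff.2 fun l _ => unitTorus_ne_zero hr hs l)
      exact h6.mul (h5.clm_apply continuousAt_const)
    · filter_upwards [hev] with t ht s hs
      have h1 : HasDerivAt (fun t => Function.update x i t) e t := hasDerivAt_update x i t
      have h2 : HasDerivAt (fun t => shiftLog (Function.update x i t) s)
          (fun l => e l.castSucc) t := by
        refine hasDerivAt_pi.2 fun l => ?_
        exact ((hasDerivAt_pi.1 h1) l.castSucc).add_const _
      exact ((hfd _ (ht s hs)).comp_hasDerivAt t (h1.prodMk h2)).const_mul _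
  refine main.congr_deriv ?_
  have hx_eq : ∀ p ∈ O, fderiv ℂ h p (e, 0) = hx p := by
    intro p hp
    have h1 : HasDerivAt (fun t => Function.update p.1 i t) e (p.1 i) := hasDerivAt_update _ i _
    have h0 : HasFDerivAt h (fderiv ℂ h p) (Function.update p.1 i (p.1 i), p.2) := by
      rw [Function.update_eq_self]; exact hfd p hp
    have h2 := HasFDerivAt.comp_hasDerivAt (p.1 i) h0 (h1.prodMk (hasDerivAt_const (p.1 i) p.2))
    exact h2.unique (hd p hp)
  have hcx : ∀ (d : (Fin (k + 1) → ℂ) × (Fin k → ℂ)), ∀ s ∈ unitTorus k r,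
      ContinuousAt (fun p => fderiv ℂ h p d) (x, shiftLog x s) := fun d s hs =>
    (hfc _ (hxO s hs)).clm_apply continuousAt_const
  have hsplit : logAvg r (fun p => fderiv ℂ h p (e, fun l => e l.castSucc)) x =
      logAvg r (fun p => fderiv ℂ h p (e, 0)) x +
      logAvg r (fun p => fderiv ℂ h p (0, fun l => e l.castSucc)) x := by
    rw [← logAvg_add hr₀ hr (hcx _) (hcx _)]
    congr 1; funext p
    rw [← map_add]; simp
  -- The contribution of the motion of z is a derivative in z and averages to zero. For the last
  -- coordinate no z moves.
  have hzero : logAvg r (fun p => fderiv ℂ h p (0, fun l => e l.castSucc)) x = 0 := by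
    rcases Fin.eq_castSucc_or_eq_last i with ⟨l, rfl⟩ | rfl
    · have he' : (fun j : Fin k => e j.castSucc) = Pi.single l 1 := by
        funext j
        simp [he, Pi.single_apply]
      rw [he']
      refine logAvg_deriv_eq_zero hr₀ hr l (g := h) (hcx _) fun s hs => ?_
      have h1 : HasDerivAt (fun t => Function.update (shiftLog x s) l t) (Pi.single l 1)
        (shiftLog x s l) := hasDerivAt_update _ l _
      have h0 : HasFDerivAt h (fderiv ℂ h (x, shiftLog x s))
          (x, Function.update (shiftLog x s) l (shiftLog x s l)) := by
        rw [Function.update_eq_self]; exact hfd _ (hxO s hs)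
      exact HasFDerivAt.comp_hasDerivAt _ h0 ((hasDerivAt_const _ x).prodMk h1)
    · have he' : (fun j : Fin k => e j.castSucc) = 0 := by
        funext j
        simp [he, (Fin.castSucc_lt_last j).ne]
      rw [he']
      simp only [← Prod.zero_eq_mk, map_zero]
      simp [logAvg, torusIntegral]
  rw [hsplit, hzero, add_zero]
  exact logAvg_congr hr₀ fun s hs => hx_eq _ (hxO s hs)

end logAverage

/-! ### The kernel average of an eigenfunction is an eigenfunction -/

section eigenAverage
variable {n k : ℕ}

/-- The domain of the kernel function as a set of pairs. -/
def kernSet (n k : ℕ) : Set ((Fin n → ℂ) × (Fin k → ℂ)) := {p | KernDom p.1 p.2}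

theorem continuous_prodDiff_expTwo : Continuous (fun x : Fin n → ℂ => prodDiff (expTwo x)) := by
  unfold prodDiff expTwo; fun_prop

theorem contDiff_prodDiff_expTwo {N : WithTop ℕ∞} :
    ContDiff ℂ N (fun x : Fin n → ℂ => prodDiff (expTwo x)) := by
  unfold prodDiff expTwo
  refine contDiff_prod fun i _ => contDiff_prod fun j _ => ?_
  exact ((contDiff_const.mul (contDiff_apply ℂ ℂ i)).cexp).sub
    ((contDiff_const.mul (contDiff_apply ℂ ℂ j)).cexp)

theorem contDiff_prodDiffStar_expTwo {N : WithTop ℕ∞} :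
    ContDiff ℂ N (fun p : (Fin n → ℂ) × (Fin k → ℂ) =>
      prodDiffStar (expTwo p.2) (expTwo p.1)) := by
  simp only [prodDiffStar_eq, expTwo]
  refine contDiff_const.mul (contDiff_prod fun i _ => contDiff_prod fun j _ => ?_)
  exact ((contDiff_const.mul ((contDiff_apply ℂ ℂ i).comp contDiff_snd)).cexp).sub
    ((contDiff_const.mul ((contDiff_apply ℂ ℂ j).comp contDiff_fst)).cexp)

theorem isOpen_kernSet : IsOpen (kernSet n k) := by
  have h1 : Continuous (fun p : (Fin n → ℂ) × (Fin k → ℂ) => prodDiff (expTwo p.1)) :=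
    continuous_prodDiff_expTwo.comp continuous_fst
  have h2 : Continuous (fun p : (Fin n → ℂ) × (Fin k → ℂ) => prodDiff (expTwo p.2)) :=
    continuous_prodDiff_expTwo.comp continuous_snd
  have h3 := (contDiff_prodDiffStar_expTwo (n := n) (k := k) (N := 0)).continuous
  exact (isOpen_ne_fun h1 continuous_const).inter
    ((isOpen_ne_fun h2 continuous_const).inter (isOpen_ne_fun h3 continuous_const))

theorem contDiffOn_kern {N : WithTop ℕ∞} (m : ℕ) (a : ℂ) :
    ContDiffOn ℂ N (fun p : (Fin n → ℂ) × (Fin k → ℂ) => kern m a p.1 p.2) (kernSet n k) := by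
  have h1 := (contDiff_prodDiff_expTwo (n := n) (N := N)).comp
    (contDiff_fst (𝕜 := ℂ) (E := Fin n → ℂ) (F := Fin k → ℂ))
  have h2 := (contDiff_prodDiff_expTwo (n := k) (N := N)).comp
    (contDiff_snd (𝕜 := ℂ) (E := Fin n → ℂ) (F := Fin k → ℂ))
  have h3 := (contDiff_prodDiffStar_expTwo (n := n) (k := k) (N := N)).pow (m + 1)
  have sx : ContDiff ℂ N (fun p : (Fin n → ℂ) × (Fin k → ℂ) => ∑ i, p.1 i) :=
    ContDiff.sum fun i _ => (contDiff_apply ℂ ℂ i).comp contDiff_fst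
  have sz : ContDiff ℂ N (fun p : (Fin n → ℂ) × (Fin k → ℂ) => ∑ i, p.2 i) :=
    ContDiff.sum fun i _ => (contDiff_apply ℂ ℂ i).comp contDiff_snd
  have h4 := h3.contDiffOn.inv (s := kernSet n k) fun p hp => pow_ne_zero _ hp.2.2
  exact ((((h1.pow (m + 1)).mul (h2.pow (m + 1))).contDiffOn.mul h4).mul
    (contDiff_const.mul sz).cexp.contDiffOn).mul
    (contDiff_const.mul (sx.sub sz)).cexp.contDiffOn

theorem contDiffOn_cothDiff {E : Type*} [NormedAddCommGroup E] [NormedSpace ℂ E]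
    {N : WithTop ℕ∞} {f g : E → ℂ} {s : Set E}
    (hf : ContDiff ℂ N f) (hg : ContDiff ℂ N g)
    (h : ∀ p ∈ s, Complex.exp (2 * f p) ≠ Complex.exp (2 * g p)) :
    ContDiffOn ℂ N (fun p => cothDiff (f p) (g p)) s := by
  have h1 := (contDiff_const (c := (2 : ℂ))).mul hf |>.cexp
  have h2 := (contDiff_const (c := (2 : ℂ))).mul hg |>.cexp
  exact (h1.add h2).contDiffOn.div (h1.sub h2).contDiffOn fun p hp => sub_ne_zero.2 (h p hp)

theorem continuousOn_cschSqDiff {E : Type*} [TopologicalSpace E] {f g : E → ℂ} {s : Set E}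
    (hf : Continuous f) (hg : Continuous g)
    (h : ∀ p ∈ s, Complex.exp (2 * f p) ≠ Complex.exp (2 * g p)) :
    ContinuousOn (fun p => cschSqDiff (f p) (g p)) s := by
  unfold cschSqDiff
  refine ContinuousOn.div (by fun_prop) (by fun_prop) fun p hp => ?_
  exact pow_ne_zero _ (sub_ne_zero.2 (h p hp))

theorem contDiffOn_kernX {N : WithTop ℕ∞} (m : ℕ) (a : ℂ) (i : Fin n) :
    ContDiffOn ℂ N (fun p : (Fin n → ℂ) × (Fin k → ℂ) => kernX m a p.1 p.2 i) (kernSet n k) := by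
  unfold kernX
  refine (contDiffOn_const.mul ((ContDiffOn.sum fun j _ => ?_).sub
    (ContDiffOn.sum fun l _ => ?_))).add contDiffOn_const
  · by_cases h : i = j
    · subst h; simp only [cothDiff_self]; exact contDiffOn_const
    · exact contDiffOn_cothDiff ((contDiff_apply ℂ ℂ i).comp contDiff_fst)
        ((contDiff_apply ℂ ℂ j).comp contDiff_fst) fun p hp =>
          prodDiff_ne_zero_iff.1 hp.1 i j h
  · exact contDiffOn_cothDiff ((contDiff_apply ℂ ℂ i).comp contDiff_fst)
        ((contDiff_apply ℂ ℂ l).comp contDiff_snd) fun p hp =>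
          (prodDiffStar_ne_zero_iff.1 hp.2.2 l i).symm

theorem continuousOn_kernXX (m : ℕ) (i : Fin n) :
    ContinuousOn (fun p : (Fin n → ℂ) × (Fin k → ℂ) => kernXX m p.1 p.2 i) (kernSet n k) := by
  unfold kernXX
  refine continuousOn_const.mul ((continuousOn_finsetSum _ fun l _ => ?_).sub
    (continuousOn_finsetSum _ fun j _ => ?_))
  · exact continuousOn_cschSqDiff (by fun_prop) (by fun_prop) fun p hp =>
          (prodDiffStar_ne_zero_iff.1 hp.2.2 l i).symm
  · by_cases h : i = j
    · subst h; simp only [cschSqDiff_self]; exact continuousOn_const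
    · exact continuousOn_cschSqDiff (by fun_prop) (by fun_prop) fun p hp =>
          prodDiff_ne_zero_iff.1 hp.1 i j h

theorem continuousOn_kernZ (m : ℕ) (a : ℂ) (l : Fin k) :
    ContinuousOn (fun p : (Fin n → ℂ) × (Fin k → ℂ) => kernZ m a p.1 p.2 l) (kernSet n k) := by
  unfold kernZ
  refine (continuousOn_const.mul ((continuousOn_finsetSum _ fun j _ => ?_).sub
    (continuousOn_finsetSum _ fun i _ => ?_))).sub continuousOn_const
  · by_cases h : l = j
    · subst h; simp only [cothDiff_self]; exact continuousOn_const
    · exact (contDiffOn_cothDiff (N := 0) ((contDiff_apply ℂ ℂ l).comp contDiff_snd)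
        ((contDiff_apply ℂ ℂ j).comp contDiff_snd) fun p hp =>
          prodDiff_ne_zero_iff.1 hp.2.1 l j h).continuousOn
  · exact (contDiffOn_cothDiff (N := 0) ((contDiff_apply ℂ ℂ l).comp contDiff_snd)
        ((contDiff_apply ℂ ℂ i).comp contDiff_fst) fun p hp =>
          prodDiffStar_ne_zero_iff.1 hp.2.2 l i).continuousOn

theorem continuousOn_kernZZ (m : ℕ) (l : Fin k) :
    ContinuousOn (fun p : (Fin n → ℂ) × (Fin k → ℂ) => kernZZ m p.1 p.2 l) (kernSet n k) := by
  unfold kernZZ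
  refine continuousOn_const.mul ((continuousOn_finsetSum _ fun i _ => ?_).sub
    (continuousOn_finsetSum _ fun j _ => ?_))
  · exact continuousOn_cschSqDiff (by fun_prop) (by fun_prop) fun p hp =>
          prodDiffStar_ne_zero_iff.1 hp.2.2 l i
  · by_cases h : l = j
    · subst h; simp only [cschSqDiff_self]; exact continuousOn_const
    · exact continuousOn_cschSqDiff (by fun_prop) (by fun_prop) fun p hp =>
          prodDiff_ne_zero_iff.1 hp.2.1 l j h

/-- Partial derivatives along a coordinate. -/
noncomputable def partialDeriv (l : Fin k) (f : (Fin k → ℂ) → ℂ) (z : Fin k → ℂ) : ℂ :=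
  deriv (fun t => f (Function.update z l t)) (z l)

theorem iteratedDeriv_two_eq_partialDeriv (l : Fin k) (f : (Fin k → ℂ) → ℂ) (z : Fin k → ℂ) :
    iteratedDeriv 2 (fun t => f (Function.update z l t)) (z l) =
      partialDeriv l (partialDeriv l f) z := by
  rw [iteratedDeriv_succ, iteratedDeriv_one]
  simp [partialDeriv]

theorem hasDerivAt_partialDeriv {U : Set (Fin k → ℂ)} (hU : IsOpen U) {f : (Fin k → ℂ) → ℂ}
    (hf : ContDiffOn ℂ (↑(⊤ : ℕ∞)) f U) (l : Fin k) {z : Fin k → ℂ} (hz : z ∈ U) :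
    HasDerivAt (fun t => f (Function.update z l t)) (fderiv ℂ f z (Pi.single l 1)) (z l) := by
  have h1 : HasFDerivAt f (fderiv ℂ f z) (Function.update z l (z l)) := by
    rw [Function.update_eq_self]
    exact ((hf.differentiableOn (by simp)).differentiableAt (hU.mem_nhds hz)).hasFDerivAt
  exact HasFDerivAt.comp_hasDerivAt _ h1 (hasDerivAt_update z l _)

theorem ContDiffOn.partialDeriv {U : Set (Fin k → ℂ)} (hU : IsOpen U) {f : (Fin k → ℂ) → ℂ}
    (hf : ContDiffOn ℂ (↑(⊤ : ℕ∞)) f U) (l : Fin k) :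
    ContDiffOn ℂ (↑(⊤ : ℕ∞)) (partialDeriv l f) U := by
  have h1 : ContDiffOn ℂ (↑(⊤ : ℕ∞)) (fderiv ℂ f) U := hf.fderiv_of_isOpen hU (by simp)
  have h2 : ContDiffOn ℂ (↑(⊤ : ℕ∞)) (fun z => fderiv ℂ f z (Pi.single l 1)) U :=
    h1.clm_apply contDiffOn_const
  exact h2.congr fun z hz => (hasDerivAt_partialDeriv hU hf l hz).deriv

theorem hasDerivAt_update_partialDeriv {U : Set (Fin k → ℂ)} (hU : IsOpen U)
    {f : (Fin k → ℂ) → ℂ} (hf : ContDiffOn ℂ (↑(⊤ : ℕ∞)) f U) (l : Fin k) {z : Fin k → ℂ}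
    (hz : z ∈ U) :
    HasDerivAt (fun t => f (Function.update z l t)) (_root_.partialDeriv l f z) (z l) := by
  have := hasDerivAt_partialDeriv hU hf l hz
  rw [_root_.partialDeriv, this.deriv]; exact this

/-- The kernel average transforms eigenfunctions into eigenfunctions. -/
theorem logAvg_eigen (m : ℕ) (a E : ℂ) {r : ℝ} (hr₀ : 0 ≤ r) (hr : r < 1)
    {Φ : (Fin k → ℂ) → ℂ}
    (hΦ : ContDiffOn ℂ (↑(⊤ : ℕ∞)) Φ {z | prodDiff (expTwo z) ≠ 0})
    (heig : ∀ z, prodDiff (expTwo z) ≠ 0 →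
      ∑ l, iteratedDeriv 2 (fun t => Φ (Function.update z l t)) (z l) =
        (m * (m + 1) * (∑ i, ∑ j, cschSqDiff (z i) (z j)) + E) * Φ z)
    {x : Fin (k + 1) → ℂ} (hx : ∀ s ∈ unitTorus k r, (x, shiftLog x s) ∈ kernSet (k + 1) k) :
    ∑ i, iteratedDeriv 2
        (fun t => logAvg r (fun p => kern m a p.1 p.2 * Φ p.2) (Function.update x i t)) (x i) =
      (4 * a ^ 2 + m * (m + 1) * (∑ i, ∑ j, cschSqDiff (x i) (x j)) + E) *
        logAvg r (fun p => kern m a p.1 p.2 * Φ p.2) x := by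
  set U : Set (Fin k → ℂ) := {z | prodDiff (expTwo z) ≠ 0} with hUdef
  have hU : IsOpen U := isOpen_ne_fun continuous_prodDiff_expTwo continuous_const
  set O := kernSet (k + 1) k with hOdef
  have hO : IsOpen O := isOpen_kernSet
  have hOU : ∀ p ∈ O, p.2 ∈ U := fun p hp => hp.2.1
  set h₀ : (Fin (k + 1) → ℂ) × (Fin k → ℂ) → ℂ := fun p => kern m a p.1 p.2 * Φ p.2 with hh₀
  set h₁ : Fin (k + 1) → (Fin (k + 1) → ℂ) × (Fin k → ℂ) → ℂ :=
    fun i p => kernX m a p.1 p.2 i * h₀ p with hh₁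
  set h₂ : Fin (k + 1) → (Fin (k + 1) → ℂ) × (Fin k → ℂ) → ℂ :=
    fun i p => (kernX m a p.1 p.2 i ^ 2 + kernXX m p.1 p.2 i) * h₀ p with hh₂
  have hΦ2 : ∀ {f : (Fin k → ℂ) → ℂ}, ContDiffOn ℂ (↑(⊤ : ℕ∞)) f U →
      ContDiffOn ℂ (↑(⊤ : ℕ∞)) (fun p : (Fin (k + 1) → ℂ) × (Fin k → ℂ) => f p.2) O := fun hf =>
    hf.comp contDiff_snd.contDiffOn hOU
  have c₀ : ContDiffOn ℂ (↑(⊤ : ℕ∞)) h₀ O := (contDiffOn_kern m a).mul (hΦ2 hΦ)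
  have c₁ : ∀ i, ContDiffOn ℂ (↑(⊤ : ℕ∞)) (h₁ i) O := fun i => (contDiffOn_kernX m a i).mul c₀
  have c₂ : ∀ i, ContinuousOn (h₂ i) O := fun i =>
    (((contDiffOn_kernX (N := 0) m a i).continuousOn.pow 2).add (continuousOn_kernXX m i)).mul
      c₀.continuousOn
  have d₀ : ∀ i, ∀ p ∈ O, HasDerivAt (fun t => h₀ (Function.update p.1 i t, p.2)) (h₁ i p)
      (p.1 i) := by
    intro i p hp
    have h := (hasLogDerivAt_kern_left m a hp i).mul (HasLogDerivAt.const (Φ p.2))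
    refine HasDerivAt.congr_deriv h ?_
    simp only [Function.update_eq_self, hh₁, hh₀]; ring
  have d₁ : ∀ i, ∀ p ∈ O, HasDerivAt (fun t => h₁ i (Function.update p.1 i t, p.2)) (h₂ i p)
      (p.1 i) := by
    intro i p hp
    have h := (hasDerivAt_kernX m a hp i).mul (d₀ i p hp)
    refine h.congr_deriv ?_
    simp only [Function.update_eq_self, hh₂, hh₁]; ring
  have second : ∀ i, iteratedDeriv 2 (fun t => logAvg r h₀ (Function.update x i t)) (x i) =
      logAvg r (h₂ i) x := by
    intro i
    refine iteratedDeriv_two_eq (f₁ := fun t => logAvg r (h₁ i) (Function.update x i t)) ?_ ?_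
    · filter_upwards [eventually_update i (eventually_shiftLog_mem hr hO hx)] with t ht
      have := hasDerivAt_logAvg hr₀ hr i hO (c₀.of_le (by simp)) (d₀ i) ht
      simpa only [Function.update_idem, Function.update_self] using this
    · exact hasDerivAt_logAvg hr₀ hr i hO ((c₁ i).of_le (by simp)) (d₁ i) hx
  -- Green's identity: g_l is (∂_l K) Φ - K ∂_l Φ and its z_l-derivative g'_l is (∂_l² K) Φ - K ∂_l²
  -- Φ.
  set g : Fin k → (Fin (k + 1) → ℂ) × (Fin k → ℂ) → ℂ := fun l p =>
    kern m a p.1 p.2 * (kernZ m a p.1 p.2 l * Φ p.2 - partialDeriv l Φ p.2) with hg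
  set g' : Fin k → (Fin (k + 1) → ℂ) × (Fin k → ℂ) → ℂ := fun l p =>
    kern m a p.1 p.2 * ((kernZ m a p.1 p.2 l ^ 2 + kernZZ m p.1 p.2 l) * Φ p.2 -
      partialDeriv l (partialDeriv l Φ) p.2) with hg'
  have cΦ1 := fun l => ContDiffOn.partialDeriv hU hΦ l
  have cΦ2 := fun l => ContDiffOn.partialDeriv hU (cΦ1 l) l
  have cg' : ∀ l, ContinuousOn (g' l) O := fun l =>
    (contDiffOn_kern (N := 0) m a).continuousOn.mul
      (((((continuousOn_kernZ m a l).pow 2).add (continuousOn_kernZZ m l)).mul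
        (hΦ2 hΦ).continuousOn).sub (hΦ2 (cΦ2 l)).continuousOn)
  have zero : ∀ l, logAvg r (g' l) x = 0 := by
    intro l
    refine logAvg_deriv_eq_zero hr₀ hr l (g := g l)
      (fun s hs => (cg' l).continuousAt (hO.mem_nhds (hx s hs))) fun s hs => ?_
    have hp := hx s hs
    have e1 := hasLogDerivAt_kern_right m a hp l
    have e2 := hasDerivAt_kernZ m a hp l
    have e3 := hasDerivAt_update_partialDeriv hU hΦ l (hOU _ hp)
    have e4 := hasDerivAt_update_partialDeriv hU (cΦ1 l) l (hOU _ hp)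
    have e5 := HasDerivAt.mul e1 ((e2.mul e3).sub e4)
    refine e5.congr_deriv ?_
    simp only [hg', Pi.sub_apply, Pi.mul_apply, Function.update_eq_self]; ring
  -- The kernel identity replaces the x-Laplacian of K by the z-Laplacian. The potential in z then
  -- cancels against the one in the equation for Φ, and the rest is a sum of the g'_l.
  have point : ∀ s ∈ unitTorus k r, (fun p => ∑ i, h₂ i p) (x, shiftLog x s) =
      (fun p => ∑ l, g' l p + (4 * a ^ 2 + m * (m + 1) *
        (∑ i, ∑ j, cschSqDiff (x i) (x j)) + E) * h₀ p) (x, shiftLog x s) := by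
    intro s hs
    have hp := hx s hs
    have e1 := kernel_identity m a hp
    have e2 := heig _ (hOU _ hp)
    simp only [iteratedDeriv_two_eq_partialDeriv] at e2
    simp only [hh₂, hg', hh₀, ← Finset.sum_mul, ← Finset.mul_sum, Finset.sum_sub_distrib, e2]
    rw [e1]
    ring
  simp only [second]
  rw [← logAvg_sum _ hr₀ hr fun i _ s hs => (c₂ i).continuousAt (hO.mem_nhds (hx s hs)),
    logAvg_congr (h := fun p => ∑ i, h₂ i p) (h' := fun p => ∑ l, g' l p +
      (4 * a ^ 2 + m * (m + 1) * (∑ i, ∑ j, cschSqDiff (x i) (x j)) + E) * h₀ p) hr₀ point,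
    logAvg_add hr₀ hr, logAvg_const_mul, logAvg_sum _ hr₀ hr]
  · simp [zero]
  · exact fun l _ s hs => (cg' l).continuousAt (hO.mem_nhds (hx s hs))
  · exact fun s hs => (continuousOn_finsetSum _ fun l _ => cg' l).continuousAt
      (hO.mem_nhds (hx s hs))
  · exact fun s hs => (continuousOn_const.mul c₀.continuousOn).continuousAt
      (hO.mem_nhds (hx s hs))

end eigenAverage

/-! ### Residues in one variable -/

section oneVariable
variable {n : ℕ}

/-- The principal branch of `s ^ b`. -/
noncomputable def powLog (b s : ℂ) : ℂ := Complex.exp (b * Complex.log s)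

/-- `∏_{j ≠ i} (u_i s - u_j)`. -/
noncomputable def sepProd (u : Fin n → ℂ) (i : Fin n) (s : ℂ) : ℂ :=
  ∏ j ∈ Finset.univ.erase i, (u i * s - u j)

/-- The residue at `s = 1` of `s ^ b / ((s - 1) ∏_{j ≠ i} (u_i s - u_j)) ^ (m + 1)`. -/
noncomputable def resCoef (m : ℕ) (u : Fin n → ℂ) (i : Fin n) (b : ℂ) : ℂ :=
  iteratedDeriv m (fun s => powLog b s * (sepProd u i s ^ (m + 1))⁻¹) 1 / m.factorial

theorem powLog_add (b b' s : ℂ) : powLog (b + b') s = powLog b s * powLog b' s := by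
  simp [powLog, add_mul, Complex.exp_add]

theorem powLog_natCast (N : ℕ) {s : ℂ} (hs : s ≠ 0) : powLog N s = s ^ N := by
  rw [powLog, Complex.exp_nat_mul, Complex.exp_log hs]

theorem powLog_one_right (b : ℂ) : powLog b 1 = 1 := by simp [powLog]

theorem hasDerivAt_powLog (b : ℂ) {s : ℂ} (hs : s ∈ Complex.slitPlane) :
    HasDerivAt (powLog b) (b * powLog (b - 1) s) s := by
  have h0 := Complex.slitPlane_ne_zero hs
  have h := ((Complex.hasDerivAt_log hs).const_mul b).cexp
  refine h.congr_deriv ?_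
  have : powLog b s = powLog (b - 1) s * s := by
    have h1 := powLog_natCast 1 h0
    rw [Nat.cast_one, pow_one] at h1
    calc powLog b s = powLog (b - 1) s * powLog 1 s := by rw [← powLog_add]; simp
      _ = _ := by rw [h1]
  change powLog b s * (b * s⁻¹) = _
  rw [this]; field_simp

theorem iteratedDeriv_powLog (b : ℂ) (r : ℕ) : ∀ s ∈ Complex.slitPlane,
    iteratedDeriv r (powLog b) s = (∏ l ∈ Finset.range r, (b - l)) * powLog (b - r) s := by
  induction r with
  | zero => intro s _; simp
  | succ r ih =>
    intro s hs
    rw [iteratedDeriv_succ]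
    have : iteratedDeriv r (powLog b) =ᶠ[nhds s]
        fun s => (∏ l ∈ Finset.range r, (b - l)) * powLog (b - r) s := by
      filter_upwards [Complex.isOpen_slitPlane.mem_nhds hs] with t ht using ih t ht
    rw [this.deriv_eq, ((hasDerivAt_powLog (b - r) hs).const_mul _).deriv,
      Finset.prod_range_succ]
    push_cast
    ring_nf

theorem contDiffAt_powLog (b : ℂ) {N : WithTop ℕ∞} {s : ℂ} (hs : s ∈ Complex.slitPlane) :
    ContDiffAt ℂ N (powLog b) s :=
  (contDiffAt_const.mul (Complex.contDiffAt_log hs)).cexp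

theorem contDiff_sepProd (u : Fin n → ℂ) (i : Fin n) {N : WithTop ℕ∞} :
    ContDiff ℂ N (sepProd u i) := by
  unfold sepProd
  exact contDiff_prod fun j _ => (contDiff_const.mul contDiff_id).sub contDiff_const

theorem circleIntegral_pole (m : ℕ) {ψ : ℂ → ℂ} {r : ℝ} (hr : 0 < r)
    (hψ : DifferentiableOn ℂ ψ (Metric.closedBall 1 r)) :
    (∮ s in C(1, r), ((s - 1) ^ (m + 1))⁻¹ * ψ s) =
      2 * π * Complex.I * (iteratedDeriv m ψ 1 / m.factorial) := by
  have := hψ.circleIntegral_one_div_sub_center_pow_smul hr m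
  simp only [one_div, smul_eq_mul] at this
  rw [this]; ring

/-- The substitution w = u s also rotates the parametrisation by arg u, which does not matter for a
periodic integrand. It moves all circles to the centre 1, where the principal logarithm is the
required branch. -/
theorem circleIntegral_scale {u : ℂ} (hu : u ≠ 0) (ε : ℝ) (f : ℂ → ℂ) :
    (∮ w in C(u, ε), f (w / u)) = u * ∮ s in C(1, ε / ‖u‖), f s := by
  set G : ℝ → ℂ := fun θ => u * (circleMap 0 (ε / ‖u‖) θ * Complex.I *
    f (circleMap 1 (ε / ‖u‖) θ)) with hG
  have hGp : Function.Periodic G (2 * π) := fun θ => by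
    simp only [hG, periodic_circleMap _ _ θ]
  have hn : ((‖u‖ : ℝ) : ℂ) ≠ 0 := by simpa using hu
  have h1 : ∀ θ : ℝ, circleMap 0 ε θ = u * circleMap 0 (ε / ‖u‖) (θ - u.arg) := by
    intro θ
    simp only [circleMap, zero_add]
    have hu' := Complex.norm_mul_exp_arg_mul_I u
    have := Complex.exp_ne_zero (u.arg * Complex.I)
    push_cast
    rw [sub_mul, Complex.exp_sub]
    field_simp
    rw [mul_comm Complex.I]
    linear_combination (ε : ℂ) * hu'
  have h2 : ∀ θ : ℝ, circleMap u ε θ / u = circleMap 1 (ε / ‖u‖) (θ - u.arg) := by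
    intro θ
    have : circleMap u ε θ = u + circleMap 0 ε θ := by simp [circleMap]
    rw [this, h1]
    simp only [circleMap, zero_add]
    field_simp
  have h3 : (∮ w in C(u, ε), f (w / u)) = ∫ θ in (0 : ℝ)..2 * π, G (θ - u.arg) := by
    simp only [circleIntegral, deriv_circleMap, smul_eq_mul, hG, h2, h1]
    congr 1; funext θ; ring
  rw [h3, intervalIntegral.integral_comp_sub_right]
  have h4 := hGp.intervalIntegral_add_eq (0 - u.arg) 0
  rw [show 0 - u.arg + 2 * π = 2 * π - u.arg by ring, zero_add] at h4
  rw [h4, circleIntegral, ← intervalIntegral.integral_const_mul]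
  simp only [hG, deriv_circleMap, smul_eq_mul]

theorem prod_sub_eq_sepProd (u : Fin n → ℂ) (i : Fin n) (s : ℂ) :
    ∏ j, (u i * s - u j) = u i * (s - 1) * sepProd u i s := by
  rw [sepProd, ← Finset.mul_prod_erase _ _ (Finset.mem_univ i)]
  ring

/-- The zero of u_i s - u_j lies at distance |u_i - u_j| / |u_i| from 1. -/
theorem sepProd_ne_zero {u : Fin n → ℂ} {i : Fin n} {r : ℝ}
    (hu : ∀ j, j ≠ i → r * ‖u i‖ < ‖u i - u j‖) {s : ℂ} (hs : ‖s - 1‖ ≤ r) :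
    sepProd u i s ≠ 0 := by
  rw [sepProd, Finset.prod_ne_zero_iff]
  intro j hj h
  have h1 : u i - u j = -(u i * (s - 1)) := by linear_combination h
  have h2 := hu j (Finset.ne_of_mem_erase hj)
  rw [h1, norm_neg, norm_mul, mul_comm] at h2
  exact absurd (mul_le_mul_of_nonneg_left hs (norm_nonneg (u i))) (not_le.2 h2)

/-- Inside the circle the only pole is s = 1, of order m + 1, so Cauchy's formula for the m-th
derivative applies. -/
theorem circleIntegral_resCoef (m : ℕ) {u : Fin n → ℂ} {i : Fin n} {r : ℝ} (hr₀ : 0 < r)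
    (hr : r < 1) (hu : ∀ j, j ≠ i → r * ‖u i‖ < ‖u i - u j‖) (c x : ℂ) :
    (∮ s in C(1, r), Complex.exp (c * (x + Complex.log s / 2)) *
      ((∏ j, (u i * s - u j)) ^ (m + 1))⁻¹) =
    2 * π * Complex.I * (Complex.exp (c * x) * (u i ^ (m + 1))⁻¹ * resCoef m u i (c / 2)) := by
  have h1 : DifferentiableOn ℂ (fun s => powLog (c / 2) s * (sepProd u i s ^ (m + 1))⁻¹)
      (Metric.closedBall 1 r) := by
    intro s hs
    have hs' : ‖s - 1‖ ≤ r := by simpa [dist_eq_norm] using hs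
    have e1 : DifferentiableAt ℂ (powLog (c / 2)) s :=
      (hasDerivAt_powLog _ (mem_slitPlane_of_norm_sub_one hr hs')).differentiableAt
    have e2 : DifferentiableAt ℂ (sepProd u i) s :=
      (contDiff_sepProd u i (N := 1)).differentiable (by norm_num) s
    exact (e1.mul ((e2.pow (m + 1)).inv (pow_ne_zero _ (sepProd_ne_zero hu hs')))).differentiableWithinAt
  have h2 := circleIntegral_pole m hr₀ h1
  have h3 : ∀ s, Complex.exp (c * (x + Complex.log s / 2)) *
      ((∏ j, (u i * s - u j)) ^ (m + 1))⁻¹ = (Complex.exp (c * x) * (u i ^ (m + 1))⁻¹) *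
      (((s - 1) ^ (m + 1))⁻¹ * (powLog (c / 2) s * (sepProd u i s ^ (m + 1))⁻¹)) := by
    intro s
    rw [prod_sub_eq_sepProd, powLog, mul_pow, mul_pow, mul_inv, mul_inv, mul_add, Complex.exp_add,
      show c * (Complex.log s / 2) = c / 2 * Complex.log s by ring]
    ring
  simp only [h3]
  rw [circleIntegral.integral_const_mul, h2, resCoef]
  ring

/-- The previous residue in the variable w = u_i s; the factor u_i of dw lowers the power of u_i⁻¹
from m + 1 to m. -/
theorem circleIntegral_halfLog (m : ℕ) {x : Fin n → ℂ} {i : Fin n} {ε : ℝ} (hε₀ : 0 < ε)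
    (hε : ε < ‖expTwo x i‖) (hu : ∀ j, j ≠ i → ε < ‖expTwo x i - expTwo x j‖) (c : ℂ) :
    (∮ w in C(expTwo x i, ε), Complex.exp (c * halfLog (x i) w) *
      ((∏ j, (w - expTwo x j)) ^ (m + 1))⁻¹) =
    2 * π * Complex.I * (Complex.exp (c * x i) * (expTwo x i ^ m)⁻¹ *
      resCoef m (expTwo x) i (c / 2)) := by
  have h0 : expTwo x i ≠ 0 := Complex.exp_ne_zero _
  have hpos : 0 < ‖expTwo x i‖ := norm_pos_iff.2 h0
  have h1 := circleIntegral_scale h0 ε (fun s => Complex.exp (c * (x i + Complex.log s / 2)) *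
      ((∏ j, (expTwo x i * s - expTwo x j)) ^ (m + 1))⁻¹)
  rw [circleIntegral_resCoef m (div_pos hε₀ hpos) ((div_lt_one hpos).2 hε) (fun j hj => by
    rw [div_mul_cancel₀ _ hpos.ne']; exact hu j hj)] at h1
  simp only [mul_div_cancel₀ _ h0] at h1
  unfold halfLog
  refine h1.trans ?_
  rw [pow_succ]
  field_simp

/-- The expansion of `resCoef` in binomial coefficients. -/
theorem resCoef_eq_sum (m : ℕ) {u : Fin n → ℂ} {i : Fin n} (hu : sepProd u i 1 ≠ 0) (b : ℂ) :
    resCoef m u i b = (∑ r ∈ Finset.range (m + 1), (m.choose r : ℂ) *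
      (∏ l ∈ Finset.range r, (b - l)) *
        iteratedDeriv (m - r) (fun s => (sepProd u i s ^ (m + 1))⁻¹) 1) / m.factorial := by
  have h1 : (1 : ℂ) ∈ Complex.slitPlane := by simp
  rw [resCoef]
  -- Leibniz' rule; derivatives of s^b at 1 are falling factorials, so the residue is a polynomial
  -- in b of degree at most m.
  have := iteratedDeriv_mul (n := m) (contDiffAt_powLog b (N := m) h1)
    (((contDiff_sepProd u i).contDiffAt.pow (m + 1)).inv (pow_ne_zero (m + 1) hu))
  change iteratedDeriv m (powLog b * (fun s => sepProd u i s ^ (m + 1))⁻¹) 1 / _ = _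
  rw [this]
  congr 1
  refine Finset.sum_congr rfl fun r _ => ?_
  rw [iteratedDeriv_powLog b r 1 h1, powLog_one_right, mul_one]
  rfl

-- Derivatives of a power of 1/D are polynomials over higher powers of D, with coefficients
-- polynomial in u. The uniformity in u is what later makes the residues rational in the
-- exponentials e^{2x_i}, with denominators powers of differences.
open Polynomial in
theorem exists_iteratedDeriv_sepProd (m : ℕ) (i : Fin n) (l : ℕ) :
    ∃ p : Polynomial (MvPolynomial (Fin n) ℂ), ∀ (u : Fin n → ℂ) (s : ℂ), sepProd u i s ≠ 0 →
      iteratedDeriv l (fun s => (sepProd u i s ^ (m + 1))⁻¹) s =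
        (p.map (MvPolynomial.eval u)).eval s * (sepProd u i s ^ (m + 1 + l))⁻¹ := by
  set D : Polynomial (MvPolynomial (Fin n) ℂ) := ∏ j ∈ Finset.univ.erase i,
    (Polynomial.C (MvPolynomial.X i) * Polynomial.X - Polynomial.C (MvPolynomial.X j)) with hD
  have hDe : ∀ u s, (D.map (MvPolynomial.eval u)).eval s = sepProd u i s := by
    intro u s
    simp [hD, sepProd, Polynomial.map_prod, Polynomial.eval_prod]
  have hDd : ∀ u s, HasDerivAt (sepProd u i)
      ((D.derivative.map (MvPolynomial.eval u)).eval s) s := by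
    intro u s
    have := (D.map (MvPolynomial.eval u)).hasDerivAt s
    rw [Polynomial.derivative_map] at this
    refine this.congr_of_eventuallyEq (Filter.Eventually.of_forall fun t => (hDe u t).symm)
  induction l with
  | zero => exact ⟨1, fun u s _ => by simp⟩
  | succ l ih =>
    obtain ⟨p, hp⟩ := ih
    -- The numerator of the derivative of p D^{-(m+1+l)} over D^{m+2+l}.
    refine ⟨p.derivative * D - Polynomial.C (MvPolynomial.C ((m : ℂ) + 1 + l)) * p * D.derivative,
      fun u s hs => ?_⟩
    rw [iteratedDeriv_succ]
    have hev : ∀ᶠ t in nhds s, sepProd u i t ≠ 0 :=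
      (contDiff_sepProd u i (N := 0)).continuous.continuousAt.eventually_ne hs
    have : iteratedDeriv l (fun s => (sepProd u i s ^ (m + 1))⁻¹) =ᶠ[nhds s]
        fun s => (p.map (MvPolynomial.eval u)).eval s * (sepProd u i s ^ (m + 1 + l))⁻¹ := by
      filter_upwards [hev] with t ht using hp u t ht
    have e1 := (p.map (MvPolynomial.eval u)).hasDerivAt s
    rw [Polynomial.derivative_map] at e1
    have e2 := ((hDd u s).fun_pow (m + 1 + l)).fun_inv (pow_ne_zero _ hs)
    rw [this.deriv_eq, (e1.fun_mul e2).deriv]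
    simp only [Polynomial.map_sub, Polynomial.map_mul, Polynomial.map_C, Polynomial.eval_sub,
      Polynomial.eval_mul, Polynomial.eval_C, MvPolynomial.eval_C, hDe]
    rw [show m + 1 + l - 1 = m + l by omega, show m + 1 + (l + 1) = m + l + 2 by omega,
      show m + 1 + l = m + l + 1 by omega]
    push_cast
    field_simp
    ring

end oneVariable

/-! ### The integral as a finite sum of products of residues -/

section residueSum
variable {k : ℕ}

theorem trigBA_eq {n m : ℕ} {P : TrigPoly n} (hP : IsBANumerator n m P) (x ν : Fin n → ℂ) :
    trigBA n m x ν = P.toFun m x ν := by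
  have h : ∃ P : TrigPoly n, IsBANumerator n m P := ⟨P, hP⟩
  rw [trigBA, dif_pos h, h.choose_spec.unique hP]

/-- The exponents of `w_i^{1/2}` in the integrand. -/
noncomputable def resExp (m : ℕ) (ν : Fin (k + 1) → ℂ) (β : Fin k → ℤ) (i : Fin k) : ℂ :=
  β i + m * (k + 1) + 2 * (ν i.castSucc - ν (Fin.last k))

/-- The value of the residue, up to a constant; `G` stands for `A(w) P(z, ν)`. -/
noncomputable def resSum (m : ℕ) (G : TrigPoly k) (x ν : Fin (k + 1) → ℂ) : ℂ :=
  prodDiff (expTwo x) ^ (m + 1) * ∑ β ∈ G.support,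
    MvPolynomial.eval (fun i => ν i.castSucc) (G β) *
      ∏ i : Fin k, (Complex.exp (resExp m ν β i * x i.castSucc) *
        (expTwo x i.castSucc ^ m)⁻¹ * resCoef m (expTwo x) i.castSucc (resExp m ν β i / 2))

/-- The constant relating the integral to `resSum`. -/
noncomputable def resConst (k m : ℕ) : ℂ :=
  2 ^ (k.choose 2 * m) * (starSign k (k + 1) ^ (m + 1))⁻¹

theorem resConst_ne_zero (k m : ℕ) : resConst k m ≠ 0 :=
  mul_ne_zero (pow_ne_zero _ two_ne_zero) (inv_ne_zero (pow_ne_zero _ (starSign_ne_zero _ _)))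

/-- The Baker–Akhiezer function without the factor `C_m(ν)`. -/
noncomputable def baPart {n : ℕ} (m : ℕ) (P : TrigPoly n) (z ν : Fin n → ℂ) : ℂ :=
  P.ev z ν / prodSinh z ^ m * Complex.exp (2 * ∑ i, ν i * z i)

/-- The integrand in the additive variables. -/
noncomputable def coreIntegrand (m : ℕ) (P : TrigPoly k) (x ν : Fin (k + 1) → ℂ)
    (z : Fin k → ℂ) : ℂ :=
  prodDiff (expTwo x) ^ (m + 1) * prodDiff (expTwo z) ^ (m + 1) /
    prodDiffStar (expTwo z) (expTwo x) ^ (m + 1) *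
    (∏ i, Complex.exp (2 * ((m : ℂ) - ν (Fin.last k)) * z i)) *
    baPart m P z (fun i => ν i.castSucc)

/-- One of the m + 1 factors A(w) is put into G; the other m cancel B(z)^m up to a power of 2 and an
exponential. That exponential contributes m(k - 1) to the exponent of each z_i and w_i^m contributes
2m, which explains the m(k + 1) in `resExp`. What remains is a sum of products of functions of one
variable. -/
theorem coreIntegrand_eq (m : ℕ) {P G : TrigPoly k}
    (hG : ∀ z ν, G.ev z ν = prodDiff (expTwo z) * P.ev z ν) (x ν : Fin (k + 1) → ℂ)
    {z : Fin k → ℂ} (hz : prodSinh z ≠ 0) :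
    coreIntegrand m P x ν z = resConst k m * prodDiff (expTwo x) ^ (m + 1) *
      ∑ β ∈ G.support, MvPolynomial.eval (fun i => ν i.castSucc) (G β) *
        ∏ i, (Complex.exp (resExp m ν β i * z i) *
          ((∏ j, (expTwo z i - expTwo x j)) ^ (m + 1))⁻¹) := by
  set ν' : Fin k → ℂ := fun i => ν i.castSucc with hν'
  set E := Complex.exp (∑ i, ((m : ℂ) * (k + 1) + 2 * (ν i.castSucc - ν (Fin.last k))) * z i)
    with hE
  have h1 : ∀ β, ∏ i, (Complex.exp (resExp m ν β i * z i) *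
      ((∏ j, (expTwo z i - expTwo x j)) ^ (m + 1))⁻¹) = trigChar β z * E *
      ((∏ i, ∏ j, (expTwo z i - expTwo x j)) ^ (m + 1))⁻¹ := by
    intro β
    rw [Finset.prod_mul_distrib, ← Complex.exp_sum, Finset.prod_inv_distrib, Finset.prod_pow,
      trigChar, hE, ← Complex.exp_add, ← Finset.sum_add_distrib]
    have : ∀ i, resExp m ν β i * z i = (β i : ℂ) * z i +
        ((m : ℂ) * (k + 1) + 2 * (ν i.castSucc - ν (Fin.last k))) * z i := fun i => by
      rw [resExp]; ring
    simp only [this]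
  simp only [h1]
  have h2 : ∑ β ∈ G.support, MvPolynomial.eval ν' (G β) * (trigChar β z * E *
      ((∏ i, ∏ j, (expTwo z i - expTwo x j)) ^ (m + 1))⁻¹) =
      prodDiff (expTwo z) * P.ev z ν' * E *
      ((∏ i, ∏ j, (expTwo z i - expTwo x j)) ^ (m + 1))⁻¹ := by
    rw [← hG, TrigPoly.ev_eq_sum, Finset.sum_mul, Finset.sum_mul]
    exact Finset.sum_congr rfl fun β _ => by ring
  rw [h2]
  have h3 : prodDiff (expTwo z) ^ m * ((∏ i, Complex.exp (2 * ((m : ℂ) - ν (Fin.last k)) * z i)) *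
      Complex.exp (2 * ∑ i, ν' i * z i)) = 2 ^ (k.choose 2 * m) * prodSinh z ^ m * E := by
    have : Complex.exp (((k : ℂ) - 1) * ∑ i, z i) ^ m *
        ((∏ i, Complex.exp (2 * ((m : ℂ) - ν (Fin.last k)) * z i)) *
        Complex.exp (2 * ∑ i, ν' i * z i)) = E := by
      rw [← Complex.exp_sum, ← Complex.exp_nat_mul, ← Complex.exp_add, ← Complex.exp_add, hE]
      congr 1
      rw [← mul_assoc, Finset.mul_sum, Finset.mul_sum, ← Finset.sum_add_distrib,
        ← Finset.sum_add_distrib]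
      exact Finset.sum_congr rfl fun i _ => by simp only [hν']; ring
    rw [prodDiff_expTwo, mul_pow, mul_pow, ← pow_mul, ← this]
    ring
  have h4 := pow_ne_zero m hz
  rw [coreIntegrand, baPart, prodDiffStar_eq, resConst, mul_pow (starSign k (k + 1)),
    div_eq_mul_inv, mul_inv]
  calc _ = prodDiff (expTwo x) ^ (m + 1) * prodDiff (expTwo z) * P.ev z ν' *
        ((starSign k (k + 1) ^ (m + 1))⁻¹ *
          ((∏ i, ∏ j, (expTwo z i - expTwo x j)) ^ (m + 1))⁻¹) * (prodSinh z ^ m)⁻¹ *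
        (prodDiff (expTwo z) ^ m * ((∏ i, Complex.exp (2 * ((m : ℂ) - ν (Fin.last k)) * z i)) *
      Complex.exp (2 * ∑ i, ν' i * z i))) := by rw [pow_succ (prodDiff (expTwo z))]; ring
    _ = _ := by rw [h3]; field_simp

theorem continuousOn_sum_prod {ι : Type*} (S : Finset ι) (d : ι → ℂ) (f : ι → Fin k → ℂ → ℂ)
    (c : Fin k → ℂ) (R : Fin k → ℝ)
    (hf : ∀ a ∈ S, ∀ i, ContinuousOn (f a i) (Metric.sphere (c i) (R i))) :
    ContinuousOn (fun w : Fin k → ℂ => ∑ a ∈ S, d a * ∏ i, f a i (w i)) (torusSet c R) := by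
  refine continuousOn_finsetSum _ fun a ha => continuousOn_const.mul
    (continuousOn_finsetProd _ fun i _ => (hf a ha i).comp (by fun_prop) fun w hw => ?_)
  simpa [dist_eq_norm] using hw i

theorem torusIntegral_sum_prod {ι : Type*} (S : Finset ι) (d : ι → ℂ) (f : ι → Fin k → ℂ → ℂ)
    (c : Fin k → ℂ) {R : Fin k → ℝ} (hR : ∀ i, 0 ≤ R i)
    (hf : ∀ a ∈ S, ∀ i, ContinuousOn (f a i) (Metric.sphere (c i) (R i))) :
    torusIntegral (fun w => ∑ a ∈ S, d a * ∏ i, f a i (w i)) c R =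
      ∑ a ∈ S, d a * ∏ i, ∮ z in C(c i, R i), f a i z := by
  rw [torusIntegral_finsetSum]
  · exact Finset.sum_congr rfl fun a _ => by rw [torusIntegral_const_mul, torusIntegral_prod]
  · intro a ha
    have := continuousOn_sum_prod {a} d f c R fun b hb => by
      rw [Finset.mem_singleton] at hb; rw [hb]; exact hf a ha
    simp only [Finset.sum_singleton] at this
    exact this.torusIntegrable hR

theorem exp_two_halfLog (x : ℂ) {w : ℂ} (hw : w ≠ 0) : Complex.exp (2 * halfLog x w) = w := by
  have h0 := Complex.exp_ne_zero (2 * x)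
  rw [halfLog, mul_add, Complex.exp_add, mul_div_cancel₀ _ (two_ne_zero),
    Complex.exp_log (div_ne_zero hw h0)]
  field_simp

theorem prodSinh_ne_zero_of_expTwo {n : ℕ} {z : Fin n → ℂ}
    (h : ∀ i j, i ≠ j → expTwo z i ≠ expTwo z j) : prodSinh z ≠ 0 :=
  prodSinh_ne_zero_iff.2 fun i j hij => (exp_two_ne_iff _ _).1 (h i j hij)

theorem residueIntegrand_eq (m : ℕ) {P G : TrigPoly k} (hP : IsBANumerator k m P)
    (hG : ∀ z ν, G.ev z ν = prodDiff (expTwo z) * P.ev z ν) (x ν : Fin (k + 1) → ℂ)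
    {w : Fin k → ℂ} (hw₀ : ∀ i, w i ≠ 0) (hw : ∀ i j, i ≠ j → w i ≠ w j) :
    residueIntegrand k m x ν w = (normConst m fun i : Fin k => ν i.castSucc)⁻¹ *
      (resConst k m * prodDiff (expTwo x) ^ (m + 1)) *
      ∑ β ∈ G.support, MvPolynomial.eval (fun i => ν i.castSucc) (G β) *
        ∏ i : Fin k, (Complex.exp (resExp m ν β i * halfLog (x i.castSucc) (w i)) *
          ((∏ j, (w i - expTwo x j)) ^ (m + 1))⁻¹) := by
  set z : Fin k → ℂ := fun i => halfLog (x i.castSucc) (w i) with hz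
  have hwz : w = expTwo z := funext fun i => (exp_two_halfLog _ (hw₀ i)).symm
  have h1 : residueIntegrand k m x ν w =
      (normConst m fun i : Fin k => ν i.castSucc)⁻¹ * coreIntegrand m P x ν z := by
    simp only [residueIntegrand]
    rw [trigBA_eq hP, TrigPoly.toFun, TrigPoly.ratio, coreIntegrand, baPart, ← hwz]
    change _ * (TrigPoly.ev P z _ / _ * _) = _
    rw [mul_comm (prodSinh _ ^ m), ← div_div]
    unfold expTwo
    ring
  rw [h1, coreIntegrand_eq m hG x ν (prodSinh_ne_zero_of_expTwo (by rw [← hwz]; exact hw)), ← hwz]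
  ring

/-- The torus integral of the residue formula in terms of `resSum`. -/
theorem torusIntegral_residueIntegrand (m : ℕ) {P G : TrigPoly k} (hP : IsBANumerator k m P)
    (hG : ∀ z ν, G.ev z ν = prodDiff (expTwo z) * P.ev z ν) (x ν : Fin (k + 1) → ℂ) {ε : ℝ}
    (hε₀ : 0 < ε) (hε : ∀ i : Fin k, ε < ‖expTwo x i.castSucc‖)
    (hu : ∀ i j : Fin (k + 1), i ≠ j → 2 * ε < ‖expTwo x i - expTwo x j‖) :
    TorusIntegrable (residueIntegrand k m x ν) (fun i : Fin k => expTwo x i.castSucc)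
      (fun _ => ε) ∧
    torusIntegral (residueIntegrand k m x ν) (fun i : Fin k => expTwo x i.castSucc) (fun _ => ε) =
      (normConst m fun i : Fin k => ν i.castSucc)⁻¹ * resConst k m * (2 * π * Complex.I) ^ k *
        resSum m G x ν := by
  set c : Fin k → ℂ := fun i => expTwo x i.castSucc with hc
  obtain ⟨A, hA⟩ : ∃ A, A = (normConst m fun i : Fin k => ν i.castSucc)⁻¹ *
      (resConst k m * prodDiff (expTwo x) ^ (m + 1)) := ⟨_, rfl⟩
  set f : (Fin k → ℤ) → Fin k → ℂ → ℂ := fun β i w =>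
    Complex.exp (resExp m ν β i * halfLog (x i.castSucc) w) *
          ((∏ j, (w - expTwo x j)) ^ (m + 1))⁻¹ with hf
  have heq : ∀ w ∈ torusSet c (fun _ => ε), residueIntegrand k m x ν w =
      A * ∑ β ∈ G.support, MvPolynomial.eval (fun i => ν i.castSucc) (G β) * ∏ i, f β i (w i) := by
    intro w hw
    rw [hA]
    refine residueIntegrand_eq m hP hG x ν (fun i h => ?_) (fun i j hij h => ?_)
    · have h1 := hw i
      rw [h, zero_sub, norm_neg] at h1
      exact absurd h1 (hε i).ne'
    · have h1 := hu i.castSucc j.castSucc (by simpa using hij)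
      have h2 : expTwo x i.castSucc - expTwo x j.castSucc = (w j - c j) - (w i - c i) := by
        rw [h]; simp only [hc]; ring
      have h3 := norm_sub_le (w j - c j) (w i - c i)
      rw [← h2, hw i, hw j] at h3
      linarith
  have hcont : ∀ β ∈ G.support, ∀ i, ContinuousOn (f β i) (Metric.sphere (c i) ε) := by
    intro β _ i w hw
    have hw' : ‖w - c i‖ = ε := by simpa [dist_eq_norm] using hw
    have h0 : c i ≠ 0 := Complex.exp_ne_zero _
    have hn : 0 < ‖c i‖ := norm_pos_iff.2 h0
    have hs : w / Complex.exp (2 * x i.castSucc) ∈ Complex.slitPlane := by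
      refine mem_slitPlane_of_norm_sub_one (r := ε / ‖c i‖) ((div_lt_one hn).2 (hε i)) ?_
      change ‖w / c i - 1‖ ≤ _
      rw [div_sub_one h0, norm_div, hw']
    have h1 : ContinuousAt (fun w => halfLog (x i.castSucc) w) w := by
      unfold halfLog
      exact continuousAt_const.add ((ContinuousAt.clog
        (continuousAt_id.div_const _) hs).div_const 2)
    have h2 : (∏ j, (w - expTwo x j)) ^ (m + 1) ≠ 0 := by
      refine pow_ne_zero _ (Finset.prod_ne_zero_iff.2 fun j _ h => ?_)
      rw [sub_eq_zero] at h
      rw [h] at hw'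
      by_cases hj : j = i.castSucc
      · rw [hj] at hw'; simp [hc] at hw'; exact hε₀.ne hw'
      · have := hu j i.castSucc hj
        rw [show ‖expTwo x j - expTwo x i.castSucc‖ = ε from hw'] at this
        linarith
    refine ContinuousAt.continuousWithinAt ?_
    exact (continuousAt_const.mul h1).cexp.mul (ContinuousAt.inv₀ (by fun_prop) h2)
  have hR : ∀ i : Fin k, 0 ≤ (fun _ : Fin k => ε) i := fun _ => hε₀.le
  constructor
  · have hS := continuousOn_sum_prod G.support
      (fun β => MvPolynomial.eval (fun i => ν i.castSucc) (G β)) f c (fun _ => ε) hcont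
    have hA' : ContinuousOn (fun _ : Fin k → ℂ => A) (torusSet c fun _ => ε) := continuousOn_const
    exact ((hA'.mul hS).congr heq).torusIntegrable hR
  · rw [torusIntegral_congr hR heq, torusIntegral_const_mul,
      torusIntegral_sum_prod _ _ _ _ hR hcont]
    have hcirc : ∀ β i, (∮ w in C(c i, ε), f β i w) = 2 * π * Complex.I *
        (Complex.exp (resExp m ν β i * x i.castSucc) * (expTwo x i.castSucc ^ m)⁻¹ *
          resCoef m (expTwo x) i.castSucc (resExp m ν β i / 2)) := by
      intro β i
      refine circleIntegral_halfLog m hε₀ (hε i) (fun j hj => ?_) _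
      linarith [hu i.castSucc j hj.symm]
    simp only [hcirc, Finset.prod_mul_distrib, Finset.prod_const, Finset.card_univ,
      Fintype.card_fin]
    rw [hA, resSum]
    rw [Finset.mul_sum, Finset.mul_sum, Finset.mul_sum]
    refine Finset.sum_congr rfl fun β _ => ?_
    simp only [Finset.prod_mul_distrib]
    ring

/-- Radii for which the circles `|s_i - 1| = r` separate the points. -/
def GoodRadius (r : ℝ) (x : Fin (k + 1) → ℂ) : Prop :=
  0 < r ∧ r < 1 ∧ ∀ i j, i ≠ j → r * (‖expTwo x i‖ + ‖expTwo x j‖) < ‖expTwo x i - expTwo x j‖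

theorem GoodRadius.lt {r : ℝ} {x : Fin (k + 1) → ℂ} (h : GoodRadius r x) {i j : Fin (k + 1)}
    (hij : j ≠ i) : r * ‖expTwo x i‖ < ‖expTwo x i - expTwo x j‖ := by
  have h1 := h.2.2 i j hij.symm
  have h2 := mul_nonneg h.1.le (norm_nonneg (expTwo x j))
  linarith

theorem expTwo_shiftLog (x : Fin (k + 1) → ℂ) {s : Fin k → ℂ} (hs : ∀ l, s l ≠ 0) (l : Fin k) :
    expTwo (shiftLog x s) l = expTwo x l.castSucc * s l := by
  rw [expTwo, shiftLog, mul_add, Complex.exp_add, mul_div_cancel₀ _ (two_ne_zero),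
    Complex.exp_log (hs l), expTwo]

/-- The discs of radius r |u_i| about the u_i are disjoint, and s_i ≠ 1 on the circle. -/
theorem GoodRadius.kernDom {r : ℝ} {x : Fin (k + 1) → ℂ} (h : GoodRadius r x) {s : Fin k → ℂ}
    (hs : s ∈ unitTorus k r) : (x, shiftLog x s) ∈ kernSet (k + 1) k := by
  have hs0 := fun l => unitTorus_ne_zero h.2.1 hs l
  refine ⟨prodDiff_ne_zero_iff.2 fun i j hij hij' => ?_, prodDiff_ne_zero_iff.2 fun i j hij hij' => ?_,
    prodDiffStar_ne_zero_iff.2 fun i j hij => ?_⟩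
  · have h1 := h.2.2 i j hij
    rw [hij', sub_self, norm_zero] at h1
    exact absurd h1 (not_lt.2 (mul_nonneg h.1.le (by positivity)))
  · simp only [expTwo_shiftLog x hs0] at hij'
    have h1 := h.2.2 i.castSucc j.castSucc (by simpa using hij)
    have h2 : expTwo x i.castSucc - expTwo x j.castSucc =
        expTwo x j.castSucc * (s j - 1) - expTwo x i.castSucc * (s i - 1) := by
      linear_combination hij'
    have h3 := norm_sub_le (expTwo x j.castSucc * (s j - 1)) (expTwo x i.castSucc * (s i - 1))
    rw [← h2, norm_mul, norm_mul, hs i, hs j] at h3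
    linarith
  · simp only [expTwo_shiftLog x hs0] at hij
    have h2 : expTwo x i.castSucc - expTwo x j = -(expTwo x i.castSucc * (s i - 1)) := by
      linear_combination hij
    by_cases hj : j = i.castSucc
    · rw [hj, sub_self, eq_comm, neg_eq_zero] at h2
      have h3 := hs i
      rw [(mul_eq_zero.1 h2).resolve_left (Complex.exp_ne_zero _), norm_zero] at h3
      exact h.1.ne h3
    · have h1 := h.lt hj
      rw [h2, norm_neg, norm_mul, hs i, mul_comm] at h1
      exact lt_irrefl _ h1

/-- The kernel average in terms of `resSum`. -/
theorem logAvg_baPart (m : ℕ) {P G : TrigPoly k}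
    (hG : ∀ z ν, G.ev z ν = prodDiff (expTwo z) * P.ev z ν) (ν : Fin (k + 1) → ℂ) {r : ℝ}
    {x : Fin (k + 1) → ℂ} (hr : GoodRadius r x) :
    logAvg r (fun p => kern m (ν (Fin.last k)) p.1 p.2 *
        baPart m P p.2 (fun i => ν i.castSucc)) x =
      Complex.exp (2 * ν (Fin.last k) * ∑ i, x i) * resConst k m * (2 * π * Complex.I) ^ k *
        resSum m G x ν := by
  set A := Complex.exp (2 * ν (Fin.last k) * ∑ i, x i) * (∏ i : Fin k, expTwo x i.castSucc) *
      (resConst k m * prodDiff (expTwo x) ^ (m + 1)) with hA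
  set f : (Fin k → ℤ) → Fin k → ℂ → ℂ := fun β i s =>
    Complex.exp (resExp m ν β i * (x i.castSucc + Complex.log s / 2)) *
          ((∏ j, (expTwo x i.castSucc * s - expTwo x j)) ^ (m + 1))⁻¹ with hf
  have heq : ∀ s ∈ unitTorus k r, (∏ l, s l)⁻¹ * (kern m (ν (Fin.last k)) x (shiftLog x s) *
        baPart m P (shiftLog x s) (fun i => ν i.castSucc)) =
      A * ∑ β ∈ G.support, MvPolynomial.eval (fun i => ν i.castSucc) (G β) * ∏ i, f β i (s i) := by
    intro s hs
    have hs0 := fun l => unitTorus_ne_zero hr.2.1 hs l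
    have hdom := hr.kernDom hs
    have h1 : (∏ l, s l)⁻¹ * (kern m (ν (Fin.last k)) x (shiftLog x s) *
        baPart m P (shiftLog x s) (fun i => ν i.castSucc)) =
        Complex.exp (2 * ν (Fin.last k) * ∑ i, x i) * (∏ i : Fin k, expTwo x i.castSucc) *
        coreIntegrand m P x ν (shiftLog x s) := by
      have e1 : ∏ i, expTwo (shiftLog x s) i = (∏ i : Fin k, expTwo x i.castSucc) * ∏ l, s l := by
        simp only [expTwo_shiftLog x hs0, Finset.prod_mul_distrib]
      -- The kernel carries w_i^{m+1} where the residue formula has w_i^m; the surplus ∏ w_i absorbs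
      -- the weight ∏ s_i⁻¹ and leaves ∏ u_i.
      have e2 : Complex.exp (2 * (m + 1) * ∑ i, shiftLog x s i) *
          Complex.exp (2 * ν (Fin.last k) * (∑ i, x i - ∑ i, shiftLog x s i)) =
          Complex.exp (2 * ν (Fin.last k) * ∑ i, x i) *
          (∏ i, Complex.exp (2 * ((m : ℂ) - ν (Fin.last k)) * shiftLog x s i)) *
          ∏ i, expTwo (shiftLog x s) i := by
        simp only [expTwo, ← Complex.exp_sum, ← Complex.exp_add, ← Finset.mul_sum]
        congr 1; ring
      have e3 : ∏ l, s l ≠ 0 := Finset.prod_ne_zero_iff.2 fun l _ => hs0 l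
      rw [e1] at e2
      rw [kern, coreIntegrand, mul_assoc _ (Complex.exp _) (Complex.exp _), e2]
      field_simp
    rw [h1, coreIntegrand_eq m hG x ν
      (prodSinh_ne_zero_of_expTwo (prodDiff_ne_zero_iff.1 hdom.2.1)), hA]
    simp only [hf, ← expTwo_shiftLog x hs0]
    simp only [shiftLog]
    ring
  have hcont : ∀ β ∈ G.support, ∀ i, ContinuousOn (f β i) (Metric.sphere 1 r) := by
    intro β _ i s hs
    have hs' : ‖s - 1‖ = r := by simpa [dist_eq_norm] using hs
    have hsl := mem_slitPlane_of_norm_sub_one hr.2.1 hs'.le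
    have h2 : (∏ j, (expTwo x i.castSucc * s - expTwo x j)) ^ (m + 1) ≠ 0 := by
      rw [prod_sub_eq_sepProd]
      refine pow_ne_zero _ (mul_ne_zero (mul_ne_zero (Complex.exp_ne_zero _) fun h => ?_)
        (sepProd_ne_zero (fun j hj => hr.lt hj) hs'.le))
      rw [h, norm_zero] at hs'; exact hr.1.ne hs'
    refine ContinuousAt.continuousWithinAt ?_
    exact (continuousAt_const.mul (continuousAt_const.add ((continuousAt_id.clog hsl).div_const
      2))).cexp.mul (ContinuousAt.inv₀ (by fun_prop) h2)
  have hR : ∀ i : Fin k, 0 ≤ (fun _ : Fin k => r) i := fun _ => hr.1.le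
  rw [logAvg, torusIntegral_congr hR heq, torusIntegral_const_mul,
      torusIntegral_sum_prod _ _ _ _ hR hcont]
  simp only [hf, circleIntegral_resCoef m hr.1 hr.2.1 (fun j hj => hr.lt hj),
    Finset.prod_mul_distrib, Finset.prod_const, Finset.card_univ, Fintype.card_fin]
  rw [hA, resSum]
  generalize Complex.exp (2 * ν (Fin.last k) * ∑ i, x i) = e
  rw [Finset.mul_sum, Finset.mul_sum, Finset.mul_sum]
  refine Finset.sum_congr rfl fun β _ => ?_
  simp only [Finset.prod_mul_distrib, Finset.prod_inv_distrib, Finset.prod_pow]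
  have e4 : ∏ i : Fin k, expTwo x i.castSucc ≠ 0 :=
    Finset.prod_ne_zero_iff.2 fun l _ => Complex.exp_ne_zero _
  rw [pow_succ (∏ i : Fin k, expTwo x i.castSucc), mul_inv]
  field_simp
  ring

end residueSum

/-! ### The residue satisfies the Schrödinger equation -/

section eigenfunction
variable {k : ℕ}

theorem prodSinh_ne_zero_iff_expTwo {n : ℕ} {z : Fin n → ℂ} :
    prodSinh z ≠ 0 ↔ prodDiff (expTwo z) ≠ 0 := by
  rw [prodSinh_ne_zero_iff, prodDiff_ne_zero_iff]
  exact forall₃_congr fun i j _ => (exp_two_ne_iff _ _).symm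

theorem sutherlandOp_const_mul {n : ℕ} (m : ℕ) (c : ℂ) (f : (Fin n → ℂ) → ℂ) (x : Fin n → ℂ) :
    sutherlandOp n m (fun y => c * f y) x = c * sutherlandOp n m f x := by
  simp only [sutherlandOp, iteratedDeriv_const_mul_field, ← Finset.mul_sum]
  ring

theorem sutherlandOp_congr {n : ℕ} (m : ℕ) {f g : (Fin n → ℂ) → ℂ} {x : Fin n → ℂ}
    (h : f =ᶠ[nhds x] g) : sutherlandOp n m f x = sutherlandOp n m g x := by
  simp only [sutherlandOp, h.eq_of_nhds]
  congr 2
  refine Finset.sum_congr rfl fun i _ => ?_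
  exact Filter.EventuallyEq.iteratedDeriv_eq 2 (eventually_update i h)

theorem contDiffOn_baPart {n : ℕ} {N : WithTop ℕ∞} (m : ℕ) (P : TrigPoly n) (ν : Fin n → ℂ) :
    ContDiffOn ℂ N (fun z => baPart m P z ν) {z | prodDiff (expTwo z) ≠ 0} := by
  have h1 : ContDiff ℂ N (fun z => P.ev z ν) := by
    simp only [TrigPoly.ev_eq_sum, trigChar]
    exact ContDiff.sum fun α _ => (ContDiff.cexp
      (ContDiff.sum fun i _ => contDiff_const.mul (contDiff_apply ℂ ℂ i))).mul contDiff_const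
  have h2 : ContDiff ℂ N (fun z : Fin n → ℂ => prodSinh z) := by
    unfold prodSinh
    exact contDiff_prod fun i _ => contDiff_prod fun j _ =>
      Complex.contDiff_sinh.comp ((contDiff_apply ℂ ℂ i).sub (contDiff_apply ℂ ℂ j))
  have h3 : ContDiff ℂ N (fun z : Fin n → ℂ => Complex.exp (2 * ∑ i, ν i * z i)) :=
    ContDiff.cexp (contDiff_const.mul
      (ContDiff.sum fun i _ => contDiff_const.mul (contDiff_apply ℂ ℂ i)))
  unfold baPart
  exact (h1.contDiffOn.div (h2.pow m).contDiffOn fun z hz =>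
    pow_ne_zero _ (prodSinh_ne_zero_iff_expTwo.2 hz)).mul h3.contDiffOn

theorem toFun_eq_baPart {n : ℕ} (m : ℕ) (P : TrigPoly n) (x ν : Fin n → ℂ) :
    P.toFun m x ν = (normConst m ν)⁻¹ * baPart m P x ν := by
  rw [TrigPoly.toFun, TrigPoly.ratio, baPart]
  change TrigPoly.ev P x ν / _ * _ = _
  rw [mul_comm (prodSinh _ ^ m), ← div_div]
  ring

theorem baPart_eigen {n m : ℕ} {P : TrigPoly n} (hP : IsBANumerator n m P) {ν : Fin n → ℂ}
    (hν : normConst m ν ≠ 0) {z : Fin n → ℂ} (hz : prodDiff (expTwo z) ≠ 0) :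
    ∑ l, iteratedDeriv 2 (fun t => baPart m P (Function.update z l t) ν) (z l) =
        (m * (m + 1) * (∑ i, ∑ j, cschSqDiff (z i) (z j)) + 4 * ∑ i, ν i ^ 2) *
          baPart m P z ν := by
  have h := hP.eigen ν hν z (prodSinh_ne_zero_iff_expTwo.2 hz)
  simp only [toFun_eq_baPart, sutherlandOp_const_mul] at h
  rw [sutherlandOp, potential_eq] at h
  have h' := inv_ne_zero hν
  have h2 := mul_left_cancel₀ h' (h.trans (mul_left_comm _ _ _))
  linear_combination -h2

theorem exists_goodRadius {x : Fin (k + 1) → ℂ} (hx : prodDiff (expTwo x) ≠ 0) :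
    ∃ r, GoodRadius r x := by
  have h : ∀ p : {p : Fin (k + 1) × Fin (k + 1) // p.1 ≠ p.2},
      ∀ᶠ r : ℝ in nhdsWithin 0 (Set.Ioi 0),
        r * (‖expTwo x p.1.1‖ + ‖expTwo x p.1.2‖) < ‖expTwo x p.1.1 - expTwo x p.1.2‖ := by
    intro p
    have h1 : Filter.Tendsto (fun r : ℝ => r * (‖expTwo x p.1.1‖ + ‖expTwo x p.1.2‖))
        (nhds 0) (nhds (0 * (‖expTwo x p.1.1‖ + ‖expTwo x p.1.2‖))) :=
      Filter.tendsto_id.mul_const _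
    rw [zero_mul] at h1
    exact (h1.mono_left nhdsWithin_le_nhds).eventually_lt_const
      (norm_pos_iff.2 (sub_ne_zero.2 (prodDiff_ne_zero_iff.1 hx _ _ p.2)))
  have h2 : ∀ᶠ r : ℝ in nhdsWithin 0 (Set.Ioi 0), r < 1 :=
    (tendsto_order.1 (Filter.tendsto_id.mono_left nhdsWithin_le_nhds)).2 _ one_pos
  obtain ⟨r, h3, h4, h5⟩ :=
    ((Filter.eventually_all.2 h).and (h2.and self_mem_nhdsWithin)).exists
  exact ⟨r, h5, h4, fun i j hij => h3 ⟨(i, j), hij⟩⟩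

theorem GoodRadius.eventually {r : ℝ} {x : Fin (k + 1) → ℂ} (h : GoodRadius r x) :
    ∀ᶠ y in nhds x, GoodRadius r y := by
  have h1 : ∀ p : {p : Fin (k + 1) × Fin (k + 1) // p.1 ≠ p.2}, ∀ᶠ y in nhds x,
        r * (‖expTwo y p.1.1‖ + ‖expTwo y p.1.2‖) < ‖expTwo y p.1.1 - expTwo y p.1.2‖ := by
    intro p
    refine ContinuousAt.eventually_lt ?_ ?_ (h.2.2 _ _ p.2) <;>
    · unfold expTwo; fun_prop
  filter_upwards [Filter.eventually_all.2 h1] with y hy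
  exact ⟨h.1, h.2.1, fun i j hij => hy ⟨(i, j), hij⟩⟩

/-- The right hand side of the residue formula, up to a constant. -/
noncomputable def resHat (m : ℕ) (G : TrigPoly k) (x ν : Fin (k + 1) → ℂ) : ℂ :=
  Complex.exp (2 * ν (Fin.last k) * ∑ i, x i) * resSum m G x ν

/-- One radius serves all points near x, so `resHat` is locally a constant multiple of the kernel
average. The 4a² from the kernel supplies the missing term ν_{k+1}² of the eigenvalue. -/
theorem resHat_eigen {m : ℕ} {P G : TrigPoly k} (hP : IsBANumerator k m P)
    (hG : ∀ z ν, G.ev z ν = prodDiff (expTwo z) * P.ev z ν) {ν : Fin (k + 1) → ℂ}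
    (hν : normConst m (fun i : Fin k => ν i.castSucc) ≠ 0) {x : Fin (k + 1) → ℂ}
    (hx : prodSinh x ≠ 0) :
    sutherlandOp (k + 1) m (fun y => resHat m G y ν) x =
      -4 * (∑ i, ν i ^ 2) * resHat m G x ν := by
  obtain ⟨r, hr⟩ := exists_goodRadius (prodSinh_ne_zero_iff_expTwo.1 hx)
  set Φ : (Fin k → ℂ) → ℂ := fun z => baPart m P z (fun i => ν i.castSucc) with hΦ
  set F := logAvg r (fun p => kern m (ν (Fin.last k)) p.1 p.2 * Φ p.2) with hF
  have hc : resConst k m * (2 * π * Complex.I) ^ k ≠ 0 :=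
    mul_ne_zero (resConst_ne_zero k m) (pow_ne_zero _ Complex.two_pi_I_ne_zero)
  have h1 : (fun y => resHat m G y ν) =ᶠ[nhds x]
      fun y => (resConst k m * (2 * π * Complex.I) ^ k)⁻¹ * F y := by
    filter_upwards [hr.eventually] with y hy
    rw [hF, hΦ, logAvg_baPart m hG ν hy, resHat, eq_inv_mul_iff_mul_eq₀ hc]
    ring
  have h2 := logAvg_eigen m (ν (Fin.last k)) (4 * ∑ i : Fin k, ν i.castSucc ^ 2) hr.1.le hr.2.1
    (Φ := Φ) (contDiffOn_baPart m P _) (fun z hz => baPart_eigen hP hν hz)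
    (fun s hs => hr.kernDom hs)
  rw [sutherlandOp_congr m h1, sutherlandOp_const_mul, h1.eq_of_nhds, sutherlandOp, potential_eq,
    h2, Fin.sum_univ_castSucc (fun i => ν i ^ 2)]
  ring

end eigenfunction

/-! ### Divisibility of trigonometric polynomials by B -/

section division
variable {n : ℕ}

/-- The zeros of `sinh (x_a - x_b)` at which the other factors of `B(x)` do not vanish. -/
def IsWall (a b : Fin n) (x : Fin n → ℂ) : Prop :=
  Complex.sinh (x a - x b) = 0 ∧ ∀ i j, i ≠ j → ¬(i = a ∧ j = b) → ¬(i = b ∧ j = a) →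
    Complex.sinh (x i - x j) ≠ 0

/-- Every zero of sinh (x_a - x_b) is a limit of zeros at which no other factor of B vanishes. -/
theorem eq_zero_of_wall {f : (Fin n → ℂ) → ℂ} (hf : Continuous f) {a b : Fin n}
    (h : ∀ x, IsWall a b x → f x = 0) {x : Fin n → ℂ} (hx : Complex.sinh (x a - x b) = 0) :
    f x = 0 := by
  -- This direction has distinct entries except that the entries at a and b agree, so it keeps x_a -
  -- x_b and moves all other differences.
  set d : Fin n → ℂ := fun i => if i = b then ((a : ℕ) : ℂ) else ((i : ℕ) : ℂ) with hd
  have hinj : ∀ i j : Fin n, i ≠ j → ((i : ℕ) : ℂ) - ((j : ℕ) : ℂ) ≠ 0 := fun i j hij h =>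
    hij (Fin.ext (by exact_mod_cast sub_eq_zero.1 h))
  refine eq_zero_of_eventually_line hf x d ?_
  have h1 : ∀ᶠ t : ℂ in nhdsWithin 0 {0}ᶜ, ∀ i j : Fin n, i ≠ j → ¬(i = a ∧ j = b) →
      ¬(i = b ∧ j = a) → Complex.sinh ((x i - x j) + t * (d i - d j)) ≠ 0 := by
    simp only [Filter.eventually_all]
    intro i j hij h1 h2
    refine eventually_sinh_ne_zero _ _ (Or.inr ?_)
    simp only [hd]
    split_ifs with h3 h4 h4
    · exact absurd (h3.trans h4.symm) hij
    · exact hinj _ _ fun h => h2 ⟨h3, h.symm⟩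
    · exact hinj _ _ fun h => h1 ⟨h, h4⟩
    · exact hinj _ _ hij
  filter_upwards [h1] with t ht
  refine h _ ⟨?_, fun i j hij h1 h2 => ?_⟩
  · have : (x + t • d) a - (x + t • d) b = x a - x b := by simp [hd]
    rw [this, hx]
  · convert ht i j hij h1 h2 using 2
    simp; ring

/-- The exponent of `α` modulo `2 (e_a - e_b)`. -/
def pairRep (a b : Fin n) (α : Fin n → ℤ) : Fin n → ℤ :=
  α + (2 * (α b / 2)) • (Pi.single a 1 - Pi.single b 1)

theorem trigChar_smul_sub (a b : Fin n) (q : ℤ) (x : Fin n → ℂ) :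
    trigChar ((2 * q) • (Pi.single a 1 - Pi.single b 1)) x =
      Complex.exp (2 * (x a - x b)) ^ q := by
  rw [← Complex.exp_int_mul, trigChar]
  congr 1
  have : ∀ i, ((((2 * q) • (Pi.single a 1 - Pi.single b 1 : Fin n → ℤ)) i : ℤ) : ℂ) * x i =
      2 * q * ((Pi.single a (x a) : Fin n → ℂ) i - (Pi.single b (x b) : Fin n → ℂ) i) := by
    intro i
    simp only [Pi.smul_apply, Pi.sub_apply, Pi.single_apply, smul_eq_mul]
    push_cast
    split_ifs with h1 h2 h2
    · subst h1; subst h2; simp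
    all_goals simp [*]
  simp only [this, ← Finset.mul_sum, Finset.sum_sub_distrib, Finset.sum_pi_single',
    Finset.mem_univ, if_true]
  ring

theorem pairRep_apply_right {a b : Fin n} (hab : a ≠ b) (α : Fin n → ℤ) :
    pairRep a b α b = 0 ∨ pairRep a b α b = 1 := by
  have : pairRep a b α b = α b % 2 := by
    simp [pairRep, hab.symm]; omega
  rw [this]; exact Int.emod_two_eq_zero_or_one _

theorem trigChar_update (γ : Fin n → ℤ) (b : Fin n) (x : Fin n → ℂ) (t : ℂ) :
    trigChar γ (Function.update x b t) =
      trigChar (Function.update γ b 0) x * Complex.exp (γ b * t) := by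
  rw [trigChar, trigChar, ← Complex.exp_add]
  congr 1
  rw [← Finset.add_sum_erase _ _ (Finset.mem_univ b), ← Finset.add_sum_erase _ _
    (Finset.mem_univ b), Function.update_self, Function.update_self, add_comm]
  simp only [Int.cast_zero, zero_mul, zero_add]
  congr 1
  refine Finset.sum_congr rfl fun i hi => ?_
  rw [Function.update_of_ne (Finset.ne_of_mem_erase hi),
    Function.update_of_ne (Finset.ne_of_mem_erase hi)]

/-- The quantity e^{2y} - 1 = 2 e^y sinh y shows that e^{2y} is 1 modulo sinh y, and so are its
integer powers. Hence characters may be reduced modulo 2(e_a - e_b). -/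
theorem exp_zpow_sub_one_mem (a b : Fin n) (q : ℤ) : ∃ r ∈ trigAlg n, ∀ x ν : Fin n → ℂ,
    Complex.exp (2 * (x a - x b)) ^ q - 1 = Complex.sinh (x a - x b) * r x ν := by
  have h1 : (fun x _ => Complex.exp (x a - x b)) ∈ trigAlg n := by
    convert (trigAlg n).mul_mem (exp_int_mem_trigAlg 1 a) (exp_int_mem_trigAlg (-1) b) using 1
    funext x ν
    simp [← Complex.exp_add, sub_eq_add_neg]
  have h2 : (fun x _ => Complex.exp (-(x a - x b))) ∈ trigAlg n := by
    convert (trigAlg n).mul_mem (exp_int_mem_trigAlg (-1) a) (exp_int_mem_trigAlg 1 b) using 1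
    funext x ν
    simp only [Pi.mul_apply, ← Complex.exp_add]
    congr 1; push_cast; ring
  have h3 : ∀ x : Fin n → ℂ, Complex.exp (2 * (x a - x b)) =
      1 + 2 * Complex.exp (x a - x b) * Complex.sinh (x a - x b) := by
    intro x
    rw [Complex.sinh, two_mul, Complex.exp_add, Complex.exp_neg]
    field_simp
    ring
  have h4 : ∀ x : Fin n → ℂ, (Complex.exp (2 * (x a - x b)))⁻¹ =
      1 - 2 * Complex.exp (-(x a - x b)) * Complex.sinh (x a - x b) := by
    intro x
    rw [← Complex.exp_neg, Complex.sinh, two_mul, neg_add, Complex.exp_add, Complex.exp_neg]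
    field_simp
    ring
  induction q with
  | zero => exact ⟨0, (trigAlg n).zero_mem, fun x ν => by simp⟩
  | succ q ih =>
    obtain ⟨r, hr, h⟩ := ih
    refine ⟨_, (trigAlg n).add_mem hr ((trigAlg n).mul_mem ((trigAlg n).smul_mem h1 (2 : ℂ))
      ((trigAlg n).add_mem (trigAlg n).one_mem ((trigAlg n).mul_mem hr
        (sinh_mem_trigAlg a b)))), fun x ν => ?_⟩
    rw [zpow_add₀ (Complex.exp_ne_zero _), zpow_one, show ∀ z w : ℂ, z * w - 1 = (z - 1) +
      (1 + (z - 1)) * (w - 1) from fun z w => by ring, h x ν, h3]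
    simp
    ring
  | pred q ih =>
    obtain ⟨r, hr, h⟩ := ih
    refine ⟨_, (trigAlg n).sub_mem hr ((trigAlg n).mul_mem ((trigAlg n).smul_mem h2 (2 : ℂ))
      ((trigAlg n).add_mem (trigAlg n).one_mem ((trigAlg n).mul_mem hr
        (sinh_mem_trigAlg a b)))), fun x ν => ?_⟩
    rw [zpow_sub₀ (Complex.exp_ne_zero _), zpow_one, div_eq_mul_inv,
      show ∀ z w : ℂ, z * w - 1 = (z - 1) +
      (1 + (z - 1)) * (w - 1) from fun z w => by ring, h x ν, h4]
    simp
    ring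

/-- A trigonometric polynomial which vanishes on the zeros of `sinh (x_a - x_b)` is divisible
by `sinh (x_a - x_b)`. -/
theorem TrigPoly.exists_eq_sinh_mul (Q : TrigPoly n) {a b : Fin n} (hab : a ≠ b)
    (h : ∀ x, Complex.sinh (x a - x b) = 0 → ∀ ν, Q.ev x ν = 0) :
    ∃ R : TrigPoly n, ∀ x ν, Q.ev x ν = Complex.sinh (x a - x b) * R.ev x ν := by
  choose r hr hq using fun α : Fin n → ℤ => exp_zpow_sub_one_mem a b (-(α b / 2))
  have h1 : ∀ α x ν, trigChar α x = trigChar (pairRep a b α) x +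
      Complex.sinh (x a - x b) * (trigChar (pairRep a b α) x * r α x ν) := by
    intro α x ν
    have : trigChar α x = trigChar (pairRep a b α) x *
        Complex.exp (2 * (x a - x b)) ^ (-(α b / 2)) := by
      rw [← trigChar_smul_sub, ← trigChar_add]
      congr 1
      rw [pairRep, add_assoc, ← add_smul]; simp
    rw [this, ← sub_eq_iff_eq_add', mul_left_comm, ← hq α x ν]; ring
  -- The reduced exponents are 0 or 1 at b, so along x_b = t the reduced sum is S₀ + S₁ e^t. Its
  -- vanishing at t = x_a and t = x_a + πi gives S₀ = S₁ = 0: the remainder of the division vanishes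
  -- identically.
  have hS : ∀ x ν, ∑ α ∈ Q.support, trigChar (pairRep a b α) x * MvPolynomial.eval ν (Q α) = 0 := by
    intro x ν
    have h2 : ∀ y, Complex.sinh (y a - y b) = 0 →
        ∑ α ∈ Q.support, trigChar (pairRep a b α) y * MvPolynomial.eval ν (Q α) = 0 := by
      intro y hy
      rw [← h y hy ν, TrigPoly.ev_eq_sum]
      refine Finset.sum_congr rfl fun α _ => ?_
      rw [h1 α y ν, hy]; ring
    set g : (Fin n → ℤ) → ℂ := fun α =>
      trigChar (Function.update (pairRep a b α) b 0) x * MvPolynomial.eval ν (Q α) with hg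
    set S₀ := ∑ α ∈ Q.support, if pairRep a b α b = 0 then g α else 0 with hS₀
    set S₁ := ∑ α ∈ Q.support, if pairRep a b α b = 0 then 0 else g α with hS₁
    have h3 : ∀ t, ∑ α ∈ Q.support, trigChar (pairRep a b α) (Function.update x b t) *
        MvPolynomial.eval ν (Q α) = S₀ + S₁ * Complex.exp t := by
      intro t
      rw [hS₀, hS₁, Finset.sum_mul, ← Finset.sum_add_distrib]
      refine Finset.sum_congr rfl fun α _ => ?_
      rw [trigChar_update]
      rcases pairRep_apply_right hab α with h4 | h4 <;> simp [h4, hg]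
      ring
    have h5 := h2 (Function.update x b (x a)) (by simp [hab])
    have h6 := h2 (Function.update x b (x a + π * Complex.I))
      (by simp [hab, Complex.sinh_mul_I])
    rw [h3] at h5 h6
    rw [Complex.exp_add, Complex.exp_pi_mul_I] at h6
    have h7 : S₁ = 0 := by
      have : 2 * (S₁ * Complex.exp (x a)) = 0 := by linear_combination h5 - h6
      simpa [Complex.exp_ne_zero] using this
    have h8 : S₀ = 0 := by rw [h7, zero_mul, add_zero] at h5; exact h5
    have h9 := h3 (x b)
    rw [Function.update_eq_self, h7, h8] at h9
    rw [h9]; ring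
  have hmem : (fun x ν => ∑ α ∈ Q.support, trigChar (pairRep a b α) x * r α x ν *
      MvPolynomial.eval ν (Q α)) ∈ trigAlg n := by
    have := (trigAlg n).sum_mem (t := Q.support) fun α _ => (trigAlg n).mul_mem
      ((trigAlg n).mul_mem (trigChar_mem_trigAlg (pairRep a b α)) (hr α)) (eval_mem_trigAlg (Q α))
    convert this using 1
    funext x ν
    simp [Finset.sum_apply]
  obtain ⟨R, hR⟩ := hmem
  refine ⟨R, fun x ν => ?_⟩
  have h2 : Q.ev x ν = ∑ α ∈ Q.support, trigChar (pairRep a b α) x * MvPolynomial.eval ν (Q α) +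
      Complex.sinh (x a - x b) * ∑ α ∈ Q.support, trigChar (pairRep a b α) x * r α x ν *
        MvPolynomial.eval ν (Q α) := by
    rw [TrigPoly.ev_eq_sum, Finset.mul_sum, ← Finset.sum_add_distrib]
    refine Finset.sum_congr rfl fun α _ => ?_
    rw [h1 α x ν]; ring
  rw [h2, hS, zero_add, ← hR]

/-- A trigonometric polynomial which vanishes at generic zeros of `B` is divisible by `B`. -/
theorem TrigPoly.exists_eq_prodSinh_mul (Q : TrigPoly n)
    (h : ∀ a b : Fin n, a ≠ b → ∀ x, IsWall a b x → ∀ ν, Q.ev x ν = 0) :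
    ∃ R : TrigPoly n, ∀ x ν, Q.ev x ν = prodSinh x * R.ev x ν := by
  have key : ∀ T : Finset (Σ _ : Fin n, Fin n), (∀ p ∈ T, p.1 < p.2) → ∃ R : TrigPoly n,
      ∀ x ν, Q.ev x ν = (∏ p ∈ T, Complex.sinh (x p.1 - x p.2)) * R.ev x ν := by
    intro T
    induction T using Finset.induction_on with
    | empty => exact fun _ => ⟨Q, fun x ν => by simp⟩
    | insert p T hp ih =>
      intro hT
      obtain ⟨R, hR⟩ := ih fun q hq => hT q (Finset.mem_insert_of_mem hq)
      have hp' := hT p (Finset.mem_insert_self _ _)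
      -- At generic points of the new wall the factors already removed are non-zero, so the quotient
      -- vanishes there, and by density on the whole zero set.
      obtain ⟨R', hR'⟩ := R.exists_eq_sinh_mul hp'.ne fun x hx ν => by
        refine eq_zero_of_wall (R.continuous_ev ν) (fun y hy => ?_) hx
        have h1 := h p.1 p.2 hp'.ne y hy ν
        rw [hR] at h1
        refine (mul_eq_zero.1 h1).resolve_left (Finset.prod_ne_zero_iff.2 fun q hq => ?_)
        have hq' := hT q (Finset.mem_insert_of_mem hq)
        refine hy.2 _ _ hq'.ne (fun h => hp ?_) fun h => ?_
        · have : q = p := Sigma.ext h.1 (heq_of_eq h.2)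
          exact this ▸ hq
        · rw [h.1, h.2] at hq'; exact absurd hq' (not_lt.2 hp'.le)
      refine ⟨R', fun x ν => ?_⟩
      rw [hR, hR', Finset.prod_insert hp]; ring
  obtain ⟨R, hR⟩ := key (Finset.univ.sigma fun i => Finset.Ioi i) fun p hp => by simpa using hp
  refine ⟨R, fun x ν => ?_⟩
  rw [hR, Finset.prod_sigma, prodSinh]

end division

/-! ### Pole orders along the walls -/

section poleReduction
variable {n : ℕ}

/-- Near a generic point of the wall only the coth of the pair a, b has a pole, and it is simple. -/
theorem tendsto_sinh_mul_cothDiff {a b : Fin n} (hab : a ≠ b) {x : Fin n → ℂ} (hx : IsWall a b x)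
    (i j : Fin n) :
    Filter.Tendsto (fun t : ℂ => Complex.sinh (x a + t - x b) *
      cothDiff ((x + t • (Pi.single a 1 : Fin n → ℂ)) i) ((x + t • (Pi.single a 1 : Fin n → ℂ)) j))
      (nhdsWithin 0 {0}ᶜ) (nhds ((if i = a then if j = b then Complex.cosh (x a - x b) else 0
        else 0) + (if i = b then if j = a then -Complex.cosh (x a - x b) else 0 else 0))) := by
  have hne : ∀ᶠ t : ℂ in nhdsWithin 0 {0}ᶜ, Complex.sinh (x a + t - x b) ≠ 0 := by
    filter_upwards [eventually_sinh_ne_zero (x a - x b) 1 (Or.inr one_ne_zero)] with t ht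
    convert ht using 2; ring
  have hc : Filter.Tendsto (fun t : ℂ => Complex.cosh (x a + t - x b))
      (nhdsWithin 0 {0}ᶜ) (nhds (Complex.cosh (x a - x b))) := by
    have : Continuous (fun t : ℂ => Complex.cosh (x a + t - x b)) := by fun_prop
    have := this.tendsto 0
    rw [add_zero] at this
    exact this.mono_left nhdsWithin_le_nhds
  by_cases h1 : i = a ∧ j = b
  · obtain ⟨rfl, rfl⟩ := h1
    simp only [if_true, hab, if_false, add_zero]
    refine hc.congr' ?_
    filter_upwards [hne] with t ht
    rw [cothDiff_eq]
    simp only [Pi.add_apply, Pi.smul_apply, Pi.single_eq_same, Pi.single_eq_of_ne hab.symm,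
      smul_eq_mul, mul_one, mul_zero, add_zero]
    field_simp
  by_cases h2 : i = b ∧ j = a
  · obtain ⟨rfl, rfl⟩ := h2
    simp only [if_true, hab.symm, if_false, zero_add]
    refine hc.neg.congr' ?_
    filter_upwards [hne] with t ht
    rw [cothDiff_comm, cothDiff_eq]
    simp only [Pi.add_apply, Pi.smul_apply, Pi.single_eq_same, Pi.single_eq_of_ne hab.symm,
      smul_eq_mul, mul_one, mul_zero, add_zero]
    field_simp
  have h0 : ((if i = a then if j = b then Complex.cosh (x a - x b) else 0
        else 0) + (if i = b then if j = a then -Complex.cosh (x a - x b) else 0 else 0)) = 0 := by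
    rw [← ite_and, ← ite_and, if_neg h1, if_neg h2, add_zero]
  rw [h0]
  by_cases hij : i = j
  · subst hij; simp only [cothDiff_self, mul_zero]; exact tendsto_const_nhds
  have h3 := hx.2 i j hij h1 h2
  have h4 : ContinuousAt (fun t : ℂ => Complex.sinh (x a + t - x b) *
      cothDiff ((x + t • (Pi.single a 1 : Fin n → ℂ)) i) ((x + t • (Pi.single a 1 : Fin n → ℂ)) j)) 0 := by
    simp only [cothDiff_eq]
    refine ContinuousAt.mul (by fun_prop) (ContinuousAt.div ?_ ?_ (by simpa using h3)) <;>
    · simp only [Pi.add_apply, Pi.smul_apply]; fun_prop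
  have h5 := h4.tendsto
  simp only [add_zero, hx.1, zero_mul] at h5
  exact h5.mono_left nhdsWithin_le_nhds

/-- Follows from the limit for coth by 1/sinh² = coth² - 1 for distinct indices. -/
theorem tendsto_sinh_sq_mul_cschSqDiff {a b : Fin n} (hab : a ≠ b) {x : Fin n → ℂ}
    (hx : IsWall a b x) (i j : Fin n) :
    Filter.Tendsto (fun t : ℂ => Complex.sinh (x a + t - x b) ^ 2 *
      cschSqDiff ((x + t • (Pi.single a 1 : Fin n → ℂ)) i) ((x + t • (Pi.single a 1 : Fin n → ℂ)) j))
      (nhdsWithin 0 {0}ᶜ) (nhds ((if i = a then if j = b then 1 else 0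
        else 0) + (if i = b then if j = a then 1 else 0 else 0))) := by
  have hS : Filter.Tendsto (fun t : ℂ => Complex.sinh (x a + t - x b))
      (nhdsWithin 0 {0}ᶜ) (nhds 0) := by
    have : Continuous (fun t : ℂ => Complex.sinh (x a + t - x b)) := by fun_prop
    have := this.tendsto 0
    rw [add_zero, hx.1] at this
    exact this.mono_left nhdsWithin_le_nhds
  have hC : Complex.cosh (x a - x b) ^ 2 = 1 := by
    rw [Complex.cosh_sq, hx.1]; ring
  by_cases hij : i = j
  · subst hij
    have : ((if i = a then if i = b then (1 : ℂ) else 0 else 0) +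
        (if i = b then if i = a then 1 else 0 else 0)) = 0 := by
      split_ifs with h1 h2 h2
      · exact absurd (h1.symm.trans h2) hab
      all_goals simp
    simp only [this, cschSqDiff_self, mul_zero]; exact tendsto_const_nhds
  have h1 := ((tendsto_sinh_mul_cothDiff hab hx i j).pow 2).sub (hS.pow 2)
  have hlim : ((if i = a then if j = b then Complex.cosh (x a - x b) else 0
        else 0) + (if i = b then if j = a then -Complex.cosh (x a - x b) else 0 else 0)) ^ 2 -
        0 ^ 2 = ((if i = a then if j = b then 1 else 0
        else 0) + (if i = b then if j = a then 1 else 0 else 0)) := by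
    by_cases hia : i = a
    · have hib : i ≠ b := fun h => hab (hia.symm.trans h)
      simp only [hia, if_true, hab, if_false]
      split_ifs <;> simp [hC]
    · simp only [hia, if_false]
      split_ifs <;> simp [hC]
  rw [hlim] at h1
  refine h1.congr' ?_
  have hsep : ∀ᶠ t : ℂ in nhdsWithin 0 {0}ᶜ,
      Complex.sinh ((x + t • (Pi.single a 1 : Fin n → ℂ)) i - (x + t • (Pi.single a 1 : Fin n → ℂ)) j) ≠ 0 := by
    have : ∀ᶠ t : ℂ in nhdsWithin 0 {0}ᶜ, Complex.sinh ((x i - x j) +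
        t * ((Pi.single a 1 : Fin n → ℂ) i - (Pi.single a 1 : Fin n → ℂ) j)) ≠ 0 := by
      refine eventually_sinh_ne_zero _ _ ?_
      by_cases h1 : i = a ∧ j = b
      · right; simp [h1.1, h1.2, hab]
      by_cases h2 : i = b ∧ j = a
      · right; simp [h2.1, h2.2, hab]
      · exact Or.inl (hx.2 i j hij h1 h2)
    filter_upwards [this] with t ht
    convert ht using 2
    simp; ring
  filter_upwards [hsep] with t ht
  rw [mul_pow, cothDiff_sq ((exp_two_ne_iff _ _).2 ht)]
  ring

/-- The limit is twice the indicial polynomial: the indices a and b contribute s² each, since cosh²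
= 1 on the wall, and the potential term contributes 2(s - m(m + 1)). -/
theorem tendsto_sinh_sq_mul_gaugeSymbol (m s : ℕ) {a b : Fin n} (hab : a ≠ b) {x : Fin n → ℂ}
    (hx : IsWall a b x) (ν : Fin n → ℂ) (α : Fin n → ℤ) :
    Filter.Tendsto (fun t : ℂ => Complex.sinh (x a + t - x b) ^ 2 *
      gaugeSymbol m s ν (x + t • (Pi.single a 1 : Fin n → ℂ)) α)
      (nhdsWithin 0 {0}ᶜ) (nhds (2 * ((s : ℂ) ^ 2 + s - m * (m + 1)))) := by
  have hS : Filter.Tendsto (fun t : ℂ => Complex.sinh (x a + t - x b))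
      (nhdsWithin 0 {0}ᶜ) (nhds 0) := by
    have : Continuous (fun t : ℂ => Complex.sinh (x a + t - x b)) := by fun_prop
    have := this.tendsto 0
    rw [add_zero, hx.1] at this
    exact this.mono_left nhdsWithin_le_nhds
  have hC : Complex.cosh (x a - x b) ^ 2 = 1 := by
    rw [Complex.cosh_sq, hx.1]; ring
  have h1 := tendsto_finsetSum Finset.univ fun i _ =>
    ((hS.mul_const ((α i : ℂ) + 2 * ν i)).sub ((tendsto_finsetSum Finset.univ fun j _ =>
      tendsto_sinh_mul_cothDiff hab hx i j).const_mul (s : ℂ))).pow 2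
  have h2 := (tendsto_finsetSum Finset.univ fun i _ => tendsto_finsetSum Finset.univ fun j _ =>
      tendsto_sinh_sq_mul_cschSqDiff hab hx i j).const_mul ((s : ℂ) - m * (m + 1))
  have h3 := (hS.pow 2).mul_const (4 * ∑ i, ν i ^ 2)
  have h4 := (h1.add h2).sub h3
  refine (h4.congr fun t => ?_).trans_eq ?_
  · simp only [gaugeSymbol, ← Finset.mul_sum]
    generalize (s : ℂ) - m * (m + 1) = c
    rw [mul_sub, mul_add, mul_left_comm _ c]
    congr 2
    rw [Finset.mul_sum]
    exact Finset.sum_congr rfl fun i _ => by ring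
  · congr 1
    have h5 : ∀ i, (0 * ((α i : ℂ) + 2 * ν i) - s * ∑ j,
        ((if i = a then if j = b then Complex.cosh (x a - x b) else 0
        else 0) + (if i = b then if j = a then -Complex.cosh (x a - x b) else 0 else 0))) ^ 2 =
        (if i = a then (s : ℂ) ^ 2 else 0) + (if i = b then (s : ℂ) ^ 2 else 0) := by
      intro i
      have : ∑ j, ((if i = a then if j = b then Complex.cosh (x a - x b) else 0
        else 0) + (if i = b then if j = a then -Complex.cosh (x a - x b) else 0 else 0)) =
        (if i = a then Complex.cosh (x a - x b) else 0) +
          (if i = b then -Complex.cosh (x a - x b) else 0) := by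
        rw [Finset.sum_add_distrib]
        split_ifs <;> simp
      rw [this]
      by_cases hia : i = a
      · simp only [hia, if_true, hab, if_false]
        linear_combination (s : ℂ) ^ 2 * hC
      · by_cases hib : i = b
        · simp only [hib, if_true, hab.symm, if_false]
          linear_combination (s : ℂ) ^ 2 * hC
        · simp [hia, hib]
    have h6 : ∀ i, ∑ j, ((if i = a then if j = b then (1 : ℂ) else 0
        else 0) + (if i = b then if j = a then 1 else 0 else 0)) =
        (if i = a then 1 else 0) + (if i = b then 1 else 0) := by
      intro i
      rw [Finset.sum_add_distrib]
      split_ifs <;> simp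
    simp only [h5, h6]
    simp only [Finset.sum_add_distrib, Finset.sum_ite_eq', Finset.mem_univ, if_true]
    ring

/-- The numerator of an eigenfunction with a pole of order `s > m` along the walls vanishes
there. -/
theorem TrigPoly.ev_eq_zero_of_isWall {m s : ℕ} (hs : m < s) {Q : TrigPoly n} {ν : Fin n → ℂ}
    (hQ : ∀ x, prodSinh x ≠ 0 →
      sutherlandOp n m (fun y => Q.ev y ν / prodSinh y ^ s * Complex.exp (2 * ∑ i, ν i * y i)) x =
      -4 * (∑ i, ν i ^ 2) * (Q.ev x ν / prodSinh x ^ s * Complex.exp (2 * ∑ i, ν i * x i)))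
    {a b : Fin n} (hab : a ≠ b) {x : Fin n → ℂ} (hx : IsWall a b x) : Q.ev x ν = 0 := by
  set y : ℂ → Fin n → ℂ := fun t => x + t • Pi.single a 1 with hy
  have h0 : ∀ z, prodSinh z ≠ 0 →
      (Q.sum fun α p => trigChar α z * MvPolynomial.eval ν p * gaugeSymbol m s ν z α) = 0 := by
    intro z hz
    rw [← sutherlandOp_eigen_iff m s Q one_ne_zero ν z hz]
    simpa only [mul_one] using hQ z hz
  have hsep : ∀ᶠ t : ℂ in nhdsWithin 0 {0}ᶜ, prodSinh (y t) ≠ 0 := by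
    have h1 : ∀ᶠ t : ℂ in nhdsWithin 0 {0}ᶜ, ∀ i j, i ≠ j → Complex.sinh ((x i - x j) +
        t * ((Pi.single a 1 : Fin n → ℂ) i - (Pi.single a 1 : Fin n → ℂ) j)) ≠ 0 := by
      simp only [Filter.eventually_all]
      intro i j hij
      refine eventually_sinh_ne_zero _ _ ?_
      by_cases h1 : i = a ∧ j = b
      · right; simp [h1.1, h1.2, hab]
      by_cases h2 : i = b ∧ j = a
      · right; simp [h2.1, h2.2, hab]
      · exact Or.inl (hx.2 i j hij h1 h2)
    filter_upwards [h1] with t ht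
    refine prodSinh_ne_zero_iff.2 fun i j hij => ?_
    convert ht i j hij using 2
    simp [hy]; ring
  have hchar : ∀ α, Filter.Tendsto (fun t : ℂ => trigChar α (y t) * MvPolynomial.eval ν (Q α))
      (nhdsWithin 0 {0}ᶜ) (nhds (trigChar α x * MvPolynomial.eval ν (Q α))) := by
    intro α
    have h1 : Continuous (fun t : ℂ => trigChar α (y t) * MvPolynomial.eval ν (Q α)) :=
      ((continuous_trigChar α).comp (by simp only [hy]; fun_prop)).mul continuous_const
    have h2 := h1.tendsto 0
    simp only [hy, zero_smul, add_zero] at h2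
    exact h2.mono_left nhdsWithin_le_nhds
  -- The limit of sinh² does not depend on α, so the equation multiplied by sinh² becomes Q times
  -- the indicial polynomial on the wall.
  have hlim := tendsto_finsetSum Q.support fun α _ =>
    (hchar α).mul (tendsto_sinh_sq_mul_gaugeSymbol m s hab hx ν α)
  rw [← Finset.sum_mul, ← TrigPoly.ev_eq_sum] at hlim
  have hzero : ∀ᶠ t : ℂ in nhdsWithin 0 {0}ᶜ, ∑ α ∈ Q.support, trigChar α (y t) *
      MvPolynomial.eval ν (Q α) * (Complex.sinh (x a + t - x b) ^ 2 *
        gaugeSymbol m s ν (y t) α) = 0 := by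
    filter_upwards [hsep] with t ht
    have h1 := h0 _ ht
    rw [Finsupp.sum] at h1
    rw [← mul_zero (Complex.sinh (x a + t - x b) ^ 2), ← h1, Finset.mul_sum]
    exact Finset.sum_congr rfl fun α _ => by ring
  have h2 := tendsto_nhds_unique ((Filter.tendsto_congr' hzero).1 hlim) tendsto_const_nhds
  refine (mul_eq_zero.1 h2).resolve_right ?_
  -- The roots of the indicial polynomial are m and -m - 1; neither equals s > m.
  have h3 : 2 * ((s : ℂ) ^ 2 + s - m * (m + 1)) = 2 * (((s : ℂ) - m) * ((s + m + 1 : ℕ) : ℂ)) := by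
    push_cast; ring
  rw [h3]
  refine mul_ne_zero two_ne_zero (mul_ne_zero (sub_ne_zero.2 ?_) ?_)
  · exact_mod_cast hs.ne'
  · exact Nat.cast_ne_zero.2 (Nat.succ_ne_zero _)

/-- As long as the pole order exceeds m, the numerator vanishes on the walls and is divisible by B.
Cancelling B preserves the equation, so the order descends to m. -/
theorem TrigPoly.exists_reduce {m s : ℕ} (hs : m ≤ s) {Q : TrigPoly n}
    (hQ : ∀ ν, normConst m ν ≠ 0 → ∀ x, prodSinh x ≠ 0 →
      sutherlandOp n m (fun y => Q.ev y ν / prodSinh y ^ s * Complex.exp (2 * ∑ i, ν i * y i)) x =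
      -4 * (∑ i, ν i ^ 2) * (Q.ev x ν / prodSinh x ^ s * Complex.exp (2 * ∑ i, ν i * x i))) :
    ∃ R : TrigPoly n, ∀ x, prodSinh x ≠ 0 → ∀ ν,
      Q.ev x ν / prodSinh x ^ s = R.ev x ν / prodSinh x ^ m := by
  obtain ⟨t, rfl⟩ := Nat.exists_eq_add_of_le hs
  clear hs
  induction t generalizing Q with
  | zero => exact ⟨Q, fun x _ ν => rfl⟩
  | succ t ih =>
    obtain ⟨R, hR⟩ := Q.exists_eq_prodSinh_mul fun a b hab x hx ν => by
      -- The equation is available only for C_m(ν) ≠ 0; being polynomial in ν, the numerator then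
      -- vanishes for every ν.
      have : Q.polyAt x = 0 := by
        refine eq_zero_of_normConst_ne_zero m _ fun ν hν => ?_
        exact TrigPoly.ev_eq_zero_of_isWall (s := m + (t + 1)) (by omega) (hQ ν hν) hab hx
      rw [TrigPoly.ev, this, map_zero]
    have h1 : ∀ x, ∀ ν, Q.ev x ν / prodSinh x ^ (m + (t + 1)) * prodSinh x =
        R.ev x ν / prodSinh x ^ (m + t) * prodSinh x := by
      intro x ν
      by_cases hx : prodSinh x = 0
      · simp [hx]
      · rw [hR, ← add_assoc, pow_succ]; field_simp
    have h2 : ∀ x, prodSinh x ≠ 0 → ∀ ν, Q.ev x ν / prodSinh x ^ (m + (t + 1)) =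
        R.ev x ν / prodSinh x ^ (m + t) := fun x hx ν => mul_right_cancel₀ hx (h1 x ν)
    obtain ⟨R', hR'⟩ := ih (Q := R) fun ν hν x hx => by
      have h3 := hQ ν hν x hx
      rw [h2 x hx] at h3
      rw [← h3]
      refine sutherlandOp_congr m ?_
      filter_upwards [(continuous_prodSinh.continuousAt (x := x)).eventually_ne hx] with y hy
      rw [h2 y hy]
    exact ⟨R', fun x hx ν => (h2 x hx ν).trans (hR' x hx ν)⟩

end poleReduction

/-! ### Leading homogeneous parts -/

section topForm
open MvPolynomial
variable {σ : Type*}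

/-- All monomials of `p` have degree less than `d`. -/
def DegLT (d : ℕ) (p : MvPolynomial σ ℂ) : Prop :=
  ∀ κ : σ →₀ ℕ, d ≤ κ.degree → coeff κ p = 0

theorem DegLT.mono {d e : ℕ} (h : d ≤ e) {p : MvPolynomial σ ℂ} (hp : DegLT d p) : DegLT e p :=
  fun κ hκ => hp κ (h.trans hκ)

theorem DegLT.zero (d : ℕ) : DegLT d (0 : MvPolynomial σ ℂ) := fun _ _ => coeff_zero _

theorem DegLT.add {d : ℕ} {p q : MvPolynomial σ ℂ} (hp : DegLT d p) (hq : DegLT d q) :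
    DegLT d (p + q) := fun κ hκ => by rw [coeff_add, hp κ hκ, hq κ hκ, add_zero]

theorem DegLT.sum {ι : Type*} {d : ℕ} (s : Finset ι) {p : ι → MvPolynomial σ ℂ}
    (hp : ∀ a ∈ s, DegLT d (p a)) : DegLT d (∑ a ∈ s, p a) := fun κ hκ => by
  rw [coeff_sum]; exact Finset.sum_eq_zero fun a ha => hp a ha κ hκ

theorem DegLT.mul {d e : ℕ} {p q : MvPolynomial σ ℂ} (hp : DegLT d p) (hq : DegLT (e + 1) q) :
    DegLT (d + e) (p * q) := fun κ hκ => by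
  classical
  rw [coeff_mul]
  refine Finset.sum_eq_zero fun x hx => ?_
  rw [Finset.HasAntidiagonal.mem_antidiagonal] at hx
  by_cases h : d ≤ x.1.degree
  · rw [hp _ h, zero_mul]
  · rw [hq, mul_zero]
    have : x.1.degree + x.2.degree = κ.degree := by rw [← hx, map_add]
    omega

theorem degLT_of_isHomogeneous {d : ℕ} {q : MvPolynomial σ ℂ} (hq : q.IsHomogeneous d) :
    DegLT (d + 1) q := fun _ hκ => hq.coeff_eq_zero (by omega)

theorem totalDegree_le_of_degLT {d : ℕ} {p : MvPolynomial σ ℂ} (hp : DegLT (d + 1) p) :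
    p.totalDegree ≤ d := by
  refine Finset.sup_le fun κ hκ => ?_
  by_contra! h
  exact mem_support_iff.1 hκ (hp κ h)

theorem degLT_of_totalDegree_le {d : ℕ} {p : MvPolynomial σ ℂ} (hp : p.totalDegree ≤ d) :
    DegLT (d + 1) p := fun κ hκ => by
  by_contra h
  have : κ.degree ≤ p.totalDegree := le_totalDegree (mem_support_iff.2 h)
  omega

/-- `q` is the homogeneous part of degree `d` of `p`, and `p` has no terms of higher degree. -/
def HasTopForm (d : ℕ) (p q : MvPolynomial σ ℂ) : Prop := q.IsHomogeneous d ∧ DegLT d (p - q)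

theorem HasTopForm.degLT {d : ℕ} {p q : MvPolynomial σ ℂ} (h : HasTopForm d p q) :
    DegLT (d + 1) p := by
  have := (h.2.mono (Nat.le_succ d)).add (degLT_of_isHomogeneous h.1)
  rwa [sub_add_cancel] at this

theorem HasTopForm.homogeneousComponent_eq {d : ℕ} {p q : MvPolynomial σ ℂ}
    (h : HasTopForm d p q) : homogeneousComponent d p = q := by
  ext κ
  rw [coeff_homogeneousComponent]
  split_ifs with hκ
  · have := h.2 κ hκ.ge
    rwa [coeff_sub, sub_eq_zero] at this
  · rw [h.1.coeff_eq_zero hκ]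

theorem hasTopForm_homogeneousComponent {d : ℕ} {p : MvPolynomial σ ℂ} (hp : DegLT (d + 1) p) :
    HasTopForm d p (homogeneousComponent d p) := by
  refine ⟨homogeneousComponent_isHomogeneous d p, fun κ hκ => ?_⟩
  rw [coeff_sub, coeff_homogeneousComponent]
  split_ifs with h
  · exact sub_self _
  · rw [hp κ (by omega), sub_zero]

/-- Uses p p' - q q' = (p - q) p' + (p' - q') q. -/
theorem HasTopForm.mul {d e : ℕ} {p q p' q' : MvPolynomial σ ℂ} (h : HasTopForm d p q)
    (h' : HasTopForm e p' q') : HasTopForm (d + e) (p * p') (q * q') := by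
  refine ⟨h.1.mul h'.1, ?_⟩
  have h1 := h.2.mul h'.degLT
  have h2 := h'.2.mul (degLT_of_isHomogeneous h.1)
  rw [add_comm e d] at h2
  have h3 := h1.add h2
  convert h3 using 1
  ring

theorem hasTopForm_C (c : ℂ) : HasTopForm 0 (C c : MvPolynomial σ ℂ) (C c) :=
  ⟨isHomogeneous_C σ c, by rw [sub_self]; exact DegLT.zero 0⟩

theorem HasTopForm.C_mul {d : ℕ} {p q : MvPolynomial σ ℂ} (h : HasTopForm d p q) (c : ℂ) :
    HasTopForm d (C c * p) (C c * q) := by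
  have := (hasTopForm_C c).mul h
  rwa [zero_add] at this

theorem HasTopForm.sum {ι : Type*} {d : ℕ} (s : Finset ι) {p q : ι → MvPolynomial σ ℂ}
    (h : ∀ a ∈ s, HasTopForm d (p a) (q a)) : HasTopForm d (∑ a ∈ s, p a) (∑ a ∈ s, q a) := by
  refine ⟨IsHomogeneous.sum _ _ _ fun a ha => (h a ha).1, ?_⟩
  rw [← Finset.sum_sub_distrib]
  exact DegLT.sum s fun a ha => (h a ha).2

theorem HasTopForm.add_degLT {d : ℕ} {p q r : MvPolynomial σ ℂ} (h : HasTopForm d p q)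
    (hr : DegLT d r) : HasTopForm d (r + p) q :=
  ⟨h.1, by rw [add_sub_assoc]; exact hr.add h.2⟩

theorem HasTopForm.prod {ι : Type*} (s : Finset ι) {d : ℕ} {p q : ι → MvPolynomial σ ℂ}
    (h : ∀ a ∈ s, HasTopForm d (p a) (q a)) :
    HasTopForm (s.card * d) (∏ a ∈ s, p a) (∏ a ∈ s, q a) := by
  classical
  induction s using Finset.induction_on with
  | empty => simpa using hasTopForm_C (σ := σ) 1
  | insert a s ha ih =>
    rw [Finset.prod_insert ha, Finset.prod_insert ha, Finset.card_insert_of_notMem ha, add_mul,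
      one_mul, add_comm]
    exact (h a (Finset.mem_insert_self _ _)).mul
      (ih fun b hb => h b (Finset.mem_insert_of_mem hb))

theorem hasTopForm_linear (i j : σ) (c : ℂ) :
    HasTopForm 1 (X i - X j + C c : MvPolynomial σ ℂ) (X i - X j) := by
  refine ⟨(isHomogeneous_X ℂ i).sub (isHomogeneous_X ℂ j), ?_⟩
  have h : DegLT 1 (C c : MvPolynomial σ ℂ) := (hasTopForm_C c).degLT
  convert h using 1
  ring

theorem HasTopForm.rename {τ : Type*} (f : σ → τ) {d : ℕ}
    {p q : MvPolynomial σ ℂ} (h : HasTopForm d p q) :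
    HasTopForm d (MvPolynomial.rename f p) (MvPolynomial.rename f q) := by
  refine ⟨h.1.rename_isHomogeneous, fun κ hκ => ?_⟩
  rw [← map_sub]
  by_contra hne
  obtain ⟨u, hu, hu'⟩ := coeff_rename_ne_zero f _ κ hne
  refine hu' (h.2 u ?_)
  rw [← hu] at hκ
  simpa [Finsupp.degree_mapDomain] using hκ

end topForm

/-! ### The residue as a polynomial in ν and its leading part -/

section residuePolynomial
open MvPolynomial
variable {k : ℕ}

/-- The factor of index `i` in the residue, as a polynomial in `ν`. -/
noncomputable def resFactor (m : ℕ) (x : Fin (k + 1) → ℂ) (i : Fin k) (b : ℤ) :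
    MvPolynomial (Fin (k + 1)) ℂ :=
  C (Complex.exp ((b + m * (k + 1)) * x i.castSucc) * (expTwo x i.castSucc ^ m)⁻¹ *
      (m.factorial : ℂ)⁻¹) *
    ∑ r ∈ Finset.range (m + 1), C (m.choose r *
      iteratedDeriv (m - r) (fun s => (sepProd (expTwo x) i.castSucc s ^ (m + 1))⁻¹) 1) *
      ∏ l ∈ Finset.range r, (X i.castSucc - X (Fin.last k) + C (((b : ℂ) + m * (k + 1)) / 2 - (l : ℂ)))

/-- The residue without its exponential factor, as a polynomial in `ν`. -/
noncomputable def resPoly (m : ℕ) (G : TrigPoly k) (x : Fin (k + 1) → ℂ) :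
    MvPolynomial (Fin (k + 1)) ℂ :=
  C (prodDiff (expTwo x) ^ (m + 1)) * ∑ β ∈ G.support,
    rename Fin.castSucc (G β) * ∏ i : Fin k, resFactor m x i (β i)

theorem sepProd_one_ne_zero {n : ℕ} {x : Fin n → ℂ} (hx : prodSinh x ≠ 0) (i : Fin n) :
    sepProd (expTwo x) i 1 ≠ 0 := by
  refine Finset.prod_ne_zero_iff.2 fun j hj => ?_
  rw [mul_one, sub_ne_zero]
  exact prodDiff_ne_zero_iff.1 (prodSinh_ne_zero_iff_expTwo.1 hx) _ _ (Finset.ne_of_mem_erase hj).symm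

theorem eval_resFactor (m : ℕ) {x : Fin (k + 1) → ℂ} (hx : prodSinh x ≠ 0)
    (ν : Fin (k + 1) → ℂ) (β : Fin k → ℤ) (i : Fin k) :
    Complex.exp (resExp m ν β i * x i.castSucc) * (expTwo x i.castSucc ^ m)⁻¹ *
      resCoef m (expTwo x) i.castSucc (resExp m ν β i / 2) =
    eval ν (resFactor m x i (β i)) *
      Complex.exp (2 * (ν i.castSucc - ν (Fin.last k)) * x i.castSucc) := by
  rw [resCoef_eq_sum m (sepProd_one_ne_zero hx _), resFactor, resExp, add_mul, Complex.exp_add]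
  simp only [map_mul, map_sum, map_prod, map_add, map_sub, eval_C, eval_X]
  have h : ∀ l : ℕ, ((β i + m * (k + 1) + 2 * (ν i.castSucc - ν (Fin.last k))) / 2 - l : ℂ) =
      ν i.castSucc - ν (Fin.last k) + ((β i + m * (k + 1)) / 2 - l) := fun l => by ring
  simp only [h]
  rw [div_eq_mul_inv, Finset.sum_congr rfl fun r _ => mul_right_comm (m.choose r : ℂ) _ _]
  ring

/-- The non-polynomial part e^{2(ν_i - ν_{k+1}) x_i} of each residue combines with e^{2ν_{k+1} ∑
x_i} to e^{2(ν,x)}. -/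
theorem resHat_eq (m : ℕ) (G : TrigPoly k) {x : Fin (k + 1) → ℂ} (hx : prodSinh x ≠ 0)
    (ν : Fin (k + 1) → ℂ) :
    resHat m G x ν = eval ν (resPoly m G x) * Complex.exp (2 * ∑ i, ν i * x i) := by
  have h1 : ∀ β, ∏ i : Fin k, (Complex.exp (resExp m ν β i * x i.castSucc) *
      (expTwo x i.castSucc ^ m)⁻¹ * resCoef m (expTwo x) i.castSucc (resExp m ν β i / 2)) =
      (∏ i : Fin k, eval ν (resFactor m x i (β i))) *
        Complex.exp (∑ i : Fin k, 2 * (ν i.castSucc - ν (Fin.last k)) * x i.castSucc) := by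
    intro β
    rw [Complex.exp_sum, ← Finset.prod_mul_distrib]
    exact Finset.prod_congr rfl fun i _ => eval_resFactor m hx ν β i
  have h2 : Complex.exp (2 * ∑ i, ν i * x i) = Complex.exp (2 * ν (Fin.last k) * ∑ i, x i) *
      Complex.exp (∑ i : Fin k, 2 * (ν i.castSucc - ν (Fin.last k)) * x i.castSucc) := by
    rw [← Complex.exp_add, Fin.sum_univ_castSucc, Fin.sum_univ_castSucc, mul_add, mul_add,
      Finset.mul_sum, Finset.mul_sum, add_right_comm, ← Finset.sum_add_distrib]
    congr 1
    rw [mul_assoc]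
    congr 1
    exact Finset.sum_congr rfl fun i _ => by ring
  rw [resHat, resSum, h2, resPoly]
  simp only [h1, map_mul, map_sum, map_prod, eval_C, eval_rename]
  generalize Complex.exp (2 * ν (Fin.last k) * ∑ i, x i) = e
  generalize Complex.exp (∑ i : Fin k, 2 * (ν i.castSucc - ν (Fin.last k)) * x i.castSucc) = e'
  rw [Finset.mul_sum, Finset.mul_sum, Finset.mul_sum, Finset.sum_mul]
  refine Finset.sum_congr rfl fun β _ => ?_
  change _ * (_ * (eval (ν ∘ Fin.castSucc) _ * _)) = _
  ring

/-- Only the term r = m has degree m in ν, and in it the other factor is not differentiated. -/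
theorem hasTopForm_resFactor (m : ℕ) (x : Fin (k + 1) → ℂ) (i : Fin k) (b : ℤ) :
    HasTopForm m (resFactor m x i b)
      (C (Complex.exp ((b + m * (k + 1)) * x i.castSucc) * (expTwo x i.castSucc ^ m)⁻¹ *
      (m.factorial : ℂ)⁻¹) * (C ((sepProd (expTwo x) i.castSucc 1 ^ (m + 1))⁻¹) *
        (X i.castSucc - X (Fin.last k)) ^ m)) := by
  have h1 : ∀ r, HasTopForm r (∏ l ∈ Finset.range r, (X i.castSucc - X (Fin.last k) +
      C (((b : ℂ) + m * (k + 1)) / 2 - l)))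
      ((X i.castSucc - X (Fin.last k) : MvPolynomial (Fin (k + 1)) ℂ) ^ r) := by
    intro r
    have := HasTopForm.prod (Finset.range r) fun l _ =>
      hasTopForm_linear i.castSucc (Fin.last k) (((b : ℂ) + m * (k + 1)) / 2 - l)
    simpa using this
  refine HasTopForm.C_mul ?_ _
  rw [Finset.sum_range_succ]
  refine HasTopForm.add_degLT ?_ (DegLT.sum _ fun r hr => ?_)
  · have := (h1 m).C_mul ((sepProd (expTwo x) i.castSucc 1 ^ (m + 1))⁻¹)
    simpa using this
  · exact ((h1 r).C_mul _).degLT.mono (Finset.mem_range.1 hr)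

theorem prod_prod_Ioi_castSucc {R : Type*} [CommRing R] (f : Fin (k + 1) → Fin (k + 1) → R) :
    ∏ i, ∏ j ∈ Finset.Ioi i, f i j =
      (∏ i : Fin k, ∏ j ∈ Finset.Ioi i, f i.castSucc j.castSucc) *
        ∏ i : Fin k, f i.castSucc (Fin.last k) := by
  have h1 : ∀ (n : ℕ) (g : Fin n → Fin n → R),
      ∏ i, ∏ j ∈ Finset.Ioi i, g i j = ∏ i, ∏ j, if i < j then g i j else 1 := by
    intro n g
    refine Finset.prod_congr rfl fun i _ => ?_
    rw [← Finset.prod_filter]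
    refine Finset.prod_congr ?_ fun _ _ => rfl
    ext j; simp
  rw [h1, h1, Fin.prod_univ_castSucc]
  simp only [Fin.prod_univ_castSucc, Fin.castSucc_lt_castSucc_iff, Fin.castSucc_lt_last, if_true,
    lt_irrefl, if_false, mul_one, Finset.prod_mul_distrib]
  rw [Finset.prod_eq_one (s := Finset.univ) (f := fun i : Fin k => if Fin.last k < i.castSucc then
    f (Fin.last k) i.castSucc else 1), mul_one]
  exact fun i _ => if_neg (not_lt.2 (Fin.le_last _))

theorem prodDiff_castSucc {R : Type*} [CommRing R] (u : Fin (k + 1) → R) :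
    prodDiff u = prodDiff (fun i => u (Fin.castSucc i)) *
      ∏ i : Fin k, (u i.castSucc - u (Fin.last k)) :=
  prod_prod_Ioi_castSucc fun i j => u i - u j

theorem prodDiff_map {R S : Type*} [CommRing R] [CommRing S] {n : ℕ} (f : R →+* S)
    (u : Fin n → R) : f (prodDiff u) = prodDiff (fun i => f (u i)) := by
  simp [prodDiff, map_prod]

/-- Pairs among the first k indices occur in both orders, and `starSign` accounts for the sign;
pairs with the last index occur once. -/
theorem starSign_mul_prod_sepProd (u : Fin (k + 1) → ℂ) :
    starSign k (k + 1) * ∏ i : Fin k, sepProd u i.castSucc 1 =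
      prodDiff (fun i : Fin k => u i.castSucc) * prodDiff u := by
  have h1 : ∀ i : Fin k, sepProd u i.castSucc 1 =
      (∏ j ∈ {i}ᶜ, (u i.castSucc - u (Fin.castSucc j))) * (u i.castSucc - u (Fin.last k)) := by
    intro i
    have h2 : (Finset.univ.erase i : Finset (Fin k)) = {i}ᶜ := by ext j; simp
    rw [sepProd, ← h2, ← Finset.filter_ne', ← Finset.filter_ne', Finset.prod_filter,
      Finset.prod_filter, Fin.prod_univ_castSucc, if_pos (Fin.castSucc_lt_last i).ne', mul_one]
    congr 1
    refine Finset.prod_congr rfl fun j _ => ?_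
    simp [Fin.castSucc_inj]
  have h3 : starSign k (k + 1) = ∏ i : Fin k, ∏ j ∈ {i}ᶜ, (if i ≤ j then (1 : ℂ) else -1) := by
    refine Finset.prod_congr rfl fun i _ => ?_
    have h4 : ((if (i : ℕ) ≤ ((Fin.last k : Fin (k + 1)) : ℕ) then (1 : ℂ) else -1)) = 1 :=
      if_pos (Fin.le_last i.castSucc)
    rw [Fin.prod_univ_castSucc, h4, mul_one, Fintype.prod_eq_mul_prod_compl i]
    simp
  have h5 := Finset.prod_prod_Ioi_mul_eq_prod_prod_off_diag
    (fun j i : Fin k => (if i ≤ j then (1 : ℂ) else -1) * (u i.castSucc - u j.castSucc))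
  simp only [h1, h3]
  rw [prodDiff_castSucc, Finset.prod_mul_distrib, ← mul_assoc, ← mul_assoc,
    ← Finset.prod_mul_distrib]
  congr 1
  simp only [← Finset.prod_mul_distrib]
  rw [← h5]
  simp only [prodDiff, ← Finset.prod_mul_distrib]
  refine Finset.prod_congr rfl fun i _ => Finset.prod_congr rfl fun j hj => ?_
  have hij := Finset.mem_Ioi.1 hj
  rw [if_pos hij.le, if_neg (not_le.2 hij)]
  ring

theorem degLT_coeff {n d : ℕ} {G : TrigPoly n} (hG : ∀ x, DegLT (d + 1) (G.polyAt x))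
    (β : Fin n → ℤ) : DegLT (d + 1) (G β) :=
  fun κ hκ => TrigPoly.coeff_eq_zero G κ (fun x => hG x κ hκ) β

/-- In the leading part the exponent β enters only through the character, so the sum over β
reassembles the leading part of G, which is A(w) B^m A(ν_1, …, ν_k)^m at w = (u_1, …, u_k). The
factors (ν_i - ν_{k+1})^m complete A(ν)^m, and `starSign_mul_prod_sepProd` cancels all dependence on
x. -/
theorem hasTopForm_resPoly (m : ℕ) {P G : TrigPoly k} (hP : IsBANumerator k m P)
    (hG : ∀ z ν, G.ev z ν = prodDiff (expTwo z) * P.ev z ν) {x : Fin (k + 1) → ℂ}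
    (hx : prodSinh x ≠ 0) :
    HasTopForm (m * (k + 1).choose 2) (resPoly m G x)
      (C ((resConst k m * (m.factorial : ℂ) ^ k)⁻¹) *
        prodDiff (fun i : Fin (k + 1) => (X i : MvPolynomial (Fin (k + 1)) ℂ)) ^ m) := by
  set d := m * k.choose 2 with hd
  set x' : Fin k → ℂ := fun i => x i.castSucc with hx'
  have hGP : ∀ z, G.polyAt z = C (prodDiff (expTwo z)) * P.polyAt z := fun z =>
    MvPolynomial.funext fun ν => by
      rw [map_mul, eval_C]; exact hG z ν
  have hdeg : ∀ z, DegLT (d + 1) (G.polyAt z) := by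
    intro z
    rw [hGP]
    have := ((hasTopForm_C (σ := Fin k) (prodDiff (expTwo z))).degLT.mono le_rfl)
    have h2 := (hasTopForm_homogeneousComponent (degLT_of_totalDegree_le (hP.degree_le z))).C_mul
      (prodDiff (expTwo z))
    exact h2.degLT
  have htop := (HasTopForm.sum G.support fun β _ =>
    ((hasTopForm_homogeneousComponent (degLT_coeff hdeg β)).rename Fin.castSucc).mul
      (HasTopForm.prod Finset.univ fun i _ => hasTopForm_resFactor m x i (β i))).C_mul
      (prodDiff (expTwo x) ^ (m + 1))
  -- Pascal's rule: binom(k, 2) + k = binom(k + 1, 2).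
  have hdim : d + (Finset.univ : Finset (Fin k)).card * m = m * (k + 1).choose 2 := by
    rw [Finset.card_univ, Fintype.card_fin, Nat.choose_succ_succ' k 1, Nat.choose_one_right, hd]
    ring
  rw [hdim] at htop
  change HasTopForm _ (resPoly m G x) _ at htop
  convert htop using 1
  have hlead : ∑ β ∈ G.support, C (trigChar β x') * homogeneousComponent d (G β) =
      C (prodDiff (expTwo x') * prodSinh x' ^ m) *
        prodDiff (fun i : Fin k => (X i : MvPolynomial (Fin k) ℂ)) ^ m := by
    have h1 : homogeneousComponent d (G.polyAt x') =
        ∑ β ∈ G.support, C (trigChar β x') * homogeneousComponent d (G β) := by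
      rw [TrigPoly.polyAt_eq_sum, map_sum]
      simp only [homogeneousComponent_C_mul]
    rw [← h1, hGP, homogeneousComponent_C_mul, hP.leading, map_mul, mul_assoc]
  set D : ℂ := ∏ i : Fin k, (Complex.exp (m * (k + 1) * x i.castSucc) *
    (expTwo x i.castSucc ^ m)⁻¹ * (m.factorial : ℂ)⁻¹ *
      (sepProd (expTwo x) i.castSucc 1 ^ (m + 1))⁻¹) with hD
  have hterm : ∀ β : Fin k → ℤ, ∏ i : Fin k,
      (C (Complex.exp ((β i + m * (k + 1)) * x i.castSucc) * (expTwo x i.castSucc ^ m)⁻¹ *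
      (m.factorial : ℂ)⁻¹) * (C ((sepProd (expTwo x) i.castSucc 1 ^ (m + 1))⁻¹) *
        (X i.castSucc - X (Fin.last k)) ^ m)) =
      C (trigChar β x') * (C D *
        (∏ i : Fin k, (X i.castSucc - X (Fin.last k) : MvPolynomial (Fin (k + 1)) ℂ)) ^ m) := by
    intro β
    rw [hD, trigChar, Complex.exp_sum, ← Finset.prod_pow, map_prod, map_prod,
      ← Finset.prod_mul_distrib, ← Finset.prod_mul_distrib]
    refine Finset.prod_congr rfl fun i _ => ?_
    rw [add_mul, Complex.exp_add]
    simp only [map_mul, hx']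
    ring
  have hsum : ∑ β ∈ G.support, rename Fin.castSucc (homogeneousComponent d (G β)) *
      (C (trigChar β x') * (C D *
        (∏ i : Fin k, (X i.castSucc - X (Fin.last k) : MvPolynomial (Fin (k + 1)) ℂ)) ^ m)) =
      C (prodDiff (expTwo x') * prodSinh x' ^ m * D) *
        prodDiff (fun i : Fin (k + 1) => (X i : MvPolynomial (Fin (k + 1)) ℂ)) ^ m := by
    have h2 := congrArg (rename (R := ℂ) (Fin.castSucc : Fin k → Fin (k + 1))) hlead
    have h3 : rename (R := ℂ) (Fin.castSucc : Fin k → Fin (k + 1))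
        (prodDiff fun i : Fin k => (X i : MvPolynomial (Fin k) ℂ)) =
        prodDiff fun i : Fin k => (X i.castSucc : MvPolynomial (Fin (k + 1)) ℂ) := by
      have := prodDiff_map (rename (R := ℂ) (Fin.castSucc : Fin k → Fin (k + 1))).toRingHom
        (fun i : Fin k => (X i : MvPolynomial (Fin k) ℂ))
      simpa using this
    rw [map_sum, map_mul, map_pow, h3, rename_C] at h2
    simp only [map_mul _ (C _), rename_C] at h2
    rw [prodDiff_castSucc, mul_pow, C_mul (a' := D), mul_mul_mul_comm, ← h2, Finset.sum_mul]
    exact Finset.sum_congr rfl fun β _ => by ring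
  simp only [hterm]
  rw [hsum, ← mul_assoc, ← C_mul]
  congr 2
  have hA := prodSinh_ne_zero_iff_expTwo.1 hx
  have hx0 : prodSinh x' ≠ 0 := prodSinh_ne_zero_iff.2 fun i j hij =>
    prodSinh_ne_zero_iff.1 hx _ _ (by simpa using hij)
  have hA' := prodSinh_ne_zero_iff_expTwo.1 hx0
  have hsep := starSign_mul_prod_sepProd (expTwo x)
  have hst := starSign_ne_zero k (k + 1)
  have hD' : D = Complex.exp (((k : ℂ) - 1) * ∑ i, x' i) ^ m * ((m.factorial : ℂ) ^ k)⁻¹ *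
      ((∏ i : Fin k, sepProd (expTwo x) i.castSucc 1) ^ (m + 1))⁻¹ := by
    rw [hD, Finset.prod_mul_distrib, Finset.prod_mul_distrib, Finset.prod_const, Finset.card_univ,
      Fintype.card_fin, Finset.prod_inv_distrib, Finset.prod_pow, inv_pow, ← Complex.exp_nat_mul,
      Finset.mul_sum, Finset.mul_sum, Complex.exp_sum]
    congr 2
    refine Finset.prod_congr rfl fun i _ => ?_
    rw [expTwo, ← Complex.exp_nat_mul, ← Complex.exp_neg, ← Complex.exp_add]
    congr 1; ring
  have hsep0 : ∏ i : Fin k, sepProd (expTwo x) i.castSucc 1 ≠ 0 := by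
    intro h
    rw [h, mul_zero] at hsep
    exact mul_ne_zero hA' hA hsep.symm
  have hpow : prodDiff (expTwo x') ^ m = 2 ^ (k.choose 2 * m) *
      Complex.exp (((k : ℂ) - 1) * ∑ i, x' i) ^ m * prodSinh x' ^ m := by
    rw [prodDiff_expTwo, mul_pow, mul_pow, ← pow_mul]
  have hfac : ((m.factorial : ℂ)) ≠ 0 := Nat.cast_ne_zero.2 m.factorial_ne_zero
  -- The denominators ∏ `sepProd` to the power m + 1 are compared with A(u)^{m+1} and A(w)^{m+1};
  -- one A(w) comes from G, the other m are B^m up to a factor.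
  have h5 : (starSign k (k + 1) * ∏ i : Fin k, sepProd (expTwo x) i.castSucc 1) ^ (m + 1) =
      (prodDiff (expTwo x') * prodDiff (expTwo x)) ^ (m + 1) := congrArg (· ^ (m + 1)) hsep
  rw [mul_pow, mul_pow, pow_succ (prodDiff (expTwo x')), hpow] at h5
  rw [hD', resConst]
  have hst' := pow_ne_zero (m + 1) hst
  have hsep' := pow_ne_zero (m + 1) hsep0
  have h2' : (2 : ℂ) ^ (k.choose 2 * m) ≠ 0 := pow_ne_zero _ two_ne_zero
  field_simp
  linear_combination h5

end residuePolynomial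

/-! ### Trigonometric polynomials with powers of B inverted -/

section ratAlg
variable {n : ℕ}

theorem prodSinh_mem_trigAlg : (fun x _ => prodSinh x) ∈ trigAlg n := by
  convert (trigAlg n).prod_mem (t := Finset.univ) fun i _ =>
    (trigAlg n).prod_mem (t := Finset.Ioi i) fun j _ => sinh_mem_trigAlg i j using 1
  funext x ν
  simp [prodSinh, Finset.prod_apply]

/-- Functions which become trigonometric polynomials after multiplication with a power of `B`. -/
noncomputable def ratAlg (n : ℕ) : Subalgebra ℂ ((Fin n → ℂ) → (Fin n → ℂ) → ℂ) where
  carrier := {f | ∃ N : ℕ, ∃ q ∈ trigAlg n, ∀ x, prodSinh x ≠ 0 → ∀ ν,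
    f x ν * prodSinh x ^ N = q x ν}
  mul_mem' := by
    rintro f g ⟨N, q, hq, h⟩ ⟨M, r, hr, h'⟩
    refine ⟨N + M, _, (trigAlg n).mul_mem hq hr, fun x hx ν => ?_⟩
    rw [Pi.mul_apply, Pi.mul_apply, Pi.mul_apply, Pi.mul_apply, ← h x hx ν, ← h' x hx ν, pow_add]
    ring
  add_mem' := by
    rintro f g ⟨N, q, hq, h⟩ ⟨M, r, hr, h'⟩
    refine ⟨N + M, _, (trigAlg n).add_mem
      ((trigAlg n).mul_mem hq ((trigAlg n).pow_mem prodSinh_mem_trigAlg M))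
      ((trigAlg n).mul_mem hr ((trigAlg n).pow_mem prodSinh_mem_trigAlg N)), fun x hx ν => ?_⟩
    simp only [Pi.add_apply, Pi.mul_apply, Pi.pow_apply]
    rw [← h x hx ν, ← h' x hx ν, pow_add]
    ring
  algebraMap_mem' c := ⟨0, _, (trigAlg n).algebraMap_mem c, fun x _ ν => by simp⟩

theorem trigAlg_le_ratAlg : trigAlg n ≤ ratAlg n := fun f hf => ⟨0, f, hf, fun x _ ν => by simp⟩

theorem sum_mem_ratAlg {ι : Type*} (s : Finset ι) {f : ι → (Fin n → ℂ) → (Fin n → ℂ) → ℂ}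
    (h : ∀ a ∈ s, f a ∈ ratAlg n) : (fun x ν => ∑ a ∈ s, f a x ν) ∈ ratAlg n := by
  convert (ratAlg n).sum_mem h using 1
  funext x ν
  simp [Finset.sum_apply]

theorem prod_mem_ratAlg {ι : Type*} (s : Finset ι) {f : ι → (Fin n → ℂ) → (Fin n → ℂ) → ℂ}
    (h : ∀ a ∈ s, f a ∈ ratAlg n) : (fun x ν => ∏ a ∈ s, f a x ν) ∈ ratAlg n := by
  convert (ratAlg n).prod_mem h using 1
  funext x ν
  simp [Finset.prod_apply]

theorem mul_mem_ratAlg {f g : (Fin n → ℂ) → (Fin n → ℂ) → ℂ} (hf : f ∈ ratAlg n)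
    (hg : g ∈ ratAlg n) : (fun x ν => f x ν * g x ν) ∈ ratAlg n := (ratAlg n).mul_mem hf hg

theorem pow_mem_ratAlg {f : (Fin n → ℂ) → (Fin n → ℂ) → ℂ} (hf : f ∈ ratAlg n)
    (N : ℕ) : (fun x ν => f x ν ^ N) ∈ ratAlg n := (ratAlg n).pow_mem hf N

theorem const_mem_ratAlg (c : ℂ) : (fun _ _ => c) ∈ ratAlg n := (ratAlg n).algebraMap_mem c

theorem exp_int_mem_ratAlg (a : ℤ) (i : Fin n) :
    (fun x _ => Complex.exp ((a : ℂ) * x i)) ∈ ratAlg n :=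
  trigAlg_le_ratAlg (exp_int_mem_trigAlg a i)

theorem expTwo_inv_mem_ratAlg (i : Fin n) : (fun x _ => (expTwo x i)⁻¹) ∈ ratAlg n := by
  have := exp_int_mem_ratAlg (-2) i
  simpa [expTwo, ← Complex.exp_neg] using this

/-- Multiplication by B leaves the product of the other factors. -/
theorem sinh_inv_mem_ratAlg {i j : Fin n} (hij : i ≠ j) :
    (fun x _ => (Complex.sinh (x i - x j))⁻¹) ∈ ratAlg n := by
  have key : ∀ i j : Fin n, i < j → (fun x _ => (Complex.sinh (x i - x j))⁻¹) ∈ ratAlg n := by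
    intro i j hij
    set T : Finset (Σ _ : Fin n, Fin n) := Finset.univ.sigma fun i => Finset.Ioi i with hT
    have hmem : (⟨i, j⟩ : Σ _ : Fin n, Fin n) ∈ T := by simpa [hT] using hij
    have hB : ∀ x : Fin n → ℂ, prodSinh x = Complex.sinh (x i - x j) *
        ∏ p ∈ T.erase ⟨i, j⟩, Complex.sinh (x p.1 - x p.2) := by
      intro x
      rw [Finset.mul_prod_erase T (fun p => Complex.sinh (x p.1 - x p.2)) hmem, hT,
        Finset.prod_sigma, prodSinh]
    have h1 := (trigAlg n).prod_mem (t := T.erase ⟨i, j⟩)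
      (f := fun p x _ => Complex.sinh (x p.1 - x p.2)) fun p _ => sinh_mem_trigAlg p.1 p.2
    refine ⟨1, _, h1, fun x hx ν => ?_⟩
    have h2 := prodSinh_ne_zero_iff.1 hx i j hij.ne
    rw [Finset.prod_apply, Finset.prod_apply, pow_one, hB, inv_mul_cancel_left₀ h2]
  rcases lt_or_gt_of_ne hij with h | h
  · exact key i j h
  · have := mul_mem_ratAlg (const_mem_ratAlg (-1)) (key j i h)
    convert this using 3 with x ν
    rw [← neg_sub, Complex.sinh_neg, inv_neg]; ring

theorem expTwo_sub_inv_mem_ratAlg {i j : Fin n} (hij : i ≠ j) :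
    (fun x _ => (expTwo x i - expTwo x j)⁻¹) ∈ ratAlg n := by
  have := mul_mem_ratAlg (mul_mem_ratAlg (const_mem_ratAlg (2⁻¹))
    (mul_mem_ratAlg (exp_int_mem_ratAlg (-1) i) (exp_int_mem_ratAlg (-1) j)))
    (sinh_inv_mem_ratAlg hij)
  convert this using 3 with x ν
  rw [expTwo, expTwo, exp_two_sub, mul_inv, mul_inv, ← Complex.exp_add, ← Complex.exp_neg]
  congr 3
  push_cast; ring

theorem eval_expTwo_mem_trigAlg (p : MvPolynomial (Fin n) ℂ) :
    (fun x _ => MvPolynomial.eval (expTwo x) p) ∈ trigAlg n := by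
  induction p using MvPolynomial.induction_on with
  | C a => simp only [MvPolynomial.eval_C]; exact (trigAlg n).algebraMap_mem a
  | add p q hp hq => simp only [map_add]; exact (trigAlg n).add_mem hp hq
  | mul_X p i hp =>
    have := (trigAlg n).mul_mem hp (exp_int_mem_trigAlg 2 i)
    simp only [map_mul, MvPolynomial.eval_X]
    exact_mod_cast this

theorem prodDiff_expTwo_mem_trigAlg : (fun x _ => prodDiff (expTwo x)) ∈ trigAlg n := by
  have := eval_expTwo_mem_trigAlg (prodDiff (fun i : Fin n => MvPolynomial.X (R := ℂ) i))
  convert this using 3 with x ν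
  rw [prodDiff_map]; simp

/-- At s = 1 the denominator is a power of ∏_{j ≠ i} (u_i - u_j), which is invertible in `ratAlg n`.
-/
theorem iteratedDeriv_sepProd_mem_ratAlg (m : ℕ) (i : Fin n) (l : ℕ) :
    ∃ f ∈ ratAlg n, ∀ x, prodSinh x ≠ 0 → ∀ ν,
      iteratedDeriv l (fun s => (sepProd (expTwo x) i s ^ (m + 1))⁻¹) 1 = f x ν := by
  obtain ⟨p, hp⟩ := exists_iteratedDeriv_sepProd (n := n) m i l
  have h1 : (fun x _ => ∏ j ∈ Finset.univ.erase i, (expTwo x i - expTwo x j)⁻¹) ∈ ratAlg n :=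
    prod_mem_ratAlg _ (f := fun j x _ => (expTwo x i - expTwo x j)⁻¹) fun j hj =>
      expTwo_sub_inv_mem_ratAlg (Finset.ne_of_mem_erase hj).symm
  refine ⟨_, mul_mem_ratAlg (trigAlg_le_ratAlg (eval_expTwo_mem_trigAlg (p.eval 1)))
    (pow_mem_ratAlg h1 (m + 1 + l)),
    fun x hx ν => ?_⟩
  have h2 := sepProd_one_ne_zero hx i
  rw [hp _ _ h2, Polynomial.eval_map, Polynomial.eval₂_at_one, ← inv_pow, Finset.prod_inv_distrib]
  simp [sepProd]

end ratAlg

/-! ### The residue as a quotient by B^m -/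

section numerator
variable {k : ℕ}

theorem eval_resFactor_mem_ratAlg (m : ℕ) (i : Fin k) (b : ℤ) :
    ∃ f ∈ ratAlg (k + 1), ∀ x, prodSinh x ≠ 0 → ∀ ν,
      MvPolynomial.eval ν (resFactor m x i b) = f x ν := by
  choose f hf hf' using fun l => iteratedDeriv_sepProd_mem_ratAlg m i.castSucc l
  have h1 := exp_int_mem_ratAlg (b + m * (k + 1)) i.castSucc
  have h2 : ∀ r, (fun _ ν => MvPolynomial.eval ν (∏ l ∈ Finset.range r,
      (MvPolynomial.X i.castSucc - MvPolynomial.X (Fin.last k) +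
        MvPolynomial.C (((b : ℂ) + m * (k + 1)) / 2 - (l : ℂ))))) ∈ ratAlg (k + 1) := fun r =>
    trigAlg_le_ratAlg (eval_mem_trigAlg _)
  refine ⟨_, mul_mem_ratAlg (mul_mem_ratAlg (mul_mem_ratAlg h1
    (pow_mem_ratAlg (expTwo_inv_mem_ratAlg i.castSucc) m)) (const_mem_ratAlg (m.factorial : ℂ)⁻¹))
    (sum_mem_ratAlg (Finset.range (m + 1)) fun r _ => mul_mem_ratAlg (mul_mem_ratAlg
      (const_mem_ratAlg (m.choose r : ℂ)) (hf (m - r))) (h2 r)), fun x hx ν => ?_⟩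
  simp only [resFactor, map_mul, map_sum, MvPolynomial.eval_C]
  rw [inv_pow]
  push_cast
  congr 1
  exact Finset.sum_congr rfl fun r _ => by rw [hf' _ x hx ν]

theorem eval_resPoly_mem_ratAlg (m : ℕ) (G : TrigPoly k) :
    ∃ N : ℕ, ∃ Q : TrigPoly (k + 1), ∀ x, prodSinh x ≠ 0 → ∀ ν,
      MvPolynomial.eval ν (resPoly m G x) * prodSinh x ^ N = Q.ev x ν := by
  choose f hf hf' using fun (i : Fin k) (b : ℤ) => eval_resFactor_mem_ratAlg m i b
  have h1 : (fun x _ => prodDiff (expTwo x)) ∈ ratAlg (k + 1) :=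
    trigAlg_le_ratAlg prodDiff_expTwo_mem_trigAlg
  have h2 : ∀ β : Fin k → ℤ, (fun _ ν => MvPolynomial.eval ν
      (MvPolynomial.rename Fin.castSucc (G β))) ∈ ratAlg (k + 1) := fun β =>
    trigAlg_le_ratAlg (eval_mem_trigAlg _)
  obtain ⟨N, q, ⟨Q, hQ⟩, h⟩ := mul_mem_ratAlg (pow_mem_ratAlg h1 (m + 1))
    (sum_mem_ratAlg G.support fun β _ => mul_mem_ratAlg (h2 β)
      (prod_mem_ratAlg Finset.univ fun i _ => hf i (β i)))
  refine ⟨N, Q, fun x hx ν => ?_⟩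
  rw [← hQ, ← h x hx ν, resPoly]
  simp only [map_mul, map_sum, map_prod, MvPolynomial.eval_C, hf' _ _ x hx ν]

/-- The residue is the Baker–Akhiezer function up to normalisation. -/
theorem exists_resPoly_numerator {m : ℕ} {P G : TrigPoly k} (hP : IsBANumerator k m P)
    (hG : ∀ z ν, G.ev z ν = prodDiff (expTwo z) * P.ev z ν)
    (hν : ∀ ν : Fin (k + 1) → ℂ, normConst m ν ≠ 0 →
      normConst m (fun i : Fin k => ν i.castSucc) ≠ 0) :
    ∃ R : TrigPoly (k + 1), ∀ x, prodSinh x ≠ 0 →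
      R.polyAt x = MvPolynomial.C (prodSinh x ^ m) * resPoly m G x := by
  obtain ⟨N, Q, hQ⟩ := eval_resPoly_mem_ratAlg m G
  -- An extra factor B^m makes the order N + m at least m, so that the pole reduction applies.
  obtain ⟨Q', hQ'⟩ := (trigAlg (k + 1)).mul_mem (⟨Q, fun _ _ => rfl⟩ : Q.ev ∈ trigAlg (k + 1))
    ((trigAlg (k + 1)).pow_mem prodSinh_mem_trigAlg m)
  have h1 : ∀ x, prodSinh x ≠ 0 → ∀ ν,
      Q'.ev x ν / prodSinh x ^ (N + m) = MvPolynomial.eval ν (resPoly m G x) := by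
    intro x hx ν
    have := hQ' x ν
    simp only [Pi.mul_apply, Pi.pow_apply] at this
    rw [← this, ← hQ x hx ν, pow_add]
    field_simp
  obtain ⟨R, hR⟩ := TrigPoly.exists_reduce (m := m) (s := N + m) (by omega) (Q := Q')
    fun ν hν' x hx => by
      have h2 := resHat_eigen hP hG (hν ν hν') hx
      rw [resHat_eq m G hx, ← h1 x hx ν] at h2
      rw [← h2]
      refine sutherlandOp_congr m ?_
      filter_upwards [(continuous_prodSinh.continuousAt (x := x)).eventually_ne hx] with y hy
      rw [resHat_eq m G hy, h1 y hy]
  refine ⟨R, fun x hx => MvPolynomial.funext fun ν => ?_⟩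
  rw [map_mul, MvPolynomial.eval_C, ← h1 x hx, hR x hx]
  change R.ev x ν = _
  have := pow_ne_zero m hx
  field_simp

end numerator

/-! ### The Weyl chamber for complex points -/

section chamber
open Filter

/-- `Re x → +∞` in the Weyl chamber. -/
def complexChamber (n : ℕ) : Filter (Fin n → ℂ) :=
  ⨅ (i : Fin n) (j : Fin n) (_ : i < j), comap (fun x : Fin n → ℂ => (x i - x j).re) atTop

theorem tendsto_complexChamber {X : Type*} {n : ℕ} {l : Filter X} {f : X → Fin n → ℂ} :
    Tendsto f l (complexChamber n) ↔
      ∀ i j, i < j → Tendsto (fun p => (f p i - f p j).re) l atTop := by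
  simp only [complexChamber, tendsto_iInf, tendsto_comap_iff]
  rfl

theorem tendsto_re_sub {n : ℕ} {i j : Fin n} (hij : i < j) :
    Tendsto (fun x : Fin n → ℂ => (x i - x j).re) (complexChamber n) atTop :=
  tendsto_complexChamber.1 tendsto_id i j hij

/-- The points z = x + ½ log s are complex even for real x. The induction therefore carries the
normalisation on the complex chamber, and the real one is recovered here. -/
theorem tendsto_ofReal_chamberAtTop (n : ℕ) :
    Tendsto (fun (x : Fin n → ℝ) (i : Fin n) => (x i : ℂ)) (chamberAtTop n) (complexChamber n) := by
  refine tendsto_complexChamber.2 fun i j hij => ?_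
  have : Tendsto (fun x : Fin n → ℝ => x i - x j) (chamberAtTop n) atTop := by
    refine tendsto_comap.mono_left ?_
    exact (iInf_le _ i).trans ((iInf_le _ j).trans (iInf_le _ hij))
  simpa using this

theorem tendsto_expTwo_div {n : ℕ} {i j : Fin n} (hij : i < j) :
    Tendsto (fun x : Fin n → ℂ => expTwo x j / expTwo x i) (complexChamber n) (nhds 0) := by
  rw [tendsto_zero_iff_norm_tendsto_zero]
  have h1 := (Real.tendsto_exp_neg_atTop_nhds_zero.comp
    (Tendsto.const_mul_atTop (two_pos : (0 : ℝ) < 2) (tendsto_re_sub hij)))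
  refine h1.congr fun x => ?_
  rw [expTwo, expTwo, ← Complex.exp_sub, Complex.norm_exp, Function.comp_apply]
  congr 1
  simp; ring

end chamber

/-! ### Uniform limits on the torus deep in the chamber -/

section limit
open Filter
variable {k : ℕ}

/-- Convergence along the product with the principal filter of the torus is uniform convergence on
it. -/
theorem tendsto_torusIntegral {X : Type*} {l : Filter X} {F : X → (Fin k → ℂ) → ℂ}
    {L : (Fin k → ℂ) → ℂ} {c : Fin k → ℂ} {R : Fin k → ℝ} (hR : ∀ i, 0 ≤ R i)
    (hL : ContinuousOn L (torusSet c R)) (hF : ∀ᶠ x in l, ContinuousOn (F x) (torusSet c R))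
    (h : Tendsto (fun p : X × (Fin k → ℂ) => F p.1 p.2 - L p.2) (l ×ˢ 𝓟 (torusSet c R)) (nhds 0)) :
    Tendsto (fun x => torusIntegral (F x) c R) l (nhds (torusIntegral L c R)) := by
  rw [tendsto_iff_norm_sub_tendsto_zero]
  set M : ℝ := (2 * π) ^ k * ∏ i, |R i| with hM
  have hM0 : 0 ≤ M := mul_nonneg (by positivity) (Finset.prod_nonneg fun i _ => abs_nonneg _)
  rw [Metric.tendsto_nhds]
  intro ε hε
  have h1 : ∀ᶠ p in l ×ˢ 𝓟 (torusSet c R), ‖F p.1 p.2 - L p.2‖ < ε / (M + 1) := by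
    have := (Metric.tendsto_nhds.1 h) (ε / (M + 1)) (by positivity)
    simpa [dist_eq_norm] using this
  rw [eventually_prod_principal_iff] at h1
  filter_upwards [h1, hF] with x hx hFx
  rw [dist_zero_right, norm_norm, ← torusIntegral_sub (hFx.torusIntegrable hR)
    (hL.torusIntegrable hR)]
  refine (norm_torusIntegral_le_of_norm_le_const fun θ =>
    (hx _ (torusMap_mem_torusSet c hR θ)).le).trans_lt ?_
  rw [← hM, ← mul_div_assoc, div_lt_iff₀ (by positivity)]
  nlinarith

/-- The deviation from 1 is -y(s - 1)/(s - y), with |s - 1| = 1/2 and |s - y| ≥ 1/4. -/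
theorem norm_single_factor_sub_one_le {s y : ℂ} (hs : ‖s - 1‖ = 1 / 2) (hy : ‖y‖ ≤ 1 / 4) :
    ‖(1 - y) * s / (s - y) - 1‖ ≤ 2 * ‖y‖ := by
  have h1 : 1 / 4 ≤ ‖s - y‖ := by
    have h2 : (1 : ℂ) = (s - y) + y - (s - 1) := by ring
    have h3 := congrArg norm h2
    have h4 := norm_sub_le ((s - y) + y) (s - 1)
    have h5 := norm_add_le (s - y) y
    rw [norm_one] at h3
    linarith
  have h0 : s - y ≠ 0 := norm_pos_iff.1 (by linarith)
  have h2 : (1 - y) * s / (s - y) - 1 = -(y * (s - 1)) / (s - y) := by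
    field_simp; ring
  rw [h2, norm_div, norm_neg, norm_mul, hs, div_le_iff₀ (by linarith)]
  nlinarith [norm_nonneg y]

/-- The deviation from 1 is y(s - 1)(t - 1) over a denominator of modulus at least 1/8. -/
theorem norm_pair_factor_sub_one_le {s t y : ℂ} (hs : ‖s - 1‖ = 1 / 2) (ht : ‖t - 1‖ = 1 / 2)
    (hy : ‖y‖ ≤ 1 / 4) :
    ‖(1 - y) * (s - y * t) / ((s - y) * (1 - y * t)) - 1‖ ≤ 2 * ‖y‖ := by
  have h1 : 1 / 4 ≤ ‖s - y‖ := by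
    have h2 : (1 : ℂ) = (s - y) + y - (s - 1) := by ring
    have h3 := congrArg norm h2
    have h4 := norm_sub_le ((s - y) + y) (s - 1)
    have h5 := norm_add_le (s - y) y
    rw [norm_one] at h3
    linarith
  have h2 : 1 / 2 ≤ ‖1 - y * t‖ := by
    have h3 : (1 : ℂ) = (1 - y * t) + y * t := by ring
    have h4 := congrArg norm h3
    have h5 := norm_add_le (1 - y * t) (y * t)
    have h6 : t = (t - 1) + 1 := by ring
    have h7 := congrArg norm h6
    have h8 := norm_add_le (t - 1) 1
    rw [norm_one] at h4 h8
    rw [norm_mul] at h5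
    nlinarith [norm_nonneg y, norm_nonneg t]
  have h0 : s - y ≠ 0 := norm_pos_iff.1 (by linarith)
  have h0' : 1 - y * t ≠ 0 := norm_pos_iff.1 (by linarith)
  have h3 : (1 - y) * (s - y * t) / ((s - y) * (1 - y * t)) - 1 =
      y * ((s - 1) * (t - 1)) / ((s - y) * (1 - y * t)) := by
    field_simp; ring
  have h4 : 1 / 8 ≤ ‖s - y‖ * ‖1 - y * t‖ := by nlinarith
  rw [h3, norm_div, norm_mul, norm_mul, norm_mul, hs, ht, div_le_iff₀ (by linarith)]
  nlinarith [norm_nonneg y]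

/-- The part of the integrand which tends to `1`. -/
noncomputable def cauchyRatio (x : Fin (k + 1) → ℂ) (s : Fin k → ℂ) : ℂ :=
  (∏ i : Fin k, (1 - expTwo x (Fin.last k) / expTwo x i.castSucc) * s i /
    (s i - expTwo x (Fin.last k) / expTwo x i.castSucc)) *
  ∏ i : Fin k, ∏ j ∈ Finset.Ioi i, (1 - expTwo x j.castSucc / expTwo x i.castSucc) *
    (s i - expTwo x j.castSucc / expTwo x i.castSucc * s j) /
    ((s i - expTwo x j.castSucc / expTwo x i.castSucc) *
      (1 - expTwo x j.castSucc / expTwo x i.castSucc * s j))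

theorem tendsto_one_of_norm_sub_le {X : Type*} {l : Filter X} {f g : X → ℂ}
    (hg : Tendsto g l (nhds 0)) (h : ∀ᶠ p in l, ‖g p‖ ≤ 1 / 4 → ‖f p - 1‖ ≤ 2 * ‖g p‖) :
    Tendsto f l (nhds 1) := by
  rw [tendsto_iff_norm_sub_tendsto_zero]
  have h1 := hg.norm
  rw [norm_zero] at h1
  have h2 := h1.const_mul 2
  rw [mul_zero] at h2
  refine squeeze_zero' (Eventually.of_forall fun _ => norm_nonneg _) ?_ h2
  filter_upwards [h, h1.eventually_le_const (by norm_num : (0 : ℝ) < 1 / 4)] with p hp hp'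
  exact hp hp'

theorem tendsto_cauchyRatio :
    Tendsto (fun p : (Fin (k + 1) → ℂ) × (Fin k → ℂ) => cauchyRatio p.1 p.2)
      (complexChamber (k + 1) ×ˢ 𝓟 (unitTorus k (1 / 2))) (nhds 1) := by
  have hs : ∀ᶠ p : (Fin (k + 1) → ℂ) × (Fin k → ℂ) in
      complexChamber (k + 1) ×ˢ 𝓟 (unitTorus k (1 / 2)), p.2 ∈ unitTorus k (1 / 2) :=
    tendsto_snd.eventually (mem_principal_self _)
  have h1 : ∀ i : Fin k, Tendsto (fun p : (Fin (k + 1) → ℂ) × (Fin k → ℂ) =>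
      (1 - expTwo p.1 (Fin.last k) / expTwo p.1 i.castSucc) * p.2 i /
        (p.2 i - expTwo p.1 (Fin.last k) / expTwo p.1 i.castSucc))
      (complexChamber (k + 1) ×ˢ 𝓟 (unitTorus k (1 / 2))) (nhds 1) := fun i =>
    tendsto_one_of_norm_sub_le
      ((tendsto_expTwo_div (Fin.castSucc_lt_last i)).comp tendsto_fst) <| by
      filter_upwards [hs] with p hp hy
      exact norm_single_factor_sub_one_le (hp i) hy
  have h2 : ∀ i : Fin k, ∀ j ∈ Finset.Ioi i, Tendsto (fun p : (Fin (k + 1) → ℂ) × (Fin k → ℂ) =>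
      (1 - expTwo p.1 j.castSucc / expTwo p.1 i.castSucc) *
    (p.2 i - expTwo p.1 j.castSucc / expTwo p.1 i.castSucc * p.2 j) /
    ((p.2 i - expTwo p.1 j.castSucc / expTwo p.1 i.castSucc) *
      (1 - expTwo p.1 j.castSucc / expTwo p.1 i.castSucc * p.2 j)))
      (complexChamber (k + 1) ×ˢ 𝓟 (unitTorus k (1 / 2))) (nhds 1) := fun i j hij =>
    tendsto_one_of_norm_sub_le ((tendsto_expTwo_div
      (Fin.castSucc_lt_castSucc_iff.2 (Finset.mem_Ioi.1 hij))).comp tendsto_fst) <| by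
      filter_upwards [hs] with p hp hy
      exact norm_pair_factor_sub_one_le (hp i) (hp j) hy
  have h3 := (tendsto_finsetProd Finset.univ fun i _ => h1 i).mul
    (tendsto_finsetProd Finset.univ fun i _ => tendsto_finsetProd (Finset.Ioi i) (h2 i))
  simpa [cauchyRatio] using h3

theorem abs_log_norm_le {s : ℂ} (hs : ‖s - 1‖ = 1 / 2) : |Real.log ‖s‖| ≤ 1 := by
  have h1 : ‖s‖ ≤ 3 / 2 := by
    have := norm_add_le (s - 1) 1
    rw [sub_add_cancel, norm_one, hs] at this
    linarith
  have h2 : 1 / 2 ≤ ‖s‖ := by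
    have := norm_sub_le s (s - 1)
    rw [sub_sub_cancel, norm_one, hs] at this
    linarith
  have h3 := Real.log_le_sub_one_of_pos (by linarith : 0 < ‖s‖)
  have h4 := Real.one_sub_inv_le_log_of_pos (by linarith : 0 < ‖s‖)
  have h5 : ‖s‖⁻¹ ≤ 2 := by
    rw [inv_le_comm₀ (by linarith) two_pos]; linarith
  rw [abs_le]
  constructor <;> linarith

/-- The real part of ½ log s_i is bounded on the torus, so z goes to infinity in its chamber
together with x, uniformly in s. -/
theorem tendsto_shiftLog :
    Tendsto (fun p : (Fin (k + 1) → ℂ) × (Fin k → ℂ) => shiftLog p.1 p.2)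
      (complexChamber (k + 1) ×ˢ 𝓟 (unitTorus k (1 / 2))) (complexChamber k) := by
  refine tendsto_complexChamber.2 fun i j hij => ?_
  have hs : ∀ᶠ p : (Fin (k + 1) → ℂ) × (Fin k → ℂ) in
      complexChamber (k + 1) ×ˢ 𝓟 (unitTorus k (1 / 2)), p.2 ∈ unitTorus k (1 / 2) :=
    tendsto_snd.eventually (mem_principal_self _)
  have h1 : Tendsto (fun p : (Fin (k + 1) → ℂ) × (Fin k → ℂ) =>
      (p.1 i.castSucc - p.1 j.castSucc).re + (-1))
      (complexChamber (k + 1) ×ˢ 𝓟 (unitTorus k (1 / 2))) atTop :=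
    tendsto_atTop_add_const_right _ _
      ((tendsto_re_sub (Fin.castSucc_lt_castSucc_iff.2 hij)).comp tendsto_fst)
  refine tendsto_atTop_mono' _ ?_ h1
  filter_upwards [hs] with p hp
  have h2 := abs_le.1 (abs_log_norm_le (hp i))
  have h3 := abs_le.1 (abs_log_norm_le (hp j))
  have h4 : (shiftLog p.1 p.2 i - shiftLog p.1 p.2 j).re = (p.1 i.castSucc - p.1 j.castSucc).re +
      (Real.log ‖p.2 i‖ - Real.log ‖p.2 j‖) / 2 := by
    simp only [shiftLog, Complex.sub_re, Complex.add_re, Complex.div_ofNat_re, Complex.log_re]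
    ring
  rw [h4]
  linarith [h2.1, h2.2, h3.1, h3.2]

/-- The fixed radius 1/2 is admissible once |u_j| < |u_i| / 4 for i < j. -/
theorem eventually_goodRadius : ∀ᶠ x in complexChamber (k + 1), GoodRadius (1 / 2) x := by
  have key : ∀ x : Fin (k + 1) → ℂ, ∀ i j, ‖expTwo x j / expTwo x i‖ < 1 / 4 →
      1 / 2 * (‖expTwo x i‖ + ‖expTwo x j‖) < ‖expTwo x i - expTwo x j‖ := by
    intro x i j h
    have hpos : 0 < ‖expTwo x i‖ := norm_pos_iff.2 (Complex.exp_ne_zero _)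
    rw [norm_div, div_lt_iff₀ hpos] at h
    have := norm_sub_norm_le (expTwo x i) (expTwo x j)
    linarith
  have h1 : ∀ i j : Fin (k + 1), i < j → ∀ᶠ x in complexChamber (k + 1),
      1 / 2 * (‖expTwo x i‖ + ‖expTwo x j‖) < ‖expTwo x i - expTwo x j‖ := by
    intro i j hij
    have h2 := (tendsto_expTwo_div hij).norm
    rw [norm_zero] at h2
    filter_upwards [h2.eventually_lt_const (by norm_num : (0 : ℝ) < 1 / 4)] with x hx
    exact key x i j hx
  have h2 : ∀ᶠ x in complexChamber (k + 1), ∀ i j : Fin (k + 1), i < j →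
      1 / 2 * (‖expTwo x i‖ + ‖expTwo x j‖) < ‖expTwo x i - expTwo x j‖ := by
    simpa only [eventually_all] using h1
  filter_upwards [h2] with x hx
  refine ⟨by norm_num, by norm_num, fun i j hij => ?_⟩
  rcases lt_or_gt_of_ne hij with h | h
  · exact hx i j h
  · rw [add_comm, norm_sub_rev]; exact hx j i h

end limit

/-! ### The limit of the kernel average -/

section asymptotics
open Filter
variable {k : ℕ}

theorem prodDiffStar_castSucc (w : Fin k → ℂ) (u : Fin (k + 1) → ℂ) :
    prodDiffStar w u = (∏ i : Fin k, (w i - u (Fin.last k)) * (w i - u i.castSucc)) *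
      ∏ i : Fin k, ∏ j ∈ Finset.Ioi i, (w i - u j.castSucc) * (u i.castSucc - w j) := by
  have h5 := Finset.prod_prod_Ioi_mul_eq_prod_prod_off_diag
    (fun j i : Fin k => if i ≤ j then w i - u j.castSucc else u j.castSucc - w i)
  have h6 : ∀ i : Fin k, ∏ j ∈ Finset.Ioi i, (w i - u j.castSucc) * (u i.castSucc - w j) =
      ∏ j ∈ Finset.Ioi i, (if i ≤ j then w i - u j.castSucc else u j.castSucc - w i) *
        (if j ≤ i then w j - u i.castSucc else u i.castSucc - w j) := by
    refine fun i => Finset.prod_congr rfl fun j hj => ?_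
    have hij := Finset.mem_Ioi.1 hj
    rw [if_pos hij.le, if_neg (not_le.2 hij)]
  simp only [h6, h5]
  rw [prodDiffStar, ← Finset.prod_mul_distrib]
  refine Finset.prod_congr rfl fun i _ => ?_
  have h4 : (if (i : ℕ) ≤ ((Fin.last k : Fin (k + 1)) : ℕ) then w i - u (Fin.last k)
      else u (Fin.last k) - w i) = w i - u (Fin.last k) := if_pos (Fin.le_last i.castSucc)
  rw [Fin.prod_univ_castSucc, h4, Fintype.prod_eq_mul_prod_compl i]
  simp only [Fin.val_castSucc, Fin.val_fin_le, le_refl, if_true]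
  ring

/-- Both sides have total degree 0 in u when s is fixed, so powers of the u_i cancel. The factors
w_i - u_i = u_i (s_i - 1) supply the poles, and the rest is `cauchyRatio`, which tends to 1. -/
theorem prodDiff_mul_div_prodDiffStar {x : Fin (k + 1) → ℂ} {s : Fin k → ℂ} (w : Fin k → ℂ)
    (hw : ∀ i, w i = expTwo x i.castSucc * s i) :
    prodDiff (expTwo x) * prodDiff w * (∏ i, w i) * (prodDiffStar w (expTwo x))⁻¹ =
      (∏ i, (s i - 1)⁻¹) * cauchyRatio x s := by
  have hu : ∀ i, expTwo x i ≠ 0 := fun i => Complex.exp_ne_zero _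
  have h1 : ∀ i j, expTwo x j / expTwo x i * expTwo x i = expTwo x j := fun i j =>
    div_mul_cancel₀ _ (hu i)
  have e1 : ∀ i : Fin k, (s i - 1)⁻¹ * ((1 - expTwo x (Fin.last k) / expTwo x i.castSucc) * s i /
      (s i - expTwo x (Fin.last k) / expTwo x i.castSucc)) =
      (expTwo x i.castSucc - expTwo x (Fin.last k)) * w i *
        ((w i - expTwo x (Fin.last k)) * (w i - expTwo x i.castSucc))⁻¹ := by
    intro i
    have h2 := h1 i.castSucc (Fin.last k)
    generalize expTwo x (Fin.last k) / expTwo x i.castSucc = y at *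
    rw [hw, ← h2]
    have := hu i.castSucc
    rw [show (expTwo x i.castSucc * s i - y * expTwo x i.castSucc) *
      (expTwo x i.castSucc * s i - expTwo x i.castSucc) =
      expTwo x i.castSucc ^ 2 * ((s i - y) * (s i - 1)) by ring, mul_inv, mul_inv, div_eq_mul_inv]
    field_simp
  have e2 : ∀ i j : Fin k, (1 - expTwo x j.castSucc / expTwo x i.castSucc) *
      (s i - expTwo x j.castSucc / expTwo x i.castSucc * s j) /
      ((s i - expTwo x j.castSucc / expTwo x i.castSucc) *
      (1 - expTwo x j.castSucc / expTwo x i.castSucc * s j)) =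
      (expTwo x i.castSucc - expTwo x j.castSucc) * (w i - w j) *
        ((w i - expTwo x j.castSucc) * (expTwo x i.castSucc - w j))⁻¹ := by
    intro i j
    have h2 := h1 i.castSucc j.castSucc
    generalize expTwo x j.castSucc / expTwo x i.castSucc = y at *
    rw [hw, hw, ← h2]
    have := hu i.castSucc
    rw [show (expTwo x i.castSucc * s i - y * expTwo x i.castSucc) *
      (expTwo x i.castSucc - y * expTwo x i.castSucc * s j) =
      expTwo x i.castSucc ^ 2 * ((s i - y) * (1 - y * s j)) by ring, mul_inv, div_eq_mul_inv]
    field_simp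
  rw [cauchyRatio, ← mul_assoc, ← Finset.prod_mul_distrib]
  simp only [e1, e2]
  rw [prodDiffStar_castSucc, prodDiff_castSucc, prodDiff, prodDiff]
  simp only [Finset.prod_mul_distrib, Finset.prod_inv_distrib, mul_inv]
  ring

/-- The limit of the integrand. -/
noncomputable def limitIntegrand (m : ℕ) (ν : Fin (k + 1) → ℂ) (s : Fin k → ℂ) : ℂ :=
  ∏ i, ((s i - 1) ^ (m + 1))⁻¹ * powLog (ν i.castSucc - ν (Fin.last k) - 1) (s i)

/-- Isolates e^{2(ν,x)}, the integrand of the limit, and a factor tending to 1. The -1 in the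
exponent of s_i is the weight s_i⁻¹. -/
theorem integrand_eq (m : ℕ) (P : TrigPoly k) {ν : Fin (k + 1) → ℂ}
    (hν : normConst m (fun i : Fin k => ν i.castSucc) ≠ 0) (x : Fin (k + 1) → ℂ)
    {s : Fin k → ℂ} (hs : ∀ i, s i ≠ 0) :
    (∏ l, s l)⁻¹ * (kern m (ν (Fin.last k)) x (shiftLog x s) *
        baPart m P (shiftLog x s) (fun i => ν i.castSucc)) =
      Complex.exp (2 * ∑ i, ν i * x i) * normConst m (fun i : Fin k => ν i.castSucc) *
      (limitIntegrand m ν s * (cauchyRatio x s ^ (m + 1) *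
        P.ratio m (shiftLog x s) (fun i => ν i.castSucc))) := by
  set ν' : Fin k → ℂ := fun i => ν i.castSucc with hν'
  set z := shiftLog x s with hz
  have hwz := expTwo_shiftLog x hs
  have hba : baPart m P z ν' = normConst m ν' * P.ratio m z ν' *
      Complex.exp (2 * ∑ i, ν' i * z i) := by
    rw [baPart, TrigPoly.ratio]
    change TrigPoly.ev P z ν' / _ * _ = _ * (TrigPoly.ev P z ν' / _) * _
    rw [mul_comm (prodSinh z ^ m), ← div_div, ← mul_div_assoc, mul_div_cancel₀ _ hν]
  have hexp : (∏ l, s l)⁻¹ * (Complex.exp (2 * (m + 1) * ∑ i, z i) *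
      Complex.exp (2 * ν (Fin.last k) * (∑ i, x i - ∑ i, z i)) *
      Complex.exp (2 * ∑ i, ν' i * z i)) =
      Complex.exp (2 * ∑ i, ν i * x i) * (∏ i, expTwo z i) ^ (m + 1) *
      ∏ i, powLog (ν i.castSucc - ν (Fin.last k) - 1) (s i) := by
    have h1 : ∀ i, powLog (ν i.castSucc - ν (Fin.last k) - 1) (s i) =
        (s i)⁻¹ * Complex.exp (2 * (ν i.castSucc - ν (Fin.last k)) * (z i - x i.castSucc)) := by
      intro i
      have h2 := Complex.exp_log (hs i)
      rw [powLog, ← h2, ← Complex.exp_neg, ← Complex.exp_add, h2]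
      congr 1
      simp only [hz, shiftLog]
      ring
    simp only [h1]
    rw [Finset.prod_mul_distrib, Finset.prod_inv_distrib, ← Complex.exp_sum,
      mul_left_comm (_ * _) ((∏ l, s l)⁻¹)]
    congr 1
    simp only [expTwo]
    rw [← Complex.exp_sum, ← Complex.exp_nat_mul, ← Complex.exp_add, ← Complex.exp_add,
      ← Complex.exp_add, ← Complex.exp_add]
    congr 1
    rw [Fin.sum_univ_castSucc, Fin.sum_univ_castSucc]
    simp only [mul_sub, sub_mul, Finset.sum_sub_distrib, mul_assoc, ← Finset.mul_sum, hν']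
    push_cast
    ring
  have hcauchy := congrArg (· ^ (m + 1)) (prodDiff_mul_div_prodDiffStar (expTwo z) hwz)
  simp only [mul_pow] at hcauchy
  have hL : limitIntegrand m ν s = (∏ i, (s i - 1)⁻¹) ^ (m + 1) *
      ∏ i, powLog (ν i.castSucc - ν (Fin.last k) - 1) (s i) := by
    rw [limitIntegrand, Finset.prod_mul_distrib, Finset.prod_inv_distrib, Finset.prod_inv_distrib,
      Finset.prod_pow, inv_pow]
  rw [hba, hL, kern]
  calc _ = prodDiff (expTwo x) ^ (m + 1) * prodDiff (expTwo z) ^ (m + 1) *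
        (prodDiffStar (expTwo z) (expTwo x) ^ (m + 1))⁻¹ * (normConst m ν' * P.ratio m z ν') *
        ((∏ l, s l)⁻¹ * (Complex.exp (2 * (m + 1) * ∑ i, z i) *
      Complex.exp (2 * ν (Fin.last k) * (∑ i, x i - ∑ i, z i)) *
      Complex.exp (2 * ∑ i, ν' i * z i))) := by ring
    _ = prodDiff (expTwo x) ^ (m + 1) * prodDiff (expTwo z) ^ (m + 1) *
        (∏ i, expTwo z i) ^ (m + 1) * (prodDiffStar (expTwo z) (expTwo x))⁻¹ ^ (m + 1) *
        (normConst m ν' * P.ratio m z ν') * (Complex.exp (2 * ∑ i, ν i * x i) *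
      ∏ i, powLog (ν i.castSucc - ν (Fin.last k) - 1) (s i)) := by rw [hexp, inv_pow]; ring
    _ = _ := by rw [hcauchy]; ring

/-- The residue of s^b / (s - 1)^{m+1} at 1 is the binomial coefficient of b over m; this is the
origin of the binomials in the theorem. -/
theorem torusIntegral_limitIntegrand (m : ℕ) (ν : Fin (k + 1) → ℂ) :
    torusIntegral (limitIntegrand m ν) (fun _ => 1) (fun _ => 1 / 2) = (2 * π * Complex.I) ^ k *
      ∏ i : Fin k, complexBinom (ν i.castSucc - ν (Fin.last k) - 1) m := by
  have h1 : ∀ b : ℂ, (∮ s in C(1, 1 / 2), ((s - 1) ^ (m + 1))⁻¹ * powLog b s) =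
      2 * π * Complex.I * complexBinom b m := by
    intro b
    rw [circleIntegral_pole m (by norm_num) fun s hs => ?_,
      iteratedDeriv_powLog b m 1 Complex.one_mem_slitPlane, powLog_one_right, mul_one, complexBinom]
    have hs' : ‖s - 1‖ ≤ 1 / 2 := by simpa [dist_eq_norm] using hs
    exact (hasDerivAt_powLog b (mem_slitPlane_of_norm_sub_one (by norm_num)
      hs')).differentiableAt.differentiableWithinAt
  unfold limitIntegrand
  rw [torusIntegral_prod (fun i s => ((s - 1) ^ (m + 1))⁻¹ *
    powLog (ν i.castSucc - ν (Fin.last k) - 1) s)]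
  simp only [h1, Finset.prod_mul_distrib, Finset.prod_const, Finset.card_univ, Fintype.card_fin,
    mul_pow]

theorem continuousOn_limitIntegrand (m : ℕ) (ν : Fin (k + 1) → ℂ) :
    ContinuousOn (limitIntegrand m ν) (unitTorus k (1 / 2)) := by
  intro s hs
  refine ContinuousAt.continuousWithinAt ?_
  unfold limitIntegrand
  refine tendsto_finsetProd _ fun i _ => ContinuousAt.mul ?_ ?_
  · refine ContinuousAt.inv₀
      (((continuous_apply i).sub continuous_const).pow (m + 1)).continuousAt (pow_ne_zero _ fun h => ?_)
    have := hs i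
    rw [h, norm_zero] at this
    norm_num at this
  · exact ContinuousAt.comp (f := fun s : Fin k → ℂ => s i)
      (hasDerivAt_powLog _ (unitTorus_slitPlane (by norm_num) hs i)).continuousAt
      (continuous_apply i).continuousAt

theorem tendsto_logAvg {m : ℕ} {P : TrigPoly k} {ν : Fin (k + 1) → ℂ}
    (hν : normConst m (fun i : Fin k => ν i.castSucc) ≠ 0)
    (hP : Tendsto (fun x => P.ratio m x (fun i => ν i.castSucc)) (complexChamber k) (nhds 1)) :
    Tendsto (fun x => (Complex.exp (2 * ∑ i, ν i * x i))⁻¹ *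
      logAvg (1 / 2) (fun p => kern m (ν (Fin.last k)) p.1 p.2 *
        baPart m P p.2 (fun i => ν i.castSucc)) x) (complexChamber (k + 1))
      (nhds (normConst m (fun i : Fin k => ν i.castSucc) * ((2 * π * Complex.I) ^ k *
        ∏ i : Fin k, complexBinom (ν i.castSucc - ν (Fin.last k) - 1) m))) := by
  set ν' : Fin k → ℂ := fun i => ν i.castSucc with hν'
  have hr : (1 / 2 : ℝ) < 1 := by norm_num
  have hR : ∀ i : Fin k, 0 ≤ (fun _ : Fin k => (1 / 2 : ℝ)) i := fun _ => by norm_num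
  have hcompact := isCompact_torusSet (fun _ : Fin k => (1 : ℂ)) (fun _ => (1 / 2 : ℝ))
  have hLc := continuousOn_limitIntegrand (k := k) m ν
  obtain ⟨M, hM⟩ := hcompact.exists_bound_of_continuousOn hLc
  set F : (Fin (k + 1) → ℂ) → (Fin k → ℂ) → ℂ := fun x s =>
    (Complex.exp (2 * ∑ i, ν i * x i))⁻¹ * ((∏ l, s l)⁻¹ *
      (kern m (ν (Fin.last k)) x (shiftLog x s) * baPart m P (shiftLog x s) ν')) with hF
  have h1 : Tendsto (fun p : (Fin (k + 1) → ℂ) × (Fin k → ℂ) =>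
      F p.1 p.2 - normConst m ν' * limitIntegrand m ν p.2)
      (complexChamber (k + 1) ×ˢ 𝓟 (torusSet (fun _ : Fin k => (1 : ℂ)) (fun _ => (1 / 2 : ℝ))))
      (nhds 0) := by
    have h2 := (tendsto_cauchyRatio (k := k)).pow (m + 1) |>.mul (hP.comp tendsto_shiftLog)
    rw [one_pow, one_mul, tendsto_iff_norm_sub_tendsto_zero] at h2
    rw [tendsto_zero_iff_norm_tendsto_zero]
    have h3 := h2.const_mul (‖normConst m ν'‖ * M)
    rw [mul_zero] at h3
    refine squeeze_zero' (Eventually.of_forall fun _ => norm_nonneg _) ?_ h3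
    filter_upwards [tendsto_snd.eventually (mem_principal_self _)] with p hp
    have hs0 := fun l => unitTorus_ne_zero hr hp l
    have h4 : F p.1 p.2 - normConst m ν' * limitIntegrand m ν p.2 =
        normConst m ν' * limitIntegrand m ν p.2 * (cauchyRatio p.1 p.2 ^ (m + 1) *
        P.ratio m (shiftLog p.1 p.2) ν' - 1) := by
      simp only [hF]
      rw [integrand_eq m P hν p.1 hs0, ← hν', mul_assoc (Complex.exp _),
        inv_mul_cancel_left₀ (Complex.exp_ne_zero _)]
      ring
    rw [h4, norm_mul, norm_mul]
    exact mul_le_mul_of_nonneg_right (mul_le_mul_of_nonneg_left (hM _ hp) (norm_nonneg _))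
      (norm_nonneg _)
  have hc : ContinuousOn (fun s => normConst m ν' * limitIntegrand m ν s)
      (torusSet (fun _ : Fin k => (1 : ℂ)) (fun _ => (1 / 2 : ℝ))) := continuousOn_const.mul hLc
  have h5 := tendsto_torusIntegral hR hc ?_ h1
  · rw [torusIntegral_const_mul, torusIntegral_limitIntegrand] at h5
    refine h5.congr fun x => ?_
    simp only [hF, logAvg, torusIntegral_const_mul]
  · filter_upwards [eventually_goodRadius] with x hx
    refine continuousOn_const.mul (continuousOn_logAvg_integrand (h := fun p =>
      kern m (ν (Fin.last k)) p.1 p.2 * baPart m P p.2 ν') hr fun s hs => ?_)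
    have hdom := hx.kernDom hs
    have h6 := ((contDiffOn_kern (N := 0) m (ν (Fin.last k))).continuousOn.continuousAt
      (isOpen_kernSet.mem_nhds hdom))
    have h7 := ((contDiffOn_baPart (N := 0) m P ν').continuousOn.continuousAt
      ((isOpen_ne_fun continuous_prodDiff_expTwo continuous_const).mem_nhds hdom.2.1))
    exact h6.mul (ContinuousAt.comp (f := fun p : (Fin (k + 1) → ℂ) × (Fin k → ℂ) => p.2)
      h7 continuousAt_snd)

end asymptotics

/-! ### Existence by induction on the number of particles -/

section existence
open Filter
variable {k : ℕ}

/-- The pairs with the last index contribute ∏_{l=1}^m (ν_i - ν_{k+1} - l), a falling factorial of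
ν_i - ν_{k+1} - 1. -/
theorem normConst_castSucc (m : ℕ) (ν : Fin (k + 1) → ℂ) :
    normConst m ν = normConst m (fun i : Fin k => ν i.castSucc) *
      ((m.factorial : ℂ) ^ k * ∏ i : Fin k, complexBinom (ν i.castSucc - ν (Fin.last k) - 1) m) := by
  have h1 : ∀ a : ℂ, ∏ l ∈ Finset.Icc 1 m, (a - (l : ℂ)) =
      (m.factorial : ℂ) * complexBinom (a - 1) m := by
    intro a
    rw [complexBinom, mul_div_cancel₀ _ (Nat.cast_ne_zero.2 m.factorial_ne_zero),
      Finset.range_eq_Ico, Finset.prod_Ico_eq_prod_range, ← Finset.Ico_add_one_right_eq_Icc,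
      Finset.prod_Ico_eq_prod_range]
    refine Finset.prod_congr rfl fun l _ => ?_
    push_cast; ring
  simp only [normConst, prod_prod_Ioi_castSucc, Finset.prod_mul_distrib]
  congr 1
  rw [Finset.prod_comm]
  simp only [h1, Finset.prod_mul_distrib, Finset.prod_const, Finset.card_univ, Fintype.card_fin]

theorem isHomogeneous_prodDiff_X (n : ℕ) :
    (prodDiff fun i : Fin n => (MvPolynomial.X i : MvPolynomial (Fin n) ℂ)).IsHomogeneous
      (n.choose 2) := by
  have := MvPolynomial.IsHomogeneous.prod (Finset.univ : Finset (Fin n))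
    (fun i => ∏ j ∈ Finset.Ioi i, (MvPolynomial.X i - MvPolynomial.X j : MvPolynomial (Fin n) ℂ))
    (fun i => ∑ j ∈ Finset.Ioi i, 1) fun i _ => MvPolynomial.IsHomogeneous.prod _ _ _ fun j _ =>
      (MvPolynomial.isHomogeneous_X ℂ i).sub (MvPolynomial.isHomogeneous_X ℂ j)
  simp only [Finset.sum_const, smul_eq_mul, mul_one, sum_card_Ioi] at this
  exact this

/-- The inductive step: the residue is the Baker–Akhiezer function with one more particle. -/
theorem exists_isBANumerator_succ {m : ℕ} {P G : TrigPoly k} (hP : IsBANumerator k m P)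
    (hlim : ∀ ν : Fin k → ℂ, normConst m ν ≠ 0 →
      Tendsto (fun x => P.ratio m x ν) (complexChamber k) (nhds 1))
    (hG : ∀ z ν, G.ev z ν = prodDiff (expTwo z) * P.ev z ν) :
    ∃ P' : TrigPoly (k + 1), IsBANumerator (k + 1) m P' ∧
      (∀ ν : Fin (k + 1) → ℂ, normConst m ν ≠ 0 →
        Tendsto (fun x => P'.ratio m x ν) (complexChamber (k + 1)) (nhds 1)) ∧
      ∀ x, prodSinh x ≠ 0 → ∀ ν, normConst m ν ≠ 0 → P'.toFun m x ν =
        resConst k m * (m.factorial : ℂ) ^ k * (normConst m ν)⁻¹ * resHat m G x ν := by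
  have hν' : ∀ ν : Fin (k + 1) → ℂ, normConst m ν ≠ 0 →
      normConst m (fun i : Fin k => ν i.castSucc) ≠ 0 := fun ν hν => by
    rw [normConst_castSucc] at hν; exact left_ne_zero_of_mul hν
  obtain ⟨R, hR⟩ := exists_resPoly_numerator hP hG hν'
  have hc0 := resConst_ne_zero k m
  have hf0 : (m.factorial : ℂ) ^ k ≠ 0 := pow_ne_zero _ (Nat.cast_ne_zero.2 m.factorial_ne_zero)
  obtain ⟨c, hc⟩ : ∃ c, c = resConst k m * (m.factorial : ℂ) ^ k := ⟨_, rfl⟩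
  have hcne : c ≠ 0 := hc ▸ mul_ne_zero hc0 hf0
  -- The constant c is the inverse of the scalar in `hasTopForm_resPoly`, so the leading term
  -- becomes B^m A^m.
  obtain ⟨P', hP'⟩ := (trigAlg (k + 1)).smul_mem (⟨R, fun _ _ => rfl⟩ : R.ev ∈ trigAlg (k + 1)) c
  have hpoly : ∀ x, prodSinh x ≠ 0 →
      P'.polyAt x = MvPolynomial.C (c * prodSinh x ^ m) * resPoly m G x := by
    intro x hx
    rw [map_mul, mul_assoc, ← hR x hx]
    refine MvPolynomial.funext fun ν => ?_
    rw [map_mul, MvPolynomial.eval_C]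
    exact (hP' x ν).symm
  have htop : ∀ x, HasTopForm (m * (k + 1).choose 2) (P'.polyAt x)
      (MvPolynomial.C (prodSinh x ^ m) * prodDiff (fun i : Fin (k + 1) =>
        (MvPolynomial.X i : MvPolynomial (Fin (k + 1)) ℂ)) ^ m) := by
    intro x
    refine ⟨?_, fun κ hκ => ?_⟩
    · have := (isHomogeneous_prodDiff_X (k + 1)).pow m
      rw [mul_comm] at this
      exact this.C_mul _
    · refine eq_zero_of_prodSinh_ne_zero (f := fun x => MvPolynomial.coeff κ (P'.polyAt x -
        MvPolynomial.C (prodSinh x ^ m) * prodDiff (fun i : Fin (k + 1) =>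
        (MvPolynomial.X i : MvPolynomial (Fin (k + 1)) ℂ)) ^ m)) ?_ (fun y hy => ?_) x
      · simp only [MvPolynomial.coeff_sub, MvPolynomial.coeff_C_mul, TrigPoly.coeff_polyAt]
        exact (continuous_finsetSum _ fun α _ => (continuous_trigChar α).mul
          continuous_const).sub ((continuous_prodSinh.pow m).mul continuous_const)
      · have h1 := (hasTopForm_resPoly m hP hG hy).C_mul (c * prodSinh y ^ m)
        rw [← hpoly y hy, ← mul_assoc, ← MvPolynomial.C_mul, ← hc, mul_right_comm,
          mul_inv_cancel₀ hcne, one_mul] at h1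
        exact h1.2 κ hκ
  have hratio : ∀ x, prodSinh x ≠ 0 → ∀ ν, P'.ratio m x ν =
      c * (normConst m ν)⁻¹ * MvPolynomial.eval ν (resPoly m G x) := by
    intro x hx ν
    have := pow_ne_zero m hx
    rw [TrigPoly.ratio, hpoly x hx, map_mul, MvPolynomial.eval_C, div_eq_mul_inv, mul_inv]
    field_simp
  have hfun : ∀ x, prodSinh x ≠ 0 → ∀ ν, P'.toFun m x ν =
      c * (normConst m ν)⁻¹ * resHat m G x ν := by
    intro x hx ν
    rw [TrigPoly.toFun, hratio x hx, resHat_eq m G hx]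
    ring
  have hnorm : ∀ ν : Fin (k + 1) → ℂ, normConst m ν ≠ 0 →
      Tendsto (fun x => P'.ratio m x ν) (complexChamber (k + 1)) (nhds 1) := by
    intro ν hν
    have hpi : (2 * π * Complex.I : ℂ) ^ k ≠ 0 := pow_ne_zero _ Complex.two_pi_I_ne_zero
    have h1 := (tendsto_logAvg (hν' ν hν) (hlim _ (hν' ν hν))).const_mul
      ((m.factorial : ℂ) ^ k * ((2 * π * Complex.I) ^ k)⁻¹ * (normConst m ν)⁻¹)
    -- The constant chosen for the leading term also gives limit 1, because C_m gains exactly the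
    -- binomials that arise as residues.
    have h2 : (m.factorial : ℂ) ^ k * ((2 * π * Complex.I) ^ k)⁻¹ * (normConst m ν)⁻¹ *
        (normConst m (fun i : Fin k => ν i.castSucc) * ((2 * π * Complex.I) ^ k *
        ∏ i : Fin k, complexBinom (ν i.castSucc - ν (Fin.last k) - 1) m)) = 1 := by
      field_simp
      rw [normConst_castSucc m ν]
      ring
    rw [h2] at h1
    refine h1.congr' ?_
    filter_upwards [eventually_goodRadius] with x hx
    have hB : prodSinh x ≠ 0 := by
      refine prodSinh_ne_zero_of_expTwo fun i j hij h => ?_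
      have h3 := hx.2.2 i j hij
      rw [h, sub_self, norm_zero] at h3
      exact absurd h3 (not_lt.2 (by positivity))
    have h4 := logAvg_baPart m hG ν hx
    have h5 := resHat_eq m G hB ν
    rw [resHat] at h5
    have he := Complex.exp_ne_zero (2 * ∑ i, ν i * x i)
    have h6 : logAvg (1 / 2) (fun p => kern m (ν (Fin.last k)) p.1 p.2 *
        baPart m P p.2 (fun i => ν i.castSucc)) x = resConst k m * (2 * π * Complex.I) ^ k *
          (MvPolynomial.eval ν (resPoly m G x) * Complex.exp (2 * ∑ i, ν i * x i)) := by
      rw [h4, ← h5]; ring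
    rw [h6, hratio x hB, hc]
    generalize (2 * π * Complex.I : ℂ) ^ k = e at *
    field_simp
  refine ⟨P', ⟨fun x => totalDegree_le_of_degLT (htop x).degLT,
    fun x => (htop x).homogeneousComponent_eq, fun ν hν x hx => ?_, fun ν hν => ?_⟩, hnorm,
    fun x hx ν _ => hc ▸ hfun x hx ν⟩
  · have h1 : (fun y => P'.toFun m y ν) =ᶠ[nhds x]
        fun y => c * (normConst m ν)⁻¹ * resHat m G y ν := by
      filter_upwards [(continuous_prodSinh.continuousAt (x := x)).eventually_ne hx] with y hy
      exact hfun y hy ν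
    rw [sutherlandOp_congr m h1, sutherlandOp_const_mul, resHat_eigen hP hG (hν' ν hν) hx,
      hfun x hx]
    ring
  · exact (hnorm ν hν).comp (tendsto_ofReal_chamberAtTop (k + 1))

/-- With no particles P = 1, and every product and sum involved is empty. -/
theorem isBANumerator_zero (m : ℕ) :
    IsBANumerator 0 m (Finsupp.single 0 1) ∧ ∀ ν : Fin 0 → ℂ, normConst m ν ≠ 0 →
      Tendsto (fun x => TrigPoly.ratio m (Finsupp.single 0 1) x ν) (complexChamber 0) (nhds 1) := by
  have h1 : ∀ x : Fin 0 → ℂ, TrigPoly.polyAt (Finsupp.single 0 1) x = 1 := fun x => by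
    rw [TrigPoly.polyAt_single, trigChar_zero]; simp
  have h2 : ∀ x ν : Fin 0 → ℂ, TrigPoly.ratio m (Finsupp.single 0 1) x ν = 1 := fun x ν => by
    rw [TrigPoly.ratio, h1]; simp [prodSinh, normConst]
  refine ⟨⟨fun x => by rw [h1]; simp, fun x => ?_, fun ν _ x _ => by simp [sutherlandOp],
    fun ν _ => by simp only [h2]; exact tendsto_const_nhds⟩,
    fun ν _ => by simp only [h2]; exact tendsto_const_nhds⟩
  rw [h1]
  simp [prodSinh, prodDiff]

theorem exists_prodDiff_mul (P : TrigPoly k) :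
    ∃ G : TrigPoly k, ∀ z ν, G.ev z ν = prodDiff (expTwo z) * P.ev z ν := by
  obtain ⟨G, hG⟩ := (trigAlg k).mul_mem prodDiff_expTwo_mem_trigAlg
    (⟨P, fun _ _ => rfl⟩ : P.ev ∈ trigAlg k)
  exact ⟨G, fun z ν => (hG z ν).symm⟩

theorem exists_isBANumerator (n m : ℕ) : ∃ P : TrigPoly n, IsBANumerator n m P ∧
    ∀ ν : Fin n → ℂ, normConst m ν ≠ 0 →
      Tendsto (fun x => P.ratio m x ν) (complexChamber n) (nhds 1) := by
  induction n with
  | zero => exact ⟨_, isBANumerator_zero m⟩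
  | succ n ih =>
    obtain ⟨P, hP, hlim⟩ := ih
    obtain ⟨G, hG⟩ := exists_prodDiff_mul P
    obtain ⟨P', h1, h2, -⟩ := exists_isBANumerator_succ hP hlim hG
    exact ⟨P', h1, h2⟩

end existence

/-! ### The residue formula -/

theorem mainTheorem5 (k m : ℕ) :
    (∃! P : TrigPoly k, IsBANumerator k m P) ∧
    (∃! P : TrigPoly (k + 1), IsBANumerator (k + 1) m P) ∧
    ∀ (x ν : Fin (k + 1) → ℂ) (ε : ℝ),
      normConst m ν ≠ 0 →
      0 < ε →
      (∀ i : Fin k, ε < ‖Complex.exp (2 * x i.castSucc)‖) →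
      (∀ i j : Fin (k + 1), i ≠ j →
        2 * ε < ‖Complex.exp (2 * x i) - Complex.exp (2 * x j)‖) →
      TorusIntegrable (residueIntegrand k m x ν)
        (fun i : Fin k => Complex.exp (2 * x i.castSucc)) (fun _ => ε) ∧
      (∏ i : Fin (k + 1), Complex.exp (2 * ν (Fin.last k) * x i)) *
          torusIntegral (residueIntegrand k m x ν)
            (fun i : Fin k => Complex.exp (2 * x i.castSucc)) (fun _ => ε) =
        (2 * π * Complex.I) ^ k *
          (∏ i : Fin k, complexBinom (ν i.castSucc - ν (Fin.last k) - 1) m) *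
          trigBA (k + 1) m x ν := by
  obtain ⟨P, hP, hlim⟩ := exists_isBANumerator k m
  obtain ⟨G, hG⟩ := exists_prodDiff_mul P
  obtain ⟨P', hP', -, hfun⟩ := exists_isBANumerator_succ hP hlim hG
  refine ⟨⟨P, hP, fun Q hQ => hQ.unique hP⟩, ⟨P', hP', fun Q hQ => hQ.unique hP'⟩,
    fun x ν ε hν hε₀ hε hu => ?_⟩
  obtain ⟨h1, h2⟩ := torusIntegral_residueIntegrand m hP hG x ν hε₀ hε hu
  refine ⟨h1, ?_⟩
  have hB : prodSinh x ≠ 0 := prodSinh_ne_zero_of_expTwo fun i j hij h => by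
    have h3 := hu i j hij
    have h4 : Complex.exp (2 * x i) = Complex.exp (2 * x j) := h
    rw [h4, sub_self, norm_zero] at h3
    linarith
  rw [trigBA_eq hP', hfun x hB ν hν, resHat, ← Complex.exp_sum, ← Finset.mul_sum]
  refine (congrArg _ h2).trans ?_
  have h5 := normConst_castSucc m ν
  have h6 : normConst m (fun i : Fin k => ν i.castSucc) ≠ 0 := fun h => hν (by rw [h5, h, zero_mul])
  -- Both sides are now multiples of `resHat`; the ratio of the two constants C_m produces the
  -- binomials.
  have h7 : (normConst m fun i : Fin k => ν i.castSucc)⁻¹ = (normConst m ν)⁻¹ *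
      ((m.factorial : ℂ) ^ k *
        ∏ i : Fin k, complexBinom (ν i.castSucc - ν (Fin.last k) - 1) m) := by
    rw [inv_mul_eq_div, eq_div_iff hν, h5, inv_mul_cancel_left₀ h6]
  rw [h7]
  ring
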